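/- Identify $\mathbb R^{2,1}$ with $\mathfrak{su}_{1,1}$, with orthogonal basis $e_1=\sigma_1$, $e_2=-\sigma_2$, $e_3=i\sigma_3$ (Pauli matrices) and $\langle X,Y\rangle=\tfrac12\operatorname{tr}(XY)$. Write $z=x+iy$. A conformal spacelike immersion $f:U\to\mathbb R^{2,1}$ of an open set $U\subset\mathbb C$ (smooth, with $\langle f_x,f_x\rangle=\langle f_y,f_y\rangle=E>0$ and $\langle f_x,f_y\rangle=0$) has unit normal $N=-\tfrac1{2E}[f_x,f_y]$ and mean curvature $\langle f_{xx}+f_{yy},N\rangle/(2E)$. It is *equivariant with respect to $y$* if $U$ is invariant under $y\mapsto y+t$ for all $t\in\mathbb R$ and there is a continuous homomorphism $t\mapsto R_t$ from $\mathbb R$ to the isometry group of $\mathbb R^{2,1}$ with $f(x,y+t)=R_tf(x,y)$ on $U$. Let $\mathcal H^{\mathbb C}$ be the group of continuous loops $X:\mathbb S^1\to SL_2\mathbb C$ with $\sigma_3X(-\lambda)\sigma_3=X(\lambda)$, let $\mathcal H^{\mathbb C}_{+}$ and $\mathcal H^{\mathbb C}_-$ be the subgroups of loops that extend continuously to the closure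 of, and holomorphically to, the disc $|\lambda|<1$, respectively the disc $|\lambda|>1$ including $\infty$. Let $\tau(X)(\lambda)=\sigma_3\,(\overline{X(\lambda)}^{\,t})^{-1}\sigma_3$ for $\lambda\in\mathbb S^1$, let $\mathcal H=\{X\in\mathcal H^{\mathbb C}:\tau(X)=\pm X\}$, and let $\mathcal B_{1,1}=\{X\in\mathcal H^{\mathbb C}:\tau(X)^{-1}X\in\mathcal H^{\mathbb C}_-\cdot\mathcal H^{\mathbb C}_+\}$. For real numbers $a\ne0$, $b\neq0$ and $c$ put $$A=\begin{pmatrix}c&a\lambda^{-1}+b\lambda\\-a\lambda-b\lambda^{-1}&-c\end{pmatrix},\qquad \phi(z)=\exp(zA),$$ so that $\phi$ is the solution of $d\phi=\phi A\,dz$ with $\phi(0)=I$, and put $\Sigma^\circ=\{z\in\mathbb C:\phi(z)\in\mathcal B_{1,1}\}$. A *frame* for $A\,dz$ is a choice, for each $z\in\Sigma^\circ$, of a factor $F(z)\in\mathcal H$ in a splitting $\phi(z)=F(z)B(z)$ with $B(z)\in\mathcal H^{\mathbb C}_+$. For real $H\ne0$ and $\lambda_0\in\mathbb S^1$, the Sym-Bobenko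 formula is $$\hat f^{\lambda_0}=-\frac1{2H}\Bigl(F\,i\sigma_3F^{-1}+2i\lambda\,(\partial_\lambda F)F^{-1}\Bigr)\Big|_{\lambda=\lambda_0}.$$ 1. For all real $a\ne0$, $b\ne0$, $c$ and $H\neq0$ and all $\lambda_0\in\mathbb S^1$: $0\in\Sigma^\circ$, a frame for $A\,dz$ exists, and for every frame the Sym-Bobenko formula is defined on $\Sigma^\circ$ and gives a conformal spacelike immersion $\hat f^{\lambda_0}:\Sigma^\circ\to\mathbb R^{2,1}$ of constant mean curvature $H$ of the open set $\Sigma^\circ$, which is equivariant with respect to $y$. 2. Conversely, let $H\ne0$ be real, let $U\subset\mathbb C$ be open and connected, let $f:U\to\mathbb R^{2,1}$ be a conformal spacelike immersion of constant mean curvature $H$ which is equivariant with respect to $y$ and not totally umbilic, and let $z_0\in U$ be any base point. Then there are real numbers $a\ne0$, $b\neq0$ and $c$, some $\lambda_0\in\mathbb S^1$, a frame for $A\,dz$, and an isometry $g$ of $\mathbb R^{2,1}$ such that, for all $z\in U$, $z-z_0\in\Sigma^\circ$ and $f(z)=g\bigl(\hat f^{\lambda_0}(z-z_0)\bigr)$,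 where $\hat f^{\lambda_0}$ is formed with the given $H$. -/

import Mathlib

open scoped ContDiff Pointwise Matrix

/-! ## Minkowski space and its isometries -/

/-- The space `ℝ^{2,1}`, in the coordinates with respect to the basis
`e₁ = σ₁, e₂ = -σ₂, e₃ = i σ₃` of `su(1,1)`. -/
abbrev R21 : Type := Fin 3 → ℝ

/-- The Lorentzian inner product of signature `(+,+,-)`. -/
def lorentz (p q : R21) : ℝ := p 0 * q 0 + p 1 * q 1 - p 2 * q 2

/-- The identification `p ↦ p₁ σ₁ - p₂ σ₂ + p₃ i σ₃` of `ℝ^{2,1}` with `su(1,1)`. -/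
noncomputable def toSu11 (p : R21) : Matrix (Fin 2) (Fin 2) ℂ :=
  !![Complex.I * (p 2 : ℂ), (p 0 : ℂ) + Complex.I * (p 1 : ℂ);
     (p 0 : ℂ) - Complex.I * (p 1 : ℂ), -(Complex.I * (p 2 : ℂ))]

/-- The Lorentzian inner product is `⟨X, Y⟩ = ½ tr (X Y)` on `su(1,1)`. -/
theorem trace_toSu11_mul (p q : R21) :
    (1 / 2 : ℂ) * (toSu11 p * toSu11 q).trace = (lorentz p q : ℂ) := by
  simp only [toSu11, lorentz, Matrix.mul_fin_two, Matrix.trace_fin_two_of]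
  push_cast
  ring_nf
  simp only [Complex.I_sq]
  ring

/-- The Lorentzian cross product, with `e₁ × e₂ = e₃`; in `su(1,1)` it is `-½ [X, Y]`. -/
def lorentzCross (u v : R21) : R21 :=
  ![-(u 1 * v 2 - u 2 * v 1), -(u 2 * v 0 - u 0 * v 2), u 0 * v 1 - u 1 * v 0]

theorem toSu11_lorentzCross (u v : R21) :
    toSu11 (lorentzCross u v) =
      (-(1 / 2) : ℂ) • (toSu11 u * toSu11 v - toSu11 v * toSu11 u) := by
  ext i j
  fin_cases i <;> fin_cases j <;>
    simp [toSu11, lorentzCross] <;> ring_nf <;>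
    simp only [Complex.I_sq] <;> ring

/-- An affine bijection of `ℝ^{2,1}` is an isometry if its linear part preserves the
Lorentzian inner product. -/
def IsLorentzIsometry (g : R21 ≃ᵃ[ℝ] R21) : Prop :=
  ∀ p q : R21, lorentz (g.linear p) (g.linear q) = lorentz p q

/-! ## Surfaces in Minkowski space -/

/-- The partial derivative `∂/∂x`, where `z = x + i y`. -/
noncomputable def partialX (f : ℂ → R21) (z : ℂ) : R21 := fderiv ℝ f z 1

/-- The partial derivative `∂/∂y`, where `z = x + i y`. -/
noncomputable def partialY (f : ℂ → R21) (z : ℂ) : R21 := fderiv ℝ f z Complex.I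

/-- The unit timelike normal `N = (f_x × f_y) / ⟨f_x, f_x⟩` of a conformal spacelike immersion.
If `F` is a frame with `F e₁ F⁻¹ = f_x / |f_x|` and `F e₂ F⁻¹ = f_y / |f_y|`, then
`N = F e₃ F⁻¹`. -/
noncomputable def unitNormal (f : ℂ → R21) (z : ℂ) : R21 :=
  (lorentz (partialX f z) (partialX f z))⁻¹ • lorentzCross (partialX f z) (partialY f z)

/-- The mean curvature of a conformal spacelike immersion with metric `E (dx² + dy²)`:
`H = ⟨f_xx + f_yy, N⟩ / (2 E)`. -/
noncomputable def meanCurvature (f : ℂ → R21) (z : ℂ) : ℝ :=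
  lorentz (partialX (partialX f) z + partialY (partialY f) z) (unitNormal f z) /
    (2 * lorentz (partialX f z) (partialX f z))

/-- `f` is a smooth conformal spacelike immersion of the open set `U` with constant mean
curvature `H`. Values of `f` outside `U` play no role. -/
structure IsConformalCMCImmersion (U : Set ℂ) (f : ℂ → R21) (H : ℝ) : Prop where
  isOpen : IsOpen U
  smooth : ContDiffOn ℝ ∞ f U
  spacelike : ∀ z ∈ U, 0 < lorentz (partialX f z) (partialX f z)
  conformal : ∀ z ∈ U,
    lorentz (partialY f z) (partialY f z) = lorentz (partialX f z) (partialX f z) ∧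
      lorentz (partialX f z) (partialY f z) = 0
  cmc : ∀ z ∈ U, meanCurvature f z = H

/-- `z` is an umbilic point: the second fundamental form is a multiple of the first. -/
def IsUmbilicAt (f : ℂ → R21) (z : ℂ) : Prop :=
  ∃ k : ℝ,
    lorentz (partialX (partialX f) z) (unitNormal f z) =
        k * lorentz (partialX f z) (partialX f z) ∧
      lorentz (partialX (partialY f) z) (unitNormal f z) =
        k * lorentz (partialX f z) (partialY f z) ∧
      lorentz (partialY (partialY f) z) (unitNormal f z) =
        k * lorentz (partialY f z) (partialY f z)

/-- `f : U → ℝ^{2,1}` is equivariant with respect to `y`: there is a continuous homomorphism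
`t ↦ R t` from `ℝ` to the isometry group with `f (x, y + t) = R t (f (x, y))`. In particular
`U` is invariant under translations in `y`. -/
def IsEquivariantInY (U : Set ℂ) (f : ℂ → R21) : Prop :=
  ∃ R : ℝ → (R21 ≃ᵃ[ℝ] R21),
    (∀ t, IsLorentzIsometry (R t)) ∧
    (∀ s t, R (s + t) = R s * R t) ∧
    (∀ p, Continuous fun t => R t p) ∧
    ∀ z ∈ U, ∀ t : ℝ, z + (t : ℂ) * Complex.I ∈ U ∧ f (z + (t : ℂ) * Complex.I) = R t (f z)

/-! ## Loop groups

Loops are matrix valued functions on the unit circle. The loop groups below consist of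
continuous loops; this class contains the Sobolev classes `H^s` for every `s > 1/2`. -/

/-- Matrix valued functions on the unit circle, with pointwise product and inverse. -/
abbrev MatLoop : Type := Circle → Matrix (Fin 2) (Fin 2) ℂ

/-- The Pauli matrix `σ₃`. -/
def sigma3 : Matrix (Fin 2) (Fin 2) ℂ := !![1, 0; 0, -1]

/-- The twisted loop group `ΛSL₂(ℂ)_σ`: continuous `SL₂(ℂ)` valued loops with
`σ₃ x(-λ) σ₃⁻¹ = x(λ)`. -/
def twistedLoops : Set MatLoop :=
  {x | Continuous x ∧ (∀ l, (x l).det = 1) ∧ ∀ l, sigma3 * x (-l) * sigma3 = x l}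

/-- The involution `τ(x)(λ) = σ₃ ((conj x(1 / conj λ))ᵗ)⁻¹ σ₃`; note `1 / conj λ = λ` for
`|λ| = 1`. -/
noncomputable def tauLoop (x : MatLoop) : MatLoop :=
  fun l => sigma3 * ((x l)ᴴ)⁻¹ * sigma3

/-- The real form: twisted loops with `τ(x) = x` or `τ(x) = -x`. -/
def realLoops : Set MatLoop :=
  {x | x ∈ twistedLoops ∧ (tauLoop x = x ∨ tauLoop x = -x)}

/-- Twisted loops that extend holomorphically to the open unit disc. -/
def plusLoops : Set MatLoop :=
  {x | x ∈ twistedLoops ∧ ∃ g : ℂ → Matrix (Fin 2) (Fin 2) ℂ,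
    (∀ i j, DiffContOnCl ℂ (fun w => g w i j) (Metric.ball 0 1)) ∧
      ∀ l : Circle, x l = g (l : ℂ)}

/-- Twisted loops that extend holomorphically to the exterior disc, including `∞`. -/
def minusLoops : Set MatLoop :=
  {x | x ∈ twistedLoops ∧ ∃ g : ℂ → Matrix (Fin 2) (Fin 2) ℂ,
    (∀ i j, DiffContOnCl ℂ (fun w => g w i j) (Metric.ball 0 1)) ∧
      ∀ l : Circle, x l = g ((l : ℂ)⁻¹)}

/-- The Birkhoff big cell of the twisted loop group. -/
def birkhoffBigCell : Set MatLoop := minusLoops * plusLoops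

/-- The `G`-Iwasawa big cell: twisted loops `x` such that `τ(x)⁻¹ x` lies in the Birkhoff
big cell. -/
def iwasawaBigCell : Set MatLoop :=
  {x | x ∈ twistedLoops ∧ (tauLoop x)⁻¹ * x ∈ birkhoffBigCell}

/-! ## The DPW construction for the potential `A dz` -/

/-- The matrix `A(λ)` of the potential `A dz`. -/
noncomputable def dpwA (a b c : ℝ) (l : Circle) : Matrix (Fin 2) (Fin 2) ℂ :=
  !![(c : ℂ), (a : ℂ) * (l : ℂ)⁻¹ + (b : ℂ) * (l : ℂ);
     -((a : ℂ) * (l : ℂ)) - (b : ℂ) * (l : ℂ)⁻¹, -(c : ℂ)]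

/-- The solution `φ(z) = exp(z A)` of `dφ = φ A dz` with `φ(0) = I`. -/
noncomputable def dpwSolution (a b c : ℝ) (z : ℂ) : MatLoop :=
  fun l => NormedSpace.exp (z • dpwA a b c l)

/-- The open set of all `z` for which `φ(z)` lies in the `G`-Iwasawa big cell. -/
def dpwDomain (a b c : ℝ) : Set ℂ := {z | dpwSolution a b c z ∈ iwasawaBigCell}

/-- `F` is the first factor of a `G`-Iwasawa splitting `φ = F B` over the set `dpwDomain`. -/
def IsIwasawaFrame (a b c : ℝ) (F : ℂ → MatLoop) : Prop :=
  ∀ z ∈ dpwDomain a b c, F z ∈ realLoops ∧ ∃ B ∈ plusLoops, dpwSolution a b c z = F z * B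

/-- The Sym-Bobenko formula
`p = -(1 / (2 H)) (F i σ₃ F⁻¹ + 2 i λ ∂_λ F F⁻¹)` at `λ = l₀`. With `λ = l₀ exp(i θ)` one has
`i λ ∂_λ = ∂_θ`, and `D` is the derivative of `F` in `θ`, which is required to exist. -/
def IsSymBobenko (H : ℝ) (l₀ : Circle) (F : MatLoop) (p : R21) : Prop :=
  ∃ D : Matrix (Fin 2) (Fin 2) ℂ,
    (∀ i j, HasDerivAt (fun θ : ℝ => F (l₀ * Circle.exp θ) i j) (D i j) 0) ∧
      toSu11 p = (-(1 / (2 * (H : ℂ)))) •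
        (F l₀ * (Complex.I • sigma3) * (F l₀)⁻¹ + (2 : ℂ) • (D * (F l₀)⁻¹))

/-- `f` is the map obtained from the Iwasawa frame `F` of the potential `A dz` by the
Sym-Bobenko formula for `H` and `l₀`, at every point where the frame is defined. -/
def IsSymBobenkoSurface (a b c H : ℝ) (l₀ : Circle) (F : ℂ → MatLoop) (f : ℂ → R21) : Prop :=
  ∀ z ∈ dpwDomain a b c, IsSymBobenko H l₀ (F z) (f z)

/-! Both directions meet in one first order system, `FrameSystem`: an adapted Lorentz frame, a map
`f`, and two functions `v`, `r` of `x` alone with `v' = 2vr` and `r' = 2a²v² - 2b²v⁻²`. With `a` and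
`H` nonzero, every solution is a conformal immersion of mean curvature `H`
(`FrameSystem.isConformalCMCImmersion`), and on a connected domain two solutions with the same
constants and the same `v`, `r` differ by an isometry (`FrameSystem.exists_isometry`).

From the potential to the surface: `A` commutes with `φ = FB`, so `L = B A B⁻¹ = F⁻¹ A F`. The first
form shows that `L` has at worst a simple pole at `λ = 0`, the second that `τ(L) = -L`; hence `L`
has the shape of `A` again, with coefficients `aβ²`, `bβ⁻²` and some real `r` (`exists_conj_dpwA`).
Therefore `φ(z₀ + w) = F₀ exp(wL) B₀` near any point `z₀` of the domain, and only a neighbourhood of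
`0` has to be studied. There the splitting is explicit: if `v`, `r` solve the system above with
`v(0) = 1`, `r(0) = c`, then `L(x)`, the potential matrix with coefficients `av`, `bv⁻¹`, `r`,
satisfies a Lax equation. The part of `L` relevant to `B` is polynomial in `λ`, so `B` solves a
linear equation and is entire in `λ`. As `φ(iy)` is itself real, left multiplication by it extends
the splitting to a strip (`ProfileSystem.exists_frame`) and also gives the equivariance.

From the surface to the potential: the fundamental forms do not depend on `y`. The Codazzi equations
then say that the Hopf differential is constant, and the Gauss equation becomes the ordinary
differential equation for `v`, `r`. The modulus of the Hopf differential gives `b`, its phase gives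
`λ₀²`, and the conformal factor at `z₀` gives `a`. The surface built from this profile solves the
same system on all of `U`, so rigidity finishes the proof.

Two analytic facts make the Sym-Bobenko formula meaningful for an arbitrary frame: two splittings
differ by a constant unitary diagonal matrix (`eq_mul_diag_of_splittings`), and the real factor is
differentiable along the circle by Schwarz reflection (`differentiableAt_of_splitting`). -/

/-! ## Gradients of functions on the plane -/

section Gradient

variable {E : Type*} [NormedAddCommGroup E] [NormedSpace ℝ E]

/-- `g` is real differentiable at `z` with partial derivatives `X` and `Y`. -/
def HasGrad (g : ℂ → E) (X Y : E) (z : ℂ) : Prop :=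
  HasFDerivAt g (Complex.reCLM.smulRight X + Complex.imCLM.smulRight Y) z

theorem HasGrad.fderiv_one {g : ℂ → E} {X Y : E} {z : ℂ} (h : HasGrad g X Y z) :
    fderiv ℝ g z 1 = X := by
  rw [HasFDerivAt.fderiv h]; simp

theorem HasGrad.fderiv_I {g : ℂ → E} {X Y : E} {z : ℂ} (h : HasGrad g X Y z) :
    fderiv ℝ g z Complex.I = Y := by
  rw [HasFDerivAt.fderiv h]; simp

theorem HasGrad.partialX {g : ℂ → R21} {X Y : R21} {z : ℂ} (h : HasGrad g X Y z) :
    partialX g z = X := h.fderiv_one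

theorem HasGrad.partialY {g : ℂ → R21} {X Y : R21} {z : ℂ} (h : HasGrad g X Y z) :
    partialY g z = Y := h.fderiv_I

theorem DifferentiableAt.hasGrad {g : ℂ → E} {z : ℂ} (h : DifferentiableAt ℝ g z) :
    HasGrad g (fderiv ℝ g z 1) (fderiv ℝ g z Complex.I) z := by
  refine HasFDerivAt.congr_fderiv h.hasFDerivAt (ContinuousLinearMap.ext fun w => ?_)
  have hw : w = w.re • (1 : ℂ) + w.im • Complex.I := by
    apply Complex.ext <;> simp
  conv_lhs => rw [hw]
  rw [map_add, map_smul, map_smul]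
  simp

theorem HasGrad.differentiableAt {g : ℂ → E} {X Y : E} {z : ℂ} (h : HasGrad g X Y z) :
    DifferentiableAt ℝ g z := HasFDerivAt.differentiableAt h

theorem HasGrad.unique {g : ℂ → E} {X Y X' Y' : E} {z : ℂ} (h : HasGrad g X Y z)
    (h' : HasGrad g X' Y' z) : X = X' ∧ Y = Y' :=
  ⟨h.fderiv_one.symm.trans h'.fderiv_one, h.fderiv_I.symm.trans h'.fderiv_I⟩

theorem HasGrad.congr_of_eventuallyEq {g g' : ℂ → E} {X Y : E} {z : ℂ} (h : HasGrad g X Y z)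
    (h' : g' =ᶠ[nhds z] g) : HasGrad g' X Y z :=
  HasFDerivAt.congr_of_eventuallyEq h h'

theorem HasGrad.congr_grad {g : ℂ → E} {X Y X' Y' : E} {z : ℂ} (h : HasGrad g X Y z)
    (hX : X = X') (hY : Y = Y') : HasGrad g X' Y' z := hX ▸ hY ▸ h

theorem hasGrad_const (e : E) (z : ℂ) : HasGrad (fun _ => e) 0 0 z := by
  refine HasFDerivAt.congr_fderiv (hasFDerivAt_const e z) (ContinuousLinearMap.ext fun w => ?_)
  simp

theorem HasGrad.add {g h : ℂ → E} {X Y X' Y' : E} {z : ℂ} (hg : HasGrad g X Y z)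
    (hh : HasGrad h X' Y' z) : HasGrad (fun w => g w + h w) (X + X') (Y + Y') z := by
  refine HasFDerivAt.congr_fderiv (HasFDerivAt.fun_add hg hh) (ContinuousLinearMap.ext fun w => ?_)
  simp only [_root_.add_apply, ContinuousLinearMap.smulRight_apply, smul_add]; abel

theorem HasGrad.sub {g h : ℂ → E} {X Y X' Y' : E} {z : ℂ} (hg : HasGrad g X Y z)
    (hh : HasGrad h X' Y' z) : HasGrad (fun w => g w - h w) (X - X') (Y - Y') z := by
  refine HasFDerivAt.congr_fderiv (HasFDerivAt.fun_sub hg hh) (ContinuousLinearMap.ext fun w => ?_)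
  simp [smul_sub]; abel

theorem HasGrad.clm_comp {F : Type*} [NormedAddCommGroup F] [NormedSpace ℝ F] (T : E →L[ℝ] F)
    {g : ℂ → E} {X Y : E} {z : ℂ} (hg : HasGrad g X Y z) :
    HasGrad (fun w => T (g w)) (T X) (T Y) z := by
  refine HasFDerivAt.congr_fderiv (T.hasFDerivAt.comp z hg) (ContinuousLinearMap.ext fun w => ?_)
  simp

theorem HasGrad.smul {s : ℂ → ℝ} {g : ℂ → E} {a b : ℝ} {X Y : E} {z : ℂ} (hs : HasGrad s a b z)
    (hg : HasGrad g X Y z) :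
    HasGrad (fun w => s w • g w) (a • g z + s z • X) (b • g z + s z • Y) z := by
  refine HasFDerivAt.congr_fderiv (HasFDerivAt.fun_smul hs hg) (ContinuousLinearMap.ext fun w => ?_)
  simp only [_root_.add_apply, ContinuousLinearMap.smulRight_apply, smul_eq_mul,
    _root_.smul_apply]
  module

theorem HasGrad.mul {s t : ℂ → ℝ} {a b a' b' : ℝ} {z : ℂ} (hs : HasGrad s a b z)
    (ht : HasGrad t a' b' z) :
    HasGrad (fun w => s w * t w) (a * t z + s z * a') (b * t z + s z * b') z := hs.smul ht

theorem HasGrad.inv {s : ℂ → ℝ} {a b : ℝ} {z : ℂ} (hs : HasGrad s a b z) (h0 : s z ≠ 0) :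
    HasGrad (fun w => (s w)⁻¹) (-a / s z ^ 2) (-b / s z ^ 2) z := by
  refine HasFDerivAt.congr_fderiv ((hasDerivAt_inv h0).comp_hasFDerivAt z hs) (ContinuousLinearMap.ext fun w => ?_)
  simp; ring

theorem HasGrad.const_smul (c : ℝ) {g : ℂ → E} {X Y : E} {z : ℂ} (hg : HasGrad g X Y z) :
    HasGrad (fun w => c • g w) (c • X) (c • Y) z := by
  simpa using (hasGrad_const c z).smul hg

theorem HasGrad.neg {g : ℂ → E} {X Y : E} {z : ℂ} (hg : HasGrad g X Y z) :
    HasGrad (fun w => -g w) (-X) (-Y) z := by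
  simpa using hg.const_smul (-1)

theorem HasGrad.of_re {g : ℝ → E} {X : E} {z : ℂ} (hg : HasDerivAt g X z.re) :
    HasGrad (fun w => g w.re) X 0 z := by
  refine HasFDerivAt.congr_fderiv 
    (HasFDerivAt.comp z (show HasFDerivAt g _ (Complex.reCLM z) from hg.hasFDerivAt)
    Complex.reCLM.hasFDerivAt) (ContinuousLinearMap.ext fun w => ?_)
  simp

theorem HasGrad.of_im {g : ℝ → E} {X : E} {z : ℂ} (hg : HasDerivAt g X z.im) :
    HasGrad (fun w => g w.im) 0 X z := by
  refine HasFDerivAt.congr_fderiv 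
    (HasFDerivAt.comp z (show HasFDerivAt g _ (Complex.imCLM z) from hg.hasFDerivAt)
    Complex.imCLM.hasFDerivAt) (ContinuousLinearMap.ext fun w => ?_)
  simp

theorem HasGrad.comp_sub {g : ℂ → E} {X Y : E} {z w₀ : ℂ} (hg : HasGrad g X Y (z - w₀)) :
    HasGrad (fun w => g (w - w₀)) X Y z := by
  refine HasFDerivAt.congr_fderiv
    (HasFDerivAt.comp z hg ((hasFDerivAt_id z).sub_const w₀)) (ContinuousLinearMap.ext fun w => ?_)
  simp

theorem HasGrad.prodMk {F : Type*} [NormedAddCommGroup F] [NormedSpace ℝ F]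
    {g : ℂ → E} {h : ℂ → F} {X Y : E} {X' Y' : F} {z : ℂ}
    (hg : HasGrad g X Y z) (hh : HasGrad h X' Y' z) :
    HasGrad (fun w => (g w, h w)) (X, X') (Y, Y') z := by
  refine HasFDerivAt.congr_fderiv (HasFDerivAt.prodMk hg hh) (ContinuousLinearMap.ext fun w => ?_)
  simp

theorem hasGrad_pi {g : ℂ → R21} {X Y : R21} {z : ℂ} :
    HasGrad g X Y z ↔ ∀ i, HasGrad (fun w => g w i) (X i) (Y i) z := by
  constructor
  · intro h i
    exact h.clm_comp (ContinuousLinearMap.proj i)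
  · intro h
    refine hasFDerivAt_pi'.2 fun i =>
      HasFDerivAt.congr_fderiv (h i) (ContinuousLinearMap.ext fun w => ?_)
    simp

theorem HasGrad.lorentz {u v : ℂ → R21} {X Y X' Y' : R21} {z : ℂ} (hu : HasGrad u X Y z)
    (hv : HasGrad v X' Y' z) :
    HasGrad (fun w => lorentz (u w) (v w)) (lorentz X (v z) + lorentz (u z) X')
      (lorentz Y (v z) + lorentz (u z) Y') z := by
  rw [hasGrad_pi] at hu hv
  refine ((((hu 0).mul (hv 0)).add ((hu 1).mul (hv 1))).sub ((hu 2).mul (hv 2))).congr_grad ?_ ?_ <;>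
  · simp only [_root_.lorentz]; ring

/-- A function on an open set which satisfies an autonomous first order system with smooth right
hand side is smooth. -/
theorem contDiffOn_of_hasFDerivAt_eq {U : Set ℂ} (hU : IsOpen U) {V : Set E}
    {G : E → ℂ →L[ℝ] E} (hG : ContDiffOn ℝ ∞ G V) {g : ℂ → E} (hgV : ∀ z ∈ U, g z ∈ V)
    (hg : ∀ z ∈ U, HasFDerivAt g (G (g z)) z) : ContDiffOn ℝ ∞ g U := by
  rw [contDiffOn_infty]
  intro n
  induction n with
  | zero => exact contDiffOn_zero.2 fun z hz => (hg z hz).continuousAt.continuousWithinAt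
  | succ n ih =>
    have := (contDiffOn_succ_iff_fderiv_of_isOpen (𝕜 := ℝ) (f := g) (n := n) hU).2
      ⟨fun z hz => (hg z hz).differentiableAt.differentiableWithinAt, by simp, ?_⟩
    · exact_mod_cast this
    -- Bootstrapping: the derivative of `g` is `G ∘ g`, which inherits the regularity already known
    -- for `g`.
    · have h1 : ContDiffOn ℝ n (fun z => G (g z)) U :=
        (hG.of_le (by exact_mod_cast le_top)).comp ih hgV
      exact h1.congr fun z hz => (hg z hz).fderiv

end Gradient


/-! ## The structure equations -/

/-- The structure equations of the surfaces obtained from the potential `A dz`, for a conformal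
factor `2 a v / H`, with `p + i q = λ₀²`. The adapted frame is `e₁, e₂, e₃`. -/
structure FrameSystem (a b H p q : ℝ) (U : Set ℂ) (v r : ℂ → ℝ) (e₁ e₂ e₃ f : ℂ → R21) :
    Prop where
  isOpen : IsOpen U
  v_ne : ∀ z ∈ U, v z ≠ 0
  grad_v : ∀ z ∈ U, HasGrad v (2 * v z * r z) 0 z
  grad_r : ∀ z ∈ U, HasGrad r (2 * a ^ 2 * v z ^ 2 - 2 * b ^ 2 * (v z)⁻¹ ^ 2) 0 z
  grad_f : ∀ z ∈ U, HasGrad f ((2 * a * v z / H) • e₁ z) (-(2 * a * v z / H) • e₂ z) z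
  grad_e₁ : ∀ z ∈ U, HasGrad e₁ (-(2 * a * v z - 2 * b * p * (v z)⁻¹) • e₃ z)
    (-(2 * r z) • e₂ z + (2 * b * q * (v z)⁻¹) • e₃ z) z
  grad_e₂ : ∀ z ∈ U, HasGrad e₂ (-(2 * b * q * (v z)⁻¹) • e₃ z)
    ((2 * r z) • e₁ z + (2 * a * v z + 2 * b * p * (v z)⁻¹) • e₃ z) z
  grad_e₃ : ∀ z ∈ U, HasGrad e₃
    (-(2 * a * v z - 2 * b * p * (v z)⁻¹) • e₁ z - (2 * b * q * (v z)⁻¹) • e₂ z)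
    ((2 * b * q * (v z)⁻¹) • e₁ z + (2 * a * v z + 2 * b * p * (v z)⁻¹) • e₂ z) z
  norm_e₁ : ∀ z ∈ U, lorentz (e₁ z) (e₁ z) = 1
  norm_e₂ : ∀ z ∈ U, lorentz (e₂ z) (e₂ z) = 1
  norm_e₃ : ∀ z ∈ U, lorentz (e₃ z) (e₃ z) = -1
  orth₁₂ : ∀ z ∈ U, lorentz (e₁ z) (e₂ z) = 0
  orth₁₃ : ∀ z ∈ U, lorentz (e₁ z) (e₃ z) = 0
  orth₂₃ : ∀ z ∈ U, lorentz (e₂ z) (e₃ z) = 0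
  cross : ∀ z ∈ U, lorentzCross (e₁ z) (e₂ z) = -e₃ z

theorem lorentz_comm (u v : R21) : lorentz u v = lorentz v u := by
  simp only [lorentz]; ring

theorem lorentz_add_left (u v w : R21) : lorentz (u + v) w = lorentz u w + lorentz v w := by
  simp only [lorentz, Pi.add_apply]; ring

theorem lorentz_add_right (u v w : R21) : lorentz u (v + w) = lorentz u v + lorentz u w := by
  simp only [lorentz, Pi.add_apply]; ring

theorem lorentz_sub_left (u v w : R21) : lorentz (u - v) w = lorentz u w - lorentz v w := by
  simp only [lorentz, Pi.sub_apply]; ring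

theorem lorentz_sub_right (u v w : R21) : lorentz u (v - w) = lorentz u v - lorentz u w := by
  simp only [lorentz, Pi.sub_apply]; ring

theorem lorentz_smul_left (c : ℝ) (u v : R21) : lorentz (c • u) v = c * lorentz u v := by
  simp only [lorentz, Pi.smul_apply, smul_eq_mul]; ring

theorem lorentz_smul_right (c : ℝ) (u v : R21) : lorentz u (c • v) = c * lorentz u v := by
  simp only [lorentz, Pi.smul_apply, smul_eq_mul]; ring

theorem lorentz_neg_left (u v : R21) : lorentz (-u) v = -lorentz u v := by
  simp only [lorentz, Pi.neg_apply]; ring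

theorem lorentz_neg_right (u v : R21) : lorentz u (-v) = -lorentz u v := by
  simp only [lorentz, Pi.neg_apply]; ring

theorem lorentz_zero_left (v : R21) : lorentz 0 v = 0 := by simp [lorentz]

theorem lorentzCross_smul_smul (c d : ℝ) (u v : R21) :
    lorentzCross (c • u) (d • v) = (c * d) • lorentzCross u v := by
  ext i; fin_cases i <;> simp [lorentzCross] <;> ring

namespace FrameSystem

variable {a b H p q : ℝ} {U : Set ℂ} {v r : ℂ → ℝ} {e₁ e₂ e₃ f : ℂ → R21}

theorem contDiffOn (h : FrameSystem a b H p q U v r e₁ e₂ e₃ f) : ContDiffOn ℝ ∞ f U := by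
  -- The inverse `v⁻¹` is carried as a separate unknown `t`, so that both right hand sides are
  -- polynomial and smooth everywhere.
  let X : ℝ × ℝ × ℝ × R21 × R21 × R21 × R21 → ℝ × ℝ × ℝ × R21 × R21 × R21 × R21 :=
    fun (s, t, ρ, x₁, x₂, x₃, y) => (2 * s * ρ, -2 * t * ρ, 2 * a ^ 2 * s ^ 2 - 2 * b ^ 2 * t ^ 2,
      -(2 * a * s - 2 * b * p * t) • x₃, -(2 * b * q * t) • x₃,
      -(2 * a * s - 2 * b * p * t) • x₁ - (2 * b * q * t) • x₂, (2 * a * s / H) • x₁)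
  let Y : ℝ × ℝ × ℝ × R21 × R21 × R21 × R21 → ℝ × ℝ × ℝ × R21 × R21 × R21 × R21 :=
    fun (s, t, ρ, x₁, x₂, x₃, y) => (0, 0, 0, -(2 * ρ) • x₂ + (2 * b * q * t) • x₃,
      (2 * ρ) • x₁ + (2 * a * s + 2 * b * p * t) • x₃,
      (2 * b * q * t) • x₁ + (2 * a * s + 2 * b * p * t) • x₂, -(2 * a * s / H) • x₂)
  have hX : ContDiff ℝ ∞ X := by fun_prop
  have hY : ContDiff ℝ ∞ Y := by fun_prop
  have hG : ContDiff ℝ ∞ fun s => Complex.reCLM.smulRight (X s) + Complex.imCLM.smulRight (Y s) :=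
    contDiff_clm_apply_iff.2 fun w => (hX.const_smul w.re).add (hY.const_smul w.im)
  have key := contDiffOn_of_hasFDerivAt_eq h.isOpen (V := Set.univ) hG.contDiffOn
    (g := fun z => (v z, (v z)⁻¹, r z, e₁ z, e₂ z, e₃ z, f z)) (fun _ _ => trivial) ?_
  · exact ((contDiff_snd.comp contDiff_snd).comp ((contDiff_snd.comp contDiff_snd).comp
      (contDiff_snd.comp contDiff_snd))).comp_contDiffOn key
  · intro z hz
    have hv := h.v_ne z hz
    refine (h.grad_v z hz).prodMk (HasGrad.prodMk (((h.grad_v z hz).inv hv).congr_grad ?_ ?_)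
      ((h.grad_r z hz).prodMk ((h.grad_e₁ z hz).prodMk ((h.grad_e₂ z hz).prodMk
        ((h.grad_e₃ z hz).prodMk (h.grad_f z hz))))))
    · field_simp
    · simp

theorem isConformalCMCImmersion (h : FrameSystem a b H p q U v r e₁ e₂ e₃ f) (ha : a ≠ 0)
    (hH : H ≠ 0) : IsConformalCMCImmersion U f H := by
  have hX : ∀ z ∈ U, partialX f z = (2 * a * v z / H) • e₁ z := fun z hz => (h.grad_f z hz).partialX
  have hY : ∀ z ∈ U, partialY f z = -(2 * a * v z / H) • e₂ z :=
    fun z hz => (h.grad_f z hz).partialY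
  have hE : ∀ z ∈ U, lorentz (partialX f z) (partialX f z) = (2 * a * v z / H) ^ 2 := by
    intro z hz
    rw [hX z hz, lorentz_smul_left, lorentz_smul_right, h.norm_e₁ z hz]; ring
  have hpos : ∀ z ∈ U, 2 * a * v z / H ≠ 0 := by
    intro z hz
    have := h.v_ne z hz
    positivity
  -- Two signs cancel: `f_y` points along `-e₂`, and `e₁ × e₂ = -e₃`.
  have hN : ∀ z ∈ U, unitNormal f z = e₃ z := by
    intro z hz
    have hv := h.v_ne z hz
    rw [unitNormal, hE z hz, hX z hz, hY z hz, lorentzCross_smul_smul, h.cross z hz, smul_neg,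
      smul_neg, smul_smul, ← neg_smul]
    convert one_smul ℝ _
    field_simp
  refine ⟨h.isOpen, h.contDiffOn, fun z hz => ?_, fun z hz => ⟨?_, ?_⟩, fun z hz => ?_⟩
  · rw [hE z hz]
    have := hpos z hz
    positivity
  · rw [hE z hz, hY z hz, lorentz_smul_left, lorentz_smul_right, h.norm_e₂ z hz]; ring
  · rw [hX z hz, hY z hz, lorentz_smul_left, lorentz_smul_right, h.orth₁₂ z hz]; ring
  · have hU : U ∈ nhds z := h.isOpen.mem_nhds hz
    have hv := h.v_ne z hz
    have gv : HasGrad (fun w => 2 * a * v w / H) (2 * a * (2 * v z * r z) / H) 0 z :=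
      (((h.grad_v z hz).const_smul (2 * a / H)).congr_of_eventuallyEq
        (Filter.Eventually.of_forall fun w => by simp; ring)).congr_grad (by simp; ring) (by simp)
    have gX : HasGrad (partialX f) _ _ z := (gv.smul (h.grad_e₁ z hz)).congr_of_eventuallyEq
      (Filter.eventually_of_mem hU hX)
    have gY : HasGrad (partialY f) _ _ z := (gv.neg.smul (h.grad_e₂ z hz)).congr_of_eventuallyEq
      (Filter.eventually_of_mem hU hY)
    rw [meanCurvature, hE z hz, hN z hz, gX.partialX, gY.partialY]
    -- The terms with `b` in `f_xx` and `f_yy` are opposite; what remains is `(2av/H) · 4av = 2H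
    -- (2av/H)²`.
    simp only [lorentz_add_left, lorentz_smul_left, h.orth₁₃ z hz, h.norm_e₃ z hz, neg_zero, lorentz_zero_left, zero_smul]
    field_simp
    ring

/-- Structure equations are transported by translations of the domain. -/
theorem comp_sub (h : FrameSystem a b H p q U v r e₁ e₂ e₃ f) (w : ℂ) :
    FrameSystem a b H p q {z | z - w ∈ U} (fun z => v (z - w)) (fun z => r (z - w))
      (fun z => e₁ (z - w)) (fun z => e₂ (z - w)) (fun z => e₃ (z - w)) (fun z => f (z - w)) where
  isOpen := h.isOpen.preimage (continuous_id.sub continuous_const)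
  v_ne _ hz := h.v_ne _ hz
  grad_v _ hz := (h.grad_v _ hz).comp_sub
  grad_r _ hz := (h.grad_r _ hz).comp_sub
  grad_f _ hz := (h.grad_f _ hz).comp_sub
  grad_e₁ _ hz := (h.grad_e₁ _ hz).comp_sub
  grad_e₂ _ hz := (h.grad_e₂ _ hz).comp_sub
  grad_e₃ _ hz := (h.grad_e₃ _ hz).comp_sub
  norm_e₁ _ hz := h.norm_e₁ _ hz
  norm_e₂ _ hz := h.norm_e₂ _ hz
  norm_e₃ _ hz := h.norm_e₃ _ hz
  orth₁₂ _ hz := h.orth₁₂ _ hz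
  orth₁₃ _ hz := h.orth₁₃ _ hz
  orth₂₃ _ hz := h.orth₂₃ _ hz
  cross _ hz := h.cross _ hz

/-- Structure equations are transported by Lorentz transformations which preserve the cross
product, and by translations. -/
theorem map (h : FrameSystem a b H p q U v r e₁ e₂ e₃ f) (T : R21 →L[ℝ] R21) (t : R21)
    (hT : ∀ x y, lorentz (T x) (T y) = lorentz x y)
    (hT' : ∀ x y, lorentzCross (T x) (T y) = T (lorentzCross x y)) :
    FrameSystem a b H p q U v r (fun z => T (e₁ z)) (fun z => T (e₂ z)) (fun z => T (e₃ z))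
      (fun z => T (f z) + t) where
  isOpen := h.isOpen
  v_ne := h.v_ne
  grad_v := h.grad_v
  grad_r := h.grad_r
  grad_f z hz := (((h.grad_f z hz).clm_comp T).add (hasGrad_const t z)).congr_grad (by simp)
    (by simp)
  grad_e₁ z hz := ((h.grad_e₁ z hz).clm_comp T).congr_grad (by simp) (by simp)
  grad_e₂ z hz := ((h.grad_e₂ z hz).clm_comp T).congr_grad (by simp) (by simp)
  grad_e₃ z hz := ((h.grad_e₃ z hz).clm_comp T).congr_grad (by simp) (by simp)
  norm_e₁ z hz := by rw [hT, h.norm_e₁ z hz]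
  norm_e₂ z hz := by rw [hT, h.norm_e₂ z hz]
  norm_e₃ z hz := by rw [hT, h.norm_e₃ z hz]
  orth₁₂ z hz := by rw [hT, h.orth₁₂ z hz]
  orth₁₃ z hz := by rw [hT, h.orth₁₃ z hz]
  orth₂₃ z hz := by rw [hT, h.orth₂₃ z hz]
  cross z hz := by rw [hT', h.cross z hz, map_neg]

theorem congr {f' : ℂ → R21} {V : Set ℂ} (h : FrameSystem a b H p q U v r e₁ e₂ e₃ f)
    (hV : IsOpen V) (hVU : V ⊆ U) (hf : Set.EqOn f' f V) :
    FrameSystem a b H p q V v r e₁ e₂ e₃ f' where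
  isOpen := hV
  v_ne _ hz := h.v_ne _ (hVU hz)
  grad_v _ hz := h.grad_v _ (hVU hz)
  grad_r _ hz := h.grad_r _ (hVU hz)
  grad_f z hz := (h.grad_f z (hVU hz)).congr_of_eventuallyEq
    (Filter.eventually_of_mem (hV.mem_nhds hz) hf)
  grad_e₁ _ hz := h.grad_e₁ _ (hVU hz)
  grad_e₂ _ hz := h.grad_e₂ _ (hVU hz)
  grad_e₃ _ hz := h.grad_e₃ _ (hVU hz)
  norm_e₁ _ hz := h.norm_e₁ _ (hVU hz)
  norm_e₂ _ hz := h.norm_e₂ _ (hVU hz)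
  norm_e₃ _ hz := h.norm_e₃ _ (hVU hz)
  orth₁₂ _ hz := h.orth₁₂ _ (hVU hz)
  orth₁₃ _ hz := h.orth₁₃ _ (hVU hz)
  orth₂₃ _ hz := h.orth₂₃ _ (hVU hz)
  cross _ hz := h.cross _ (hVU hz)

end FrameSystem


/-! ## Rigidity -/

/-- Expansion of a vector in a Lorentz orthonormal basis. -/
theorem lorentz_expansion {e₁ e₂ e₃ : R21} (h₁ : lorentz e₁ e₁ = 1) (h₂ : lorentz e₂ e₂ = 1)
    (h₃ : lorentz e₃ e₃ = -1) (h₁₂ : lorentz e₁ e₂ = 0) (h₁₃ : lorentz e₁ e₃ = 0)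
    (h₂₃ : lorentz e₂ e₃ = 0) (w : R21) :
    w = lorentz w e₁ • e₁ + lorentz w e₂ • e₂ - lorentz w e₃ • e₃ := by
  let P : Matrix (Fin 3) (Fin 3) ℝ := !![e₁ 0, e₂ 0, e₃ 0; e₁ 1, e₂ 1, e₃ 1; e₁ 2, e₂ 2, e₃ 2]
  -- `Q = J Pᵀ J` with `J` the Gram matrix of the metric. Orthonormality is `QP = 1`, and for square
  -- matrices this gives `PQ = 1`, which is the expansion.
  let Q : Matrix (Fin 3) (Fin 3) ℝ :=
    !![e₁ 0, e₁ 1, -e₁ 2; e₂ 0, e₂ 1, -e₂ 2; -e₃ 0, -e₃ 1, e₃ 2]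
  have hQP : Q * P = 1 := by
    simp only [lorentz] at h₁ h₂ h₃ h₁₂ h₁₃ h₂₃
    ext i j
    fin_cases i <;> fin_cases j <;> simp [P, Q, Matrix.mul_apply, Fin.sum_univ_three] <;> linarith
  have hPQ : P * Q = 1 := mul_eq_one_comm.1 hQP
  have hw : w = (P * Q).mulVec w := by rw [hPQ, Matrix.one_mulVec]
  conv_lhs => rw [hw]
  ext i
  fin_cases i <;>
    simp [P, Q, Matrix.mulVec, dotProduct, Matrix.mul_apply, Fin.sum_univ_three, lorentz] <;> ring

theorem eq_zero_of_lorentz_eq_zero {w : R21} (h : ∀ x, lorentz w x = 0) : w = 0 := by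
  ext i
  have := h (Pi.single i 1)
  fin_cases i <;> simpa [lorentz] using this

theorem exists_affineEquiv_of_lorentz (T : R21 →L[ℝ] R21) (t : R21)
    (hT : ∀ x y, lorentz (T x) (T y) = lorentz x y) :
    ∃ g : R21 ≃ᵃ[ℝ] R21, IsLorentzIsometry g ∧ ∀ p, g p = T p + t := by
  have hinj : Function.Injective (T : R21 →ₗ[ℝ] R21) := by
    rw [← LinearMap.ker_eq_bot, LinearMap.ker_eq_bot']
    intro w hw
    refine eq_zero_of_lorentz_eq_zero fun x => ?_
    have hw' : T w = 0 := hw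
    rw [← hT, hw', lorentz_zero_left]
  let e : R21 ≃ₗ[ℝ] R21 := LinearEquiv.ofInjectiveEndo (T : R21 →ₗ[ℝ] R21) hinj
  refine ⟨e.toAffineEquiv.trans (AffineEquiv.constVAdd ℝ R21 t), fun p q => hT p q, fun p => ?_⟩
  simp [e, add_comm]

theorem eqOn_of_hasGrad_zero {E : Type*} [NormedAddCommGroup E] [NormedSpace ℝ E] {U : Set ℂ}
    (hU : IsOpen U) (hU' : IsPreconnected U) {g : ℂ → E} (hg : ∀ z ∈ U, HasGrad g 0 0 z) {z w : ℂ}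
    (hz : z ∈ U) (hw : w ∈ U) : g z = g w := by
  refine hU.is_const_of_fderiv_eq_zero hU'
    (fun x hx => (hg x hx).differentiableAt.differentiableWithinAt) (fun x hx => ?_) hz hw
  refine (HasFDerivAt.fderiv (hg x hx)).trans (ContinuousLinearMap.ext fun y => ?_)
  simp

namespace FrameSystem

variable {a b H p q : ℝ} {U : Set ℂ} {v r : ℂ → ℝ} {e₁ e₂ e₃ f e₁' e₂' e₃' f' : ℂ → R21}

/-- Two solutions of the same structure equations differ by an isometry. -/
theorem exists_isometry (h : FrameSystem a b H p q U v r e₁ e₂ e₃ f)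
    (h' : FrameSystem a b H p q U v r e₁' e₂' e₃' f') (hU : IsConnected U) :
    ∃ g : R21 ≃ᵃ[ℝ] R21, IsLorentzIsometry g ∧ ∀ z ∈ U, f z = g (f' z) := by
  obtain ⟨z₀, hz₀⟩ := hU.nonempty
  have hexp : ∀ z ∈ U, ∀ w, w = lorentz w (e₁' z) • e₁' z + lorentz w (e₂' z) • e₂' z -
      lorentz w (e₃' z) • e₃' z := fun z hz w =>
    lorentz_expansion (h'.norm_e₁ z hz) (h'.norm_e₂ z hz) (h'.norm_e₃ z hz) (h'.orth₁₂ z hz)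
      (h'.orth₁₃ z hz) (h'.orth₂₃ z hz) w
  -- `T z` carries the second frame at `z` to the first; the minus sign is there because `e₃` is
  -- timelike. Both frames have the same connection coefficients, so `T` does not depend on `z`.
  let T : ℂ → R21 → R21 := fun z w =>
    lorentz w (e₁' z) • e₁ z + lorentz w (e₂' z) • e₂ z - lorentz w (e₃' z) • e₃ z
  have hT : ∀ w, ∀ z ∈ U, HasGrad (fun z => T z w) 0 0 z := by
    intro w z hz
    refine ((((hasGrad_const w z).lorentz (h'.grad_e₁ z hz)).smul (h.grad_e₁ z hz)).add
      (((hasGrad_const w z).lorentz (h'.grad_e₂ z hz)).smul (h.grad_e₂ z hz))).sub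
      (((hasGrad_const w z).lorentz (h'.grad_e₃ z hz)).smul (h.grad_e₃ z hz)) |>.congr_grad ?_ ?_ <;>
    · simp only [lorentz_zero_left, lorentz_add_right, lorentz_sub_right, lorentz_smul_right]
      module
  have hTc : ∀ w, ∀ z ∈ U, T z w = T z₀ w := fun w z hz =>
    eqOn_of_hasGrad_zero h.isOpen hU.isPreconnected (hT w) hz hz₀
  let T₀ : R21 →L[ℝ] R21 := LinearMap.toContinuousLinearMap
    { toFun := T z₀
      map_add' := fun x y => by simp only [T, lorentz_add_left]; module
      map_smul' := fun c x => by simp only [T, lorentz_smul_left, RingHom.id_apply]; module }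
  have hT₀ : ∀ x, T₀ x = T z₀ x := fun _ => rfl
  have hl : ∀ x y, lorentz (T₀ x) (T₀ y) = lorentz x y := by
    intro x y
    rw [hT₀, hT₀]
    conv_rhs => rw [hexp z₀ hz₀ x]
    simp only [T, lorentz_add_left, lorentz_sub_left, lorentz_add_right, lorentz_sub_right,
      lorentz_smul_left, lorentz_smul_right, h.norm_e₁ z₀ hz₀, h.norm_e₂ z₀ hz₀, h.norm_e₃ z₀ hz₀,
      h.orth₁₂ z₀ hz₀, h.orth₁₃ z₀ hz₀, h.orth₂₃ z₀ hz₀, lorentz_comm (e₂ z₀) (e₁ z₀),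
      lorentz_comm (e₃ z₀) (e₁ z₀), lorentz_comm (e₃ z₀) (e₂ z₀), lorentz_comm y]
    ring
  have hf : ∀ z ∈ U, HasGrad (fun z => f z - T₀ (f' z)) 0 0 z := by
    intro z hz
    refine ((h.grad_f z hz).sub ((h'.grad_f z hz).clm_comp T₀)).congr_grad ?_ ?_
    · rw [map_smul, hT₀, ← hTc _ z hz]
      simp only [T, h'.norm_e₁ z hz, h'.orth₁₂ z hz, h'.orth₁₃ z hz]
      module
    · rw [map_smul, hT₀, ← hTc _ z hz]
      simp only [T, lorentz_comm (e₂' z) (e₁' z), h'.norm_e₂ z hz, h'.orth₁₂ z hz, h'.orth₂₃ z hz]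
      module
  obtain ⟨g, hg, hg'⟩ := exists_affineEquiv_of_lorentz T₀ (f z₀ - T₀ (f' z₀)) hl
  refine ⟨g, hg, fun z hz => ?_⟩
  rw [hg', ← eqOn_of_hasGrad_zero h.isOpen hU.isPreconnected hf hz hz₀]
  abel

end FrameSystem


/-! ## Equivariant surfaces of constant mean curvature -/

theorem contDiffOn_partialX {U : Set ℂ} (hU : IsOpen U) {g : ℂ → R21} (hg : ContDiffOn ℝ ∞ g U) :
    ContDiffOn ℝ ∞ (partialX g) U :=
  (hg.fderiv_of_isOpen hU (m := ∞) (by simp)).clm_apply contDiffOn_const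

theorem contDiffOn_partialY {U : Set ℂ} (hU : IsOpen U) {g : ℂ → R21} (hg : ContDiffOn ℝ ∞ g U) :
    ContDiffOn ℝ ∞ (partialY g) U :=
  (hg.fderiv_of_isOpen hU (m := ∞) (by simp)).clm_apply contDiffOn_const

theorem ContDiffOn.hasGrad_partial {U : Set ℂ} (hU : IsOpen U) {g : ℂ → R21}
    (hg : ContDiffOn ℝ ∞ g U) {z : ℂ} (hz : z ∈ U) :
    HasGrad g (partialX g z) (partialY g z) z :=
  ((hg.contDiffAt (hU.mem_nhds hz)).differentiableAt (by simp)).hasGrad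

theorem partialY_partialX {U : Set ℂ} (hU : IsOpen U) {g : ℂ → R21} (hg : ContDiffOn ℝ ∞ g U)
    {z : ℂ} (hz : z ∈ U) : partialY (partialX g) z = partialX (partialY g) z := by
  have hd : DifferentiableAt ℝ (fderiv ℝ g) z :=
    ((hg.fderiv_of_isOpen hU (m := ∞) (by simp)).contDiffAt (hU.mem_nhds hz)).differentiableAt
      (by simp)
  have hs : IsSymmSndFDerivAt ℝ g z :=
    (hg.contDiffAt (hU.mem_nhds hz)).isSymmSndFDerivAt (by
      rw [minSmoothness_of_isRCLikeNormedField]; exact WithTop.coe_le_coe.2 le_top)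
  have key : ∀ c d : ℂ, fderiv ℝ (fun w => fderiv ℝ g w c) z d = fderiv ℝ (fderiv ℝ g) z d c := by
    intro c d
    rw [fderiv_clm_apply hd (differentiableAt_const c)]
    simp
  exact (key 1 Complex.I).trans ((hs Complex.I 1).trans (key Complex.I 1).symm)

theorem lorentzCross_lorentz_left (u v : R21) : lorentz (lorentzCross u v) u = 0 := by
  simp [lorentz, lorentzCross]; ring

theorem lorentzCross_lorentz_right (u v : R21) : lorentz (lorentzCross u v) v = 0 := by
  simp [lorentz, lorentzCross]; ring

theorem lorentzCross_lorentz_self (u v : R21) : lorentz (lorentzCross u v) (lorentzCross u v) =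
    -(lorentz u u * lorentz v v - lorentz u v ^ 2) := by
  simp [lorentz, lorentzCross]; ring

/-- Expansion of a vector in a conformal frame. -/
theorem lorentz_expansion_conformal {u₁ u₂ N : R21} {s : ℝ} (hs : s ≠ 0)
    (h₁ : lorentz u₁ u₁ = s ^ 2) (h₂ : lorentz u₂ u₂ = s ^ 2) (h₃ : lorentz N N = -1)
    (h₁₂ : lorentz u₁ u₂ = 0) (h₁₃ : lorentz N u₁ = 0) (h₂₃ : lorentz N u₂ = 0) (w : R21) :
    w = (lorentz w u₁ / s ^ 2) • u₁ + (lorentz w u₂ / s ^ 2) • u₂ - lorentz w N • N := by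
  have := lorentz_expansion (e₁ := s⁻¹ • u₁) (e₂ := s⁻¹ • u₂) (e₃ := N)
    (by rw [lorentz_smul_left, lorentz_smul_right, h₁]; field_simp)
    (by rw [lorentz_smul_left, lorentz_smul_right, h₂]; field_simp) h₃
    (by rw [lorentz_smul_left, lorentz_smul_right, h₁₂]; simp)
    (by rw [lorentz_smul_left, lorentz_comm, h₁₃]; simp)
    (by rw [lorentz_smul_left, lorentz_comm, h₂₃]; simp) w
  conv_lhs => rw [this]
  simp only [lorentz_smul_right, smul_smul]
  congr 3 <;> field_simp

/-- Serves to convert the invariance of the fundamental forms under translation in `y` into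
equations between derivatives. -/
theorem HasGrad.eq_zero_of_invariant {E : Type*} [NormedAddCommGroup E]
    [NormedSpace ℝ E] {g : ℂ → E} {X Y : E} {z : ℂ} (hg : HasGrad g X Y z)
    (hi : ∀ t : ℝ, g (z + (t : ℂ) * Complex.I) = g z) : Y = 0 := by
  have h1 : HasDerivAt (fun t : ℝ => z + (t : ℂ) * Complex.I) Complex.I 0 := by
    simpa using ((Complex.ofRealCLM.hasDerivAt (x := 0)).mul_const Complex.I).const_add z
  have hg' : HasGrad g X Y (z + ((0 : ℝ) : ℂ) * Complex.I) := by simpa using hg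
  have h2 := HasFDerivAt.comp_hasDerivAt (f := fun t : ℝ => z + (t : ℂ) * Complex.I) (0 : ℝ) hg' h1
  have h3 : HasDerivAt (g ∘ fun t : ℝ => z + (t : ℂ) * Complex.I) 0 0 := by
    have : (g ∘ fun t : ℝ => z + (t : ℂ) * Complex.I) = fun _ => g z := funext hi
    rw [this]; exact hasDerivAt_const _ _
  simpa using h2.unique h3

/-- Used first for `f`, then with `c = 0` for its partial derivatives, so that second derivatives
transform by the linear part as well. -/
theorem partial_of_equivariant {U : Set ℂ} (hU : IsOpen U) {g : ℂ → R21}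
    (hg : ContDiffOn ℝ ∞ g U) {t : ℝ} (hUt : ∀ z ∈ U, z + (t : ℂ) * Complex.I ∈ U)
    (L : R21 →L[ℝ] R21) (c : R21) (h : ∀ z ∈ U, g (z + (t : ℂ) * Complex.I) = L (g z) + c) {z : ℂ}
    (hz : z ∈ U) : partialX g (z + (t : ℂ) * Complex.I) = L (partialX g z) ∧
      partialY g (z + (t : ℂ) * Complex.I) = L (partialY g z) := by
  have h1 := HasGrad.comp_sub (g := g) (z := z) (w₀ := -((t : ℂ) * Complex.I))
    (by rw [sub_neg_eq_add]; exact hg.hasGrad_partial hU (hUt z hz))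
  have h2 := ((hg.hasGrad_partial hU hz).clm_comp L).add (hasGrad_const c z)
  have h3 := h2.congr_of_eventuallyEq (g' := fun w => g (w - -((t : ℂ) * Complex.I)))
    (Filter.eventually_of_mem (hU.mem_nhds hz) fun w hw => by
      simp only [sub_neg_eq_add]; exact h w hw)
  have := h1.unique h3
  simpa using this

/-! ### Invariance of the fundamental forms. -/

section Surface

variable {H : ℝ} {U : Set ℂ} {f : ℂ → R21}

theorem IsConformalCMCImmersion.frame (hf : IsConformalCMCImmersion U f H) {z : ℂ} (hz : z ∈ U) :
    lorentz (unitNormal f z) (unitNormal f z) = -1 ∧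
      lorentz (unitNormal f z) (partialX f z) = 0 ∧
      lorentz (unitNormal f z) (partialY f z) = 0 := by
  have hE := hf.spacelike z hz
  obtain ⟨h1, h2⟩ := hf.conformal z hz
  refine ⟨?_, ?_, ?_⟩
  · rw [unitNormal, lorentz_smul_left, lorentz_smul_right, lorentzCross_lorentz_self, h1, h2]
    field_simp; ring
  · rw [unitNormal, lorentz_smul_left, lorentzCross_lorentz_left, mul_zero]
  · rw [unitNormal, lorentz_smul_left, lorentzCross_lorentz_right, mul_zero]

theorem IsConformalCMCImmersion.trace (hf : IsConformalCMCImmersion U f H) {z : ℂ} (hz : z ∈ U) :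
    lorentz (partialX (partialX f) z) (unitNormal f z) +
      lorentz (partialY (partialY f) z) (unitNormal f z) =
      2 * H * lorentz (partialX f z) (partialX f z) := by
  have hE := hf.spacelike z hz
  have := hf.cmc z hz
  rw [meanCurvature, lorentz_add_left, div_eq_iff (by positivity)] at this
  rw [this]; ring

theorem IsConformalCMCImmersion.contDiffOn_unitNormal (hf : IsConformalCMCImmersion U f H) :
    ContDiffOn ℝ ∞ (unitNormal f) U := by
  have hX := contDiffOn_partialX hf.isOpen hf.smooth
  have hY := contDiffOn_partialY hf.isOpen hf.smooth
  have hX' := contDiffOn_pi.1 hX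
  have hY' := contDiffOn_pi.1 hY
  have hE : ContDiffOn ℝ ∞ (fun z => lorentz (partialX f z) (partialX f z)) U :=
    (((hX' 0).mul (hX' 0)).add ((hX' 1).mul (hX' 1))).sub ((hX' 2).mul (hX' 2))
  refine (hE.inv fun z hz => (hf.spacelike z hz).ne').smul (contDiffOn_pi.2 fun i => ?_)
  fin_cases i
  · exact (((hX' 1).mul (hY' 2)).sub ((hX' 2).mul (hY' 1))).neg
  · exact (((hX' 2).mul (hY' 0)).sub ((hX' 0).mul (hY' 2))).neg
  · exact ((hX' 0).mul (hY' 1)).sub ((hX' 1).mul (hY' 0))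

/-- The first and second fundamental forms of an equivariant surface do not depend on `y`. -/
theorem IsConformalCMCImmersion.forms_invariant (hf : IsConformalCMCImmersion U f H) (hH : H ≠ 0)
    (he : IsEquivariantInY U f) {z : ℂ} (hz : z ∈ U) (t : ℝ) :
    lorentz (partialX f (z + (t : ℂ) * Complex.I)) (partialX f (z + (t : ℂ) * Complex.I)) =
        lorentz (partialX f z) (partialX f z) ∧
      lorentz (partialX (partialX f) (z + (t : ℂ) * Complex.I)) (partialX f (z + (t : ℂ) * Complex.I)) =
        lorentz (partialX (partialX f) z) (partialX f z) ∧
      lorentz (partialX (partialX f) (z + (t : ℂ) * Complex.I)) (unitNormal f (z + (t : ℂ) * Complex.I)) =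
        lorentz (partialX (partialX f) z) (unitNormal f z) ∧
      lorentz (partialY (partialX f) (z + (t : ℂ) * Complex.I)) (unitNormal f (z + (t : ℂ) * Complex.I)) =
        lorentz (partialY (partialX f) z) (unitNormal f z) ∧
      lorentz (partialY (partialY f) (z + (t : ℂ) * Complex.I)) (unitNormal f (z + (t : ℂ) * Complex.I)) =
        lorentz (partialY (partialY f) z) (unitNormal f z) := by
  obtain ⟨R, hR, -, -, hRf⟩ := he
  have hUt : ∀ z ∈ U, z + (t : ℂ) * Complex.I ∈ U := fun z hz => (hRf z hz t).1
  let L : R21 →L[ℝ] R21 := LinearMap.toContinuousLinearMap ((R t).linear : R21 →ₗ[ℝ] R21)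
  have hL : ∀ x y, lorentz (L x) (L y) = lorentz x y := hR t
  have hfL : ∀ z ∈ U, f (z + (t : ℂ) * Complex.I) = L (f z) + R t 0 := by
    intro z hz
    rw [(hRf z hz t).2]
    have := (R t).map_vadd 0 (f z)
    rw [vadd_eq_add, vadd_eq_add, add_zero] at this
    exact this
  have hX := contDiffOn_partialX hf.isOpen hf.smooth
  have hY := contDiffOn_partialY hf.isOpen hf.smooth
  have h1 := fun z hz => partial_of_equivariant hf.isOpen hf.smooth hUt L _ hfL (z := z) hz
  have h1X := partial_of_equivariant hf.isOpen hX hUt L 0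
    (fun z hz => by rw [add_zero]; exact (h1 z hz).1) hz
  have h1Y := partial_of_equivariant hf.isOpen hY hUt L 0
    (fun z hz => by rw [add_zero]; exact (h1 z hz).2) hz
  have hz' := hUt z hz
  have tr := hf.trace hz
  have tr' := hf.trace hz'
  obtain ⟨hN, hN1, hN2⟩ := hf.frame hz
  obtain ⟨hN', hN1', hN2'⟩ := hf.frame hz'
  have hE := hf.spacelike z hz
  have hE' := hf.spacelike _ hz'
  obtain ⟨hc1, hc2⟩ := hf.conformal _ hz'
  -- The image of the normal under `L` is orthogonal to both translated tangent vectors, hence a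
  -- multiple `μ` of the normal there.
  have hexp := lorentz_expansion_conformal (Real.sqrt_ne_zero'.2 hE')
    (by rw [Real.sq_sqrt hE'.le]) (by rw [Real.sq_sqrt hE'.le, hc1]) hN' hc2 hN1' hN2'
    (L (unitNormal f z))
  simp only [(h1 z hz).1, (h1 z hz).2, hL, hN1, hN2, zero_div, zero_smul, zero_add,
    zero_sub] at hexp
  set N' := unitNormal f (z + (t : ℂ) * Complex.I) with hN'def
  set μ := -lorentz (L (unitNormal f z)) N' with hμ
  have hexp' : L (unitNormal f z) = μ • N' := by rw [hexp, hμ]; module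
  have hconj : ∀ w, lorentz w (unitNormal f z) = μ * lorentz (L w) N' := by
    intro w
    rw [← hL, hexp', lorentz_smul_right]
  -- The isometry could a priori reverse the normal. The trace of the second fundamental form is
  -- `2HE` at both points with the same nonzero value, which excludes this.
  have hμ1 : μ = 1 := by
    rw [hconj, hconj, ← h1X.1, ← h1Y.2, ← mul_add, tr', (h1 z hz).1, hL] at tr
    have : 2 * H * lorentz (partialX f z) (partialX f z) ≠ 0 := by positivity
    exact mul_right_cancel₀ this (by rw [one_mul]; exact tr)
  refine ⟨by rw [(h1 z hz).1, hL], by rw [(h1 z hz).1, h1X.1, hL], ?_, ?_, ?_⟩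
  · rw [hconj, h1X.1, hμ1, one_mul]
  · rw [hconj, h1X.2, hμ1, one_mul]
  · rw [hconj, h1Y.2, hμ1, one_mul]

end Surface


/-! ### The Gauss and Codazzi equations. -/

section Surface

variable {H : ℝ} {U : Set ℂ} {f : ℂ → R21}

/-- The Gauss and Codazzi equations of an equivariant surface, in terms of the conformal factor
`s ^ 2`: the first derivatives of the conformal factor and of the second fundamental form, and the
expansions of the second derivatives of `f` in the adapted frame. -/
theorem IsConformalCMCImmersion.gauss_codazzi (hf : IsConformalCMCImmersion U f H) (hH : H ≠ 0)
    (he : IsEquivariantInY U f) {z : ℂ} (hz : z ∈ U) {E e l m n : ℂ → ℝ}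
    (hEd : E = fun z => lorentz (partialX f z) (partialX f z))
    (hed : e = fun z => lorentz (partialX (partialX f) z) (partialX f z))
    (hld : l = fun z => lorentz (partialX (partialX f) z) (unitNormal f z))
    (hmd : m = fun z => lorentz (partialY (partialX f) z) (unitNormal f z))
    (hnd : n = fun z => lorentz (partialY (partialY f) z) (unitNormal f z)) :
    HasGrad E (2 * e z) 0 z ∧
    HasGrad e (2 * e z ^ 2 / E z - m z ^ 2 + l z * n z) 0 z ∧
    HasGrad m 0 0 z ∧
    HasGrad (fun w => n w - H * E w) 0 0 z ∧
    partialX (partialX f) z = (e z / E z) • partialX f z - l z • unitNormal f z ∧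
    partialY (partialX f) z = (e z / E z) • partialY f z - m z • unitNormal f z ∧
    partialY (partialY f) z = -(e z / E z) • partialX f z - n z • unitNormal f z ∧
    HasGrad (unitNormal f) (-(l z / E z) • partialX f z - (m z / E z) • partialY f z)
      (-(m z / E z) • partialX f z - (n z / E z) • partialY f z) z := by
  have hU := hf.isOpen
  have inv := fun t => hf.forms_invariant hH he hz t
  have s1 := contDiffOn_partialX hU hf.smooth
  have s2 := contDiffOn_partialY hU hf.smooth
  have s11 := contDiffOn_partialX hU s1
  have s12 := contDiffOn_partialY hU s1
  have s22 := contDiffOn_partialY hU s2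
  have sN := hf.contDiffOn_unitNormal
  have c12 : ∀ w ∈ U, partialX (partialY f) w = partialY (partialX f) w := fun w hw =>
    (partialY_partialX hU hf.smooth hw).symm
  have g1 := fun w hw => s1.hasGrad_partial (z := w) hU hw
  have g2 := fun w hw => (s2.hasGrad_partial (z := w) hU hw).congr_grad (c12 w hw) rfl
  -- The mixed third derivatives are all written as `y`-derivatives of `f_xx` and `f_xy`; these can
  -- be eliminated by invariance in `y`.
  have g11 := s11.hasGrad_partial hU hz
  have g12 := (s12.hasGrad_partial hU hz).congr_grad (partialY_partialX hU s1 hz).symm rfl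
  have g22 := (s22.hasGrad_partial hU hz).congr_grad
    ((partialY_partialX hU s2 hz).symm.trans
      ((g2 z hz).congr_of_eventuallyEq Filter.EventuallyEq.rfl |> fun _ =>
        (s12.hasGrad_partial hU hz |>.congr_of_eventuallyEq
          (Filter.eventually_of_mem (hU.mem_nhds hz) c12)).partialY)) rfl
  have gN := sN.hasGrad_partial hU hz
  have hE : ∀ w ∈ U, 0 < E w := by rw [hEd]; exact hf.spacelike
  have hEz := hE z hz
  have heqE : ∀ w, lorentz (partialX f w) (partialX f w) = E w := fun w => by rw [hEd]
  have heqe : ∀ w, lorentz (partialX (partialX f) w) (partialX f w) = e w := fun w => by rw [hed]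
  have heql : ∀ w, lorentz (partialX (partialX f) w) (unitNormal f w) = l w := fun w => by rw [hld]
  have heqm : ∀ w, lorentz (partialY (partialX f) w) (unitNormal f w) = m w := fun w => by rw [hmd]
  have heqn : ∀ w, lorentz (partialY (partialY f) w) (unitNormal f w) = n w := fun w => by rw [hnd]
  have E2 : ∀ w ∈ U, lorentz (partialY f w) (partialY f w) = E w := fun w hw => by
    rw [(hf.conformal w hw).1, heqE]
  have h12 : ∀ w ∈ U, lorentz (partialX f w) (partialY f w) = 0 := fun w hw => (hf.conformal w hw).2
  have hnear : ∀ {P : ℂ → Prop}, (∀ w ∈ U, P w) → ∀ w ∈ U, ∀ᶠ w' in nhds w, P w' :=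
    fun h w hw => Filter.eventually_of_mem (hU.mem_nhds hw) h
  -- first order relations
  have r12_1 : ∀ w ∈ U, lorentz (partialY (partialX f) w) (partialX f w) = 0 := by
    intro w hw
    have hg := ((g1 w hw).lorentz (g1 w hw))
    have := hg.eq_zero_of_invariant fun t => (hf.forms_invariant hH he hw t).1
    rw [lorentz_comm (partialX f w)] at this
    linarith
  have gE : ∀ w ∈ U, HasGrad E (2 * e w) 0 w := by
    intro w hw
    refine (((g1 w hw).lorentz (g1 w hw)).congr_of_eventuallyEq
      (Filter.Eventually.of_forall fun w => (heqE w).symm)).congr_grad ?_ ?_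
    · rw [lorentz_comm (partialX f w), heqe]; ring
    · rw [lorentz_comm (partialX f w), r12_1 w hw]; ring
  have gE2 := fun w hw => (gE w hw).unique (((g2 w hw).lorentz (g2 w hw)).congr_of_eventuallyEq
    (hnear (fun w hw => (E2 w hw).symm) w hw))
  have g0 := fun w hw => ((g1 w hw).lorentz (g2 w hw)).unique ((hasGrad_const (0 : ℝ) w)
    |>.congr_of_eventuallyEq (hnear h12 w hw))
  have r12_2 : ∀ w ∈ U, lorentz (partialY (partialX f) w) (partialY f w) = e w := by
    intro w hw
    have := (gE2 w hw).1
    rw [lorentz_comm (partialY f w)] at this; linarith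
  have r22_2 : ∀ w ∈ U, lorentz (partialY (partialY f) w) (partialY f w) = 0 := by
    intro w hw
    have := (gE2 w hw).2
    rw [lorentz_comm (partialY f w)] at this; linarith
  have r11_2 : ∀ w ∈ U, lorentz (partialX (partialX f) w) (partialY f w) = 0 := by
    intro w hw
    have := (g0 w hw).1
    rw [lorentz_comm (partialX f w), r12_1 w hw] at this; linarith
  have r22_1 : ∀ w ∈ U, lorentz (partialY (partialY f) w) (partialX f w) = -e w := by
    intro w hw
    have := (g0 w hw).2
    rw [lorentz_comm (partialX f w), r12_2 w hw] at this; linarith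
  -- the derivative of the normal
  obtain ⟨nN, n1, n2⟩ := hf.frame hz
  have dN := (gN.lorentz gN).unique ((hasGrad_const (-1 : ℝ) z)
    |>.congr_of_eventuallyEq (hnear (fun w hw => (hf.frame hw).1) z hz))
  have dN1 := (gN.lorentz (g1 z hz)).unique ((hasGrad_const (0 : ℝ) z)
    |>.congr_of_eventuallyEq (hnear (fun w hw => (hf.frame hw).2.1) z hz))
  have dN2 := (gN.lorentz (g2 z hz)).unique ((hasGrad_const (0 : ℝ) z)
    |>.congr_of_eventuallyEq (hnear (fun w hw => (hf.frame hw).2.2) z hz))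
  simp only [lorentz_comm (unitNormal f z), heql, heqm, heqn] at dN dN1 dN2
  set N1 := partialX (unitNormal f) z
  set N2 := partialY (unitNormal f) z
  have hexp := fun w => lorentz_expansion_conformal (Real.sqrt_ne_zero'.2 hEz)
    (by rw [Real.sq_sqrt hEz.le, heqE]) (by rw [Real.sq_sqrt hEz.le, E2 z hz]) nN (h12 z hz) n1 n2 w
  simp only [Real.sq_sqrt hEz.le] at hexp
  have x11 : partialX (partialX f) z = (e z / E z) • partialX f z - l z • unitNormal f z := by
    conv_lhs => rw [hexp (partialX (partialX f) z)]
    rw [heqe, r11_2 z hz, heql]; module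
  have x12 : partialY (partialX f) z = (e z / E z) • partialY f z - m z • unitNormal f z := by
    conv_lhs => rw [hexp (partialY (partialX f) z)]
    rw [r12_1 z hz, r12_2 z hz, heqm]; module
  have x22 : partialY (partialY f) z = -(e z / E z) • partialX f z - n z • unitNormal f z := by
    conv_lhs => rw [hexp (partialY (partialY f) z)]
    rw [r22_1 z hz, r22_2 z hz, heqn]; module
  have xN1 : N1 = -(l z / E z) • partialX f z - (m z / E z) • partialY f z := by
    conv_lhs => rw [hexp N1]
    rw [show lorentz N1 (partialX f z) = -l z by linarith [dN1.1],
      show lorentz N1 (partialY f z) = -m z by linarith [dN2.1],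
      show lorentz N1 (unitNormal f z) = 0 by linarith [dN.1]]
    module
  have xN2 : N2 = -(m z / E z) • partialX f z - (n z / E z) • partialY f z := by
    conv_lhs => rw [hexp N2]
    rw [show lorentz N2 (partialX f z) = -m z by linarith [dN1.2],
      show lorentz N2 (partialY f z) = -n z by linarith [dN2.2],
      show lorentz N2 (unitNormal f z) = 0 by linarith [dN.2]]
    module
  -- the second fundamental form
  have q11_N1 : lorentz (partialX (partialX f) z) N2 = -(m z * e z / E z) := by
    rw [xN2, lorentz_sub_right, lorentz_smul_right, lorentz_smul_right, heqe, r11_2 z hz]; ring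
  have q12_N1 : lorentz (partialY (partialX f) z) N1 = -(m z * e z / E z) := by
    rw [xN1, lorentz_sub_right, lorentz_smul_right, lorentz_smul_right, r12_1 z hz, r12_2 z hz]; ring
  have q12_N2 : lorentz (partialY (partialX f) z) N2 = -(n z * e z / E z) := by
    rw [xN2, lorentz_sub_right, lorentz_smul_right, lorentz_smul_right, r12_1 z hz, r12_2 z hz]; ring
  have q22_N1 : lorentz (partialY (partialY f) z) N1 = l z * e z / E z := by
    rw [xN1, lorentz_sub_right, lorentz_smul_right, lorentz_smul_right, r22_1 z hz, r22_2 z hz]; ring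
  have dl := g11.lorentz gN
  have dm := g12.lorentz gN
  have dn := g22.lorentz gN
  -- Invariance of `l` and `m` gives `⟨f_xxy, N⟩ = -⟨f_xx, N_y⟩` and `⟨f_xyy, N⟩ = -⟨f_xy, N_y⟩`.
  -- Inserted into `m_x` and `n_x`, these are the Codazzi equations `m_x = 0` and `n_x = 2He = H
  -- E_x`.
  have dl0 := dl.eq_zero_of_invariant fun t => (inv t).2.2.1
  have dm0 := dm.eq_zero_of_invariant fun t => (inv t).2.2.2.1
  have dn0 := dn.eq_zero_of_invariant fun t => (inv t).2.2.2.2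
  have gm : HasGrad m 0 0 z := by
    rw [hmd]
    exact dm.congr_grad (by linarith) dm0
  have gn : HasGrad n (2 * H * e z) 0 z := by
    rw [hnd]
    refine dn.congr_grad ?_ dn0
    have tr := hf.trace hz
    rw [heql, heqn, heqE] at tr
    have : l z * e z / E z + n z * e z / E z = 2 * H * e z := by
      rw [← add_div, ← add_mul, tr]; field_simp
    linarith
  have gnH : HasGrad (fun w => n w - H * E w) 0 0 z :=
    (gn.sub ((gE z hz).const_smul H)).congr_grad (by simp; ring) (by simp)
  -- the Gauss equation
  have de := g12.lorentz (g2 z hz)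
  have de' := (g11.lorentz (g2 z hz)).unique ((hasGrad_const (0 : ℝ) z)
    |>.congr_of_eventuallyEq (hnear r11_2 z hz))
  have ge0 := (g11.lorentz (g1 z hz)).eq_zero_of_invariant fun t => (inv t).2.1
  have ge1 : HasGrad e _ _ z := de.congr_of_eventuallyEq (hnear (fun w hw => (r12_2 w hw).symm) z hz)
  have ge2 : HasGrad e _ _ z := (g11.lorentz (g1 z hz)).congr_of_eventuallyEq
    (Filter.Eventually.of_forall fun w => (heqe w).symm)
  have hey := (ge1.unique ge2).2.trans ge0
  have q1 : lorentz (partialY (partialX f) z) (partialY (partialX f) z) =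
      e z ^ 2 / E z - m z ^ 2 := by
    conv_lhs => arg 2; rw [x12]
    rw [lorentz_sub_right, lorentz_smul_right, lorentz_smul_right, r12_2 z hz, heqm]; ring
  have q2 : lorentz (partialX (partialX f) z) (partialY (partialY f) z) =
      -(e z ^ 2 / E z) - l z * n z := by
    conv_lhs => arg 2; rw [x22]
    rw [lorentz_sub_right, lorentz_smul_right, lorentz_smul_right, heqe, heql]; ring
  have ge : HasGrad e (2 * e z ^ 2 / E z - m z ^ 2 + l z * n z) 0 z := by
    -- With `e = ⟨f_xy, f_y⟩` one has `e_x = ⟨f_xxy, f_y⟩ + ⟨f_xy, f_xy⟩`, and differentiating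
    -- `⟨f_xx, f_y⟩ = 0` in `y` replaces the first term by `-⟨f_xx, f_yy⟩`.
    refine ge1.congr_grad ?_ hey
    have := de'.2
    rw [q2] at this
    rw [q1]
    linear_combination this
  exact ⟨gE z hz, ge, gm, gnH, x11, x12, x22, gN.congr_grad xN1 xN2⟩

end Surface


/-- An equivariant surface of constant mean curvature which is not totally umbilic satisfies the
structure equations. -/
theorem IsConformalCMCImmersion.exists_frameSystem {H : ℝ} {U : Set ℂ} {f : ℂ → R21}
    (hf : IsConformalCMCImmersion U f H) (hH : H ≠ 0) (hU' : IsConnected U)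
    (he : IsEquivariantInY U f) (hn : ∃ z ∈ U, ¬ IsUmbilicAt f z) {z₀ : ℂ} (hz₀ : z₀ ∈ U) :
    ∃ (a b p q : ℝ) (v r : ℂ → ℝ) (e₁ e₂ e₃ : ℂ → R21), a ≠ 0 ∧ b ≠ 0 ∧ p ^ 2 + q ^ 2 = 1 ∧
      v z₀ = 1 ∧ (∀ z ∈ U, 0 < v z) ∧
      (∀ z ∈ U, ∀ t : ℝ, v (z + (t : ℂ) * Complex.I) = v z) ∧
      (∀ z ∈ U, ∀ t : ℝ, r (z + (t : ℂ) * Complex.I) = r z) ∧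
      FrameSystem a b H p q U v r e₁ e₂ e₃ f := by
  have hU := hf.isOpen
  obtain ⟨E, hEd⟩ : ∃ E, E = fun z => lorentz (partialX f z) (partialX f z) := ⟨_, rfl⟩
  obtain ⟨e, hed⟩ : ∃ e, e = fun z => lorentz (partialX (partialX f) z) (partialX f z) := ⟨_, rfl⟩
  obtain ⟨l, hld⟩ : ∃ l, l = fun z => lorentz (partialX (partialX f) z) (unitNormal f z) := ⟨_, rfl⟩
  obtain ⟨m, hmd⟩ : ∃ m, m = fun z => lorentz (partialY (partialX f) z) (unitNormal f z) := ⟨_, rfl⟩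
  obtain ⟨n, hnd⟩ : ∃ n, n = fun z => lorentz (partialY (partialY f) z) (unitNormal f z) := ⟨_, rfl⟩
  have gc := fun z hz => hf.gauss_codazzi hH he (z := z) hz hEd hed hld hmd hnd
  have hE : ∀ w ∈ U, 0 < E w := by rw [hEd]; exact hf.spacelike
  have hEt : ∀ z ∈ U, ∀ t : ℝ, E (z + (t : ℂ) * Complex.I) = E z := by
    intro z hz t; rw [hEd]; exact (hf.forms_invariant hH he hz t).1
  have het : ∀ z ∈ U, ∀ t : ℝ, e (z + (t : ℂ) * Complex.I) = e z := by
    intro z hz t; rw [hed]; exact (hf.forms_invariant hH he hz t).2.1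
  have tr : ∀ z ∈ U, l z + n z = 2 * H * E z := by
    intro z hz; rw [hld, hnd, hEd]; exact hf.trace hz
  -- the Hopf differential
  have hm : ∀ z ∈ U, m z = m z₀ := fun z hz =>
    eqOn_of_hasGrad_zero hU hU'.isPreconnected (fun w hw => (gc w hw).2.2.1) hz hz₀
  have hnc : ∀ z ∈ U, n z - H * E z = n z₀ - H * E z₀ := fun z hz =>
    eqOn_of_hasGrad_zero hU hU'.isPreconnected (fun w hw => (gc w hw).2.2.2.1) hz hz₀
  obtain ⟨h₁, hh₁⟩ : ∃ h₁, h₁ = -(n z₀ - H * E z₀) := ⟨_, rfl⟩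
  obtain ⟨h₂, hh₂⟩ : ∃ h₂, h₂ = m z₀ := ⟨_, rfl⟩
  have hm' : ∀ z ∈ U, m z = h₂ := fun z hz => by rw [hm z hz, hh₂]
  have hn' : ∀ z ∈ U, n z = H * E z - h₁ := fun z hz => by rw [hh₁, ← hnc z hz]; ring
  have hl' : ∀ z ∈ U, l z = H * E z + h₁ := fun z hz => by
    have := tr z hz; rw [hn' z hz] at this; linarith
  -- If both constants vanished, the second fundamental form would be `H` times the first at every
  -- point.
  have hne : 0 < h₁ ^ 2 + h₂ ^ 2 := by
    obtain ⟨z, hz, hzu⟩ := hn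
    by_contra hcon
    have h1 : h₁ = 0 := by nlinarith [sq_nonneg h₁, sq_nonneg h₂]
    have h2 : h₂ = 0 := by nlinarith [sq_nonneg h₁, sq_nonneg h₂]
    refine hzu ⟨H, ?_, ?_, ?_⟩
    · have := hl' z hz
      rw [h1, add_zero, hld, hEd] at this
      exact this
    · have := hm' z hz
      rw [h2, hmd] at this
      rw [(hf.conformal z hz).2, mul_zero, ← partialY_partialX hU hf.smooth hz]
      exact this
    · have := hn' z hz
      rw [h1, sub_zero, hnd, hEd] at this
      rw [(hf.conformal z hz).1]
      exact this
  obtain ⟨ρ, hρ, hρ2⟩ : ∃ ρ : ℝ, 0 < ρ ∧ ρ ^ 2 = h₁ ^ 2 + h₂ ^ 2 :=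
    ⟨√(h₁ ^ 2 + h₂ ^ 2), Real.sqrt_pos.2 hne, Real.sq_sqrt hne.le⟩
  obtain ⟨s, hsd⟩ : ∃ s : ℂ → ℝ, s = fun z => √(E z) := ⟨_, rfl⟩
  have hs : ∀ z ∈ U, 0 < s z := fun z hz => by rw [hsd]; exact Real.sqrt_pos.2 (hE z hz)
  have hs2 : ∀ z ∈ U, E z = s z ^ 2 := fun z hz => by rw [hsd]; exact (Real.sq_sqrt (hE z hz).le).symm
  have gs : ∀ z ∈ U, HasGrad s (e z / s z) 0 z := by
    intro z hz
    have hsz := hs z hz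
    have h0 := HasFDerivAt.sqrt (gc z hz).1 (hE z hz).ne'
    have hsz' : √(E z) = s z := by rw [hsd]
    rw [hsz'] at h0
    have h1 : HasGrad (fun w => √(E w)) (e z / s z) 0 z :=
      h0.congr_fderiv (ContinuousLinearMap.ext fun w => by simp; field_simp)
    rwa [← hsd] at h1
  set σ := s z₀ with hσ
  have hσp : 0 < σ := hs z₀ hz₀
  have ginv : ∀ z ∈ U, HasGrad (fun w => (s w)⁻¹) (-(e z / s z) / s z ^ 2) 0 z := fun z hz =>
    ((gs z hz).inv (hs z hz).ne').congr_grad rfl (by simp)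
  -- The choices are made so that `v(z₀) = 1`, `2av/H = s`, `2bp/v = -h₁/s` and `2bq/v = -h₂/s`,
  -- where `s` is the length of `f_x`. The function `r` is half the logarithmic derivative of `v`.
  refine ⟨H * σ / 2, -ρ / (2 * σ), h₁ / ρ, h₂ / ρ, fun z => s z / σ, fun z => e z / (2 * E z),
    fun z => (s z)⁻¹ • partialX f z, fun z => -((s z)⁻¹ • partialY f z), unitNormal f,
    by positivity, by simp [hρ.ne', hσp.ne'], by field_simp; exact hρ2.symm,
    div_self hσp.ne', fun z hz => div_pos (hs z hz) hσp, fun z hz t => ?_, fun z hz t => ?_, ?_⟩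
  · simp only [hsd, hEt z hz t]
  · simp only [hEt z hz t, het z hz t]
  have g1 := fun w hw => (contDiffOn_partialX hU hf.smooth).hasGrad_partial (z := w) hU hw
  have g2 := fun w hw => ((contDiffOn_partialY hU hf.smooth).hasGrad_partial (z := w) hU hw).congr_grad
    (partialY_partialX hU hf.smooth hw).symm rfl
  have E1 : ∀ w ∈ U, lorentz (partialX f w) (partialX f w) = s w ^ 2 := fun w hw => by
    rw [← hs2 w hw, hEd]
  have E2 : ∀ w ∈ U, lorentz (partialY f w) (partialY f w) = s w ^ 2 := fun w hw => by
    rw [(hf.conformal w hw).1, E1 w hw]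
  constructor
  · exact hU
  · exact fun z hz => (div_pos (hs z hz) hσp).ne'
  · intro z hz
    have hsz := hs z hz
    refine (((gs z hz).const_smul σ⁻¹).congr_of_eventuallyEq (Filter.Eventually.of_forall
      fun w => by simp; ring)).congr_grad ?_ (by simp)
    rw [hs2 z hz, smul_eq_mul]
    field_simp
  · intro z hz
    have hsz := hs z hz
    have hEz := hE z hz
    obtain ⟨gE, ge, -⟩ := gc z hz
    refine (((ge.mul (gE.inv hEz.ne')).const_smul (1 / 2)).congr_of_eventuallyEq
      (Filter.Eventually.of_forall fun w => by simp; ring)).congr_grad ?_ (by simp)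
    rw [hm' z hz, hl' z hz, hn' z hz, hs2 z hz, smul_eq_mul]
    -- The Gauss equation contains the Hopf differential only through `h₁² + h₂² = ρ²`, which is
    -- what turns into the term with `b²`.
    have : h₁ ^ 2 = ρ ^ 2 - h₂ ^ 2 := by rw [hρ2]; ring
    field_simp
    ring_nf
    rw [this]
    ring
  · intro z hz
    have hsz := hs z hz
    refine (hf.smooth.hasGrad_partial hU hz).congr_grad ?_ ?_ <;>
    · match_scalars
      field_simp
  · intro z hz
    have hsz := hs z hz
    obtain ⟨-, -, -, -, x11, x12, -⟩ := gc z hz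
    refine ((ginv z hz).smul (g1 z hz)).congr_grad ?_ ?_
    · rw [x11, hl' z hz, hs2 z hz]
      match_scalars <;> field_simp <;> ring
    · rw [x12, hm' z hz, hs2 z hz]
      match_scalars <;> field_simp
  · intro z hz
    have hsz := hs z hz
    obtain ⟨-, -, -, -, -, x12, x22, -⟩ := gc z hz
    refine ((ginv z hz).smul (g2 z hz)).neg.congr_grad ?_ ?_
    · rw [x12, hm' z hz, hs2 z hz]
      match_scalars <;> field_simp <;> ring
    · rw [x22, hn' z hz, hs2 z hz]
      match_scalars <;> field_simp <;> ring
  · intro z hz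
    have hsz := hs z hz
    obtain ⟨-, -, -, -, -, -, -, gN⟩ := gc z hz
    refine gN.congr_grad ?_ ?_
    · rw [hl' z hz, hm' z hz, hs2 z hz]
      match_scalars <;> field_simp <;> ring
    · rw [hm' z hz, hn' z hz, hs2 z hz]
      match_scalars <;> field_simp <;> ring
  all_goals intro z hz; have hsz := hs z hz; obtain ⟨nN, n1, n2⟩ := hf.frame hz
  · rw [lorentz_smul_left, lorentz_smul_right, E1 z hz]; field_simp
  · rw [lorentz_neg_left, lorentz_neg_right, lorentz_smul_left, lorentz_smul_right, E2 z hz]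
    field_simp
  · exact nN
  · rw [lorentz_neg_right, lorentz_smul_left, lorentz_smul_right, (hf.conformal z hz).2]; simp
  · rw [lorentz_smul_left, lorentz_comm, n1, mul_zero]
  · rw [lorentz_neg_left, lorentz_smul_left, lorentz_comm, n2, mul_zero, neg_zero]
  · rw [← neg_smul, lorentzCross_smul_smul, unitNormal, E1 z hz]
    match_scalars
    field_simp


/-! ## The groups `SU(1,1)` and the adjoint action -/

section Matrices

open scoped Matrix.Norms.Operator
open Complex (I)
open scoped ComplexConjugate

/-- Coordinates of a matrix in `su(1,1)`. -/
noncomputable def ofSu11 : Matrix (Fin 2) (Fin 2) ℂ →L[ℝ] R21 :=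
  LinearMap.toContinuousLinearMap
    { toFun := fun M => ![(M 0 1).re, (M 0 1).im, (M 0 0).im]
      map_add' := fun M N => by ext i; fin_cases i <;> simp
      map_smul' := fun c M => by ext i; fin_cases i <;> simp }

theorem ofSu11_apply (M : Matrix (Fin 2) (Fin 2) ℂ) :
    ofSu11 M = ![(M 0 1).re, (M 0 1).im, (M 0 0).im] := rfl

theorem ofSu11_toSu11 (p : R21) : ofSu11 (toSu11 p) = p := by
  ext i; fin_cases i <;> simp [ofSu11_apply, toSu11]

theorem toSu11_injective : Function.Injective toSu11 :=
  Function.LeftInverse.injective ofSu11_toSu11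

theorem toSu11_add (p q : R21) : toSu11 (p + q) = toSu11 p + toSu11 q := by
  ext i j; fin_cases i <;> fin_cases j <;> simp [toSu11] <;> ring

theorem toSu11_smul (c : ℝ) (p : R21) : toSu11 (c • p) = c • toSu11 p := by
  ext i j; fin_cases i <;> fin_cases j <;> simp [toSu11] <;> ring

/-- Membership in the Lie algebra `su(1,1)`. -/
def IsSu11 (M : Matrix (Fin 2) (Fin 2) ℂ) : Prop :=
  conj (M 0 0) = -M 0 0 ∧ M 1 1 = -M 0 0 ∧ M 1 0 = conj (M 0 1)

theorem isSu11_toSu11 (p : R21) : IsSu11 (toSu11 p) := by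
  refine ⟨?_, ?_, ?_⟩ <;> simp [toSu11, sub_eq_add_neg]

theorem IsSu11.toSu11_ofSu11 {M : Matrix (Fin 2) (Fin 2) ℂ} (h : IsSu11 M) :
    toSu11 (ofSu11 M) = M := by
  obtain ⟨h1, h2, h3⟩ := h
  have h0 : (M 0 0).re = 0 := by
    have := congrArg Complex.re h1
    simp at this; linarith
  ext i j
  fin_cases i <;> fin_cases j <;> simp [toSu11, ofSu11_apply, h2, h3] <;> apply Complex.ext <;>
    simp [h0]

theorem IsSu11.add {M N : Matrix (Fin 2) (Fin 2) ℂ} (hM : IsSu11 M) (hN : IsSu11 N) :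
    IsSu11 (M + N) := by
  rw [← hM.toSu11_ofSu11, ← hN.toSu11_ofSu11, ← toSu11_add]
  exact isSu11_toSu11 _

theorem IsSu11.smul {M : Matrix (Fin 2) (Fin 2) ℂ} (hM : IsSu11 M) (c : ℝ) : IsSu11 (c • M) := by
  rw [← hM.toSu11_ofSu11, ← toSu11_smul]
  exact isSu11_toSu11 _

/-- The subgroup `SU(1,1)` of `SL₂ ℂ`, together with its coset of matrices with `τ(F) = -F`. -/
def IsSU11 (F : Matrix (Fin 2) (Fin 2) ℂ) : Prop :=
  F.det = 1 ∧ ∃ ε : ℂ, (ε = 1 ∨ ε = -1) ∧ F 1 1 = ε * conj (F 0 0) ∧ F 1 0 = ε * conj (F 0 1)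

theorem inv_eq_of_det_one {F : Matrix (Fin 2) (Fin 2) ℂ} (h : F.det = 1) :
    F⁻¹ = !![F 1 1, -F 0 1; -F 1 0, F 0 0] := by
  rw [Matrix.inv_def, h, Ring.inverse_one, one_smul, Matrix.adjugate_fin_two]

theorem mul_inv_of_det_one {F : Matrix (Fin 2) (Fin 2) ℂ} (h : F.det = 1) : F * F⁻¹ = 1 :=
  Matrix.mul_nonsing_inv F (by rw [h]; exact isUnit_one)

theorem inv_mul_of_det_one {F : Matrix (Fin 2) (Fin 2) ℂ} (h : F.det = 1) : F⁻¹ * F = 1 :=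
  Matrix.nonsing_inv_mul F (by rw [h]; exact isUnit_one)

theorem IsSU11.conj_isSu11 {F M : Matrix (Fin 2) (Fin 2) ℂ} (hF : IsSU11 F) (hM : IsSu11 M) :
    IsSu11 (F * M * F⁻¹) := by
  obtain ⟨hd, ε, hε, h1, h2⟩ := hF
  obtain ⟨m1, m2, m3⟩ := hM
  have hεc : conj ε = ε := by rcases hε with rfl | rfl <;> simp
  have hε2 : ε * ε = 1 := by rcases hε with rfl | rfl <;> simp
  rw [inv_eq_of_det_one hd]
  refine ⟨?_, ?_, ?_⟩ <;>
    simp only [Matrix.mul_apply, Fin.sum_univ_two, Matrix.of_apply, Matrix.cons_val',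
      Matrix.cons_val_zero, Matrix.cons_val_one, Matrix.cons_val_fin_one, h1, h2, m2, m3, map_add, map_mul, map_neg,
      Complex.conj_conj, hεc, m1]
  · ring
  · ring
  · linear_combination (2 * conj (F 0 1) * M 0 0 * conj (F 0 0) - conj (F 0 1) ^ 2 * M 0 1 +
      conj (F 0 0) ^ 2 * conj (M 0 1)) * hε2

/-- The adjoint action of `SL₂ ℂ` in the coordinates of `su(1,1)`. -/
noncomputable def adAct (F : Matrix (Fin 2) (Fin 2) ℂ) : R21 →L[ℝ] R21 :=
  LinearMap.toContinuousLinearMap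
    { toFun := fun p => ofSu11 (F * toSu11 p * F⁻¹)
      map_add' := fun p q => by rw [toSu11_add, mul_add, add_mul, map_add]
      map_smul' := fun c p => by
        rw [toSu11_smul, Matrix.mul_smul, Matrix.smul_mul, map_smul, RingHom.id_apply] }

theorem adAct_apply (F : Matrix (Fin 2) (Fin 2) ℂ) (p : R21) :
    adAct F p = ofSu11 (F * toSu11 p * F⁻¹) := rfl

theorem IsSU11.toSu11_adAct {F : Matrix (Fin 2) (Fin 2) ℂ} (hF : IsSU11 F) (p : R21) :
    toSu11 (adAct F p) = F * toSu11 p * F⁻¹ :=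
  (hF.conj_isSu11 (isSu11_toSu11 p)).toSu11_ofSu11

theorem IsSU11.lorentz_adAct {F : Matrix (Fin 2) (Fin 2) ℂ} (hF : IsSU11 F) (p q : R21) :
    lorentz (adAct F p) (adAct F q) = lorentz p q := by
  have h := trace_toSu11_mul (adAct F p) (adAct F q)
  rw [hF.toSu11_adAct, hF.toSu11_adAct,
    show F * toSu11 p * F⁻¹ * (F * toSu11 q * F⁻¹) = F * toSu11 p * (F⁻¹ * F) * toSu11 q * F⁻¹ by
      simp only [mul_assoc], inv_mul_of_det_one hF.1, mul_one, Matrix.trace_mul_comm, ← mul_assoc,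
    ← mul_assoc, inv_mul_of_det_one hF.1, one_mul, trace_toSu11_mul] at h
  exact_mod_cast h.symm

theorem IsSU11.lorentzCross_adAct {F : Matrix (Fin 2) (Fin 2) ℂ} (hF : IsSU11 F) (p q : R21) :
    lorentzCross (adAct F p) (adAct F q) = adAct F (lorentzCross p q) := by
  apply toSu11_injective
  rw [toSu11_lorentzCross, hF.toSu11_adAct, hF.toSu11_adAct, hF.toSu11_adAct, toSu11_lorentzCross]
  have h : ∀ p q, F * toSu11 p * F⁻¹ * (F * toSu11 q * F⁻¹) = F * (toSu11 p * toSu11 q) * F⁻¹ := by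
    intro p q
    rw [show F * toSu11 p * F⁻¹ * (F * toSu11 q * F⁻¹) = F * toSu11 p * (F⁻¹ * F) * toSu11 q * F⁻¹ by
      simp only [mul_assoc], inv_mul_of_det_one hF.1, mul_one, mul_assoc F]
  rw [h, h, Matrix.mul_smul, Matrix.smul_mul, mul_sub, sub_mul]

theorem hasDerivAt_matrix_iff {M : ℝ → Matrix (Fin 2) (Fin 2) ℂ} {D : Matrix (Fin 2) (Fin 2) ℂ}
    {x : ℝ} : HasDerivAt M D x ↔ ∀ i j, HasDerivAt (fun t => M t i j) (D i j) x := by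
  constructor
  · intro h i j
    let T : Matrix (Fin 2) (Fin 2) ℂ →L[ℝ] ℂ := LinearMap.toContinuousLinearMap
      { toFun := fun M => M i j, map_add' := fun _ _ => rfl, map_smul' := fun _ _ => rfl }
    exact T.hasFDerivAt.comp_hasDerivAt x h
  · intro h
    have key : ∀ N : Matrix (Fin 2) (Fin 2) ℂ, N = ∑ i, ∑ j, N i j • Matrix.single i j (1 : ℂ) := by
      intro N
      conv_lhs => rw [Matrix.matrix_eq_sum_single N]
      simp [Matrix.smul_single]
    rw [funext fun t => key (M t), key D]
    exact HasDerivAt.fun_sum fun i _ => HasDerivAt.fun_sum fun j _ => (h i j).smul_const _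

end Matrices


/-! ## Surfaces from extended frames -/

section Frames

open scoped Matrix.Norms.Operator
open Complex (I)
open scoped ComplexConjugate

theorem HasGrad.matrix_mul {F G : ℂ → Matrix (Fin 2) (Fin 2) ℂ}
    {X Y X' Y' : Matrix (Fin 2) (Fin 2) ℂ} {z : ℂ} (hF : HasGrad F X Y z) (hG : HasGrad G X' Y' z) :
    HasGrad (fun w => F w * G w) (X * G z + F z * X') (Y * G z + F z * Y') z := by
  refine HasFDerivAt.congr_fderiv (HasFDerivAt.fun_mul' hF hG) (ContinuousLinearMap.ext fun w => ?_)
  simp only [_root_.add_apply, ContinuousLinearMap.smulRight_apply, _root_.smul_apply, smul_eq_mul,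
    smul_add, op_smul_eq_mul, mul_add, add_mul, Matrix.mul_smul, Matrix.smul_mul]
  abel

/-- The adjugate of a `2 × 2` matrix, as a linear map. -/
noncomputable def adjugateCLM : Matrix (Fin 2) (Fin 2) ℂ →L[ℝ] Matrix (Fin 2) (Fin 2) ℂ :=
  LinearMap.toContinuousLinearMap
    { toFun := Matrix.adjugate
      map_add' := fun M N => by
        ext i j; fin_cases i <;> fin_cases j <;> simp [Matrix.adjugate_fin_two] <;> ring
      map_smul' := fun c M => by
        ext i j; fin_cases i <;> fin_cases j <;> simp [Matrix.adjugate_fin_two] }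

theorem adjugateCLM_apply (M : Matrix (Fin 2) (Fin 2) ℂ) : adjugateCLM M = M.adjugate := rfl

theorem inv_eq_adjugate {F : Matrix (Fin 2) (Fin 2) ℂ} (h : F.det = 1) : F⁻¹ = F.adjugate := by
  rw [Matrix.inv_def, h, Ring.inverse_one, one_smul]

theorem adjugate_eq_neg {A : Matrix (Fin 2) (Fin 2) ℂ} (h : A 1 1 = -A 0 0) : A.adjugate = -A := by
  ext i j; fin_cases i <;> fin_cases j <;> simp [Matrix.adjugate_fin_two, h]

/-- At determinant one the inverse is the adjugate, which is linear on `2 × 2` matrices and equals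
`-X` on a traceless `X`; no inverse has to be differentiated. -/
theorem HasGrad.matrix_inv {F : ℂ → Matrix (Fin 2) (Fin 2) ℂ}
    {X Y : Matrix (Fin 2) (Fin 2) ℂ} {z : ℂ} (hF : HasGrad F (F z * X) (F z * Y) z)
    (hd : ∀ᶠ w in nhds z, (F w).det = 1) (hX : X 1 1 = -X 0 0) (hY : Y 1 1 = -Y 0 0) :
    HasGrad (fun w => (F w)⁻¹) (-(X * (F z)⁻¹)) (-(Y * (F z)⁻¹)) z := by
  refine ((hF.clm_comp adjugateCLM).congr_of_eventuallyEq
    (hd.mono fun w hw => inv_eq_adjugate hw)).congr_grad ?_ ?_ <;>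
  · refine (adjugateCLM_apply _).trans ?_
    rw [Matrix.adjugate_mul_distrib, adjugate_eq_neg ‹_›,
      inv_eq_adjugate hd.self_of_nhds, neg_mul]

/-- The matrix `F⁻¹ F_x` of an extended frame. -/
noncomputable def frameX (a b : ℝ) (l : Circle) : Matrix (Fin 2) (Fin 2) ℂ :=
  !![0, (a : ℂ) * (l : ℂ)⁻¹ - (b : ℂ) * (l : ℂ); (a : ℂ) * (l : ℂ) - (b : ℂ) * (l : ℂ)⁻¹, 0]

/-- The derivative `i λ ∂_λ` of `frameX`. -/
noncomputable def frameX' (a b : ℝ) (l : Circle) : Matrix (Fin 2) (Fin 2) ℂ :=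
  I • !![0, -((a : ℂ) * (l : ℂ)⁻¹) - (b : ℂ) * (l : ℂ);
    (a : ℂ) * (l : ℂ) + (b : ℂ) * (l : ℂ)⁻¹, 0]

/-- The derivative `i λ ∂_λ` of `dpwA`. -/
noncomputable def dpwA' (a b : ℝ) (l : Circle) : Matrix (Fin 2) (Fin 2) ℂ :=
  I • !![0, -((a : ℂ) * (l : ℂ)⁻¹) + (b : ℂ) * (l : ℂ);
    -((a : ℂ) * (l : ℂ)) + (b : ℂ) * (l : ℂ)⁻¹, 0]

/-- The derivative of `Ad F` is `Ad F` applied to a bracket. The structure equations thereby reduce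
to brackets of constant vectors with `F⁻¹F_x` and `F⁻¹F_y`. -/
theorem HasGrad.adAct {F : ℂ → Matrix (Fin 2) (Fin 2) ℂ}
    {X Y : Matrix (Fin 2) (Fin 2) ℂ} {z : ℂ} (hF : HasGrad F (F z * X) (F z * Y) z)
    (hd : ∀ᶠ w in nhds z, (F w).det = 1) (hX : X 1 1 = -X 0 0) (hY : Y 1 1 = -Y 0 0)
    (p : R21) {p₁ p₂ : R21} (h₁ : X * toSu11 p - toSu11 p * X = toSu11 p₁)
    (h₂ : Y * toSu11 p - toSu11 p * Y = toSu11 p₂) :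
    HasGrad (fun w => adAct (F w) p) (_root_.adAct (F z) p₁) (_root_.adAct (F z) p₂) z := by
  refine (((hF.matrix_mul (hasGrad_const (toSu11 p) z)).matrix_mul
    (hF.matrix_inv hd hX hY)).clm_comp ofSu11).congr_grad ?_ ?_ <;>
  · rw [adAct_apply]
    congr 1
    simp only [← h₁, ← h₂]
    noncomm_ring

/-- The Sym-Bobenko formula in terms of `F` and `W = (∂_θ F) F⁻¹`. -/
noncomputable def symFormula (H : ℝ) (F W : Matrix (Fin 2) (Fin 2) ℂ) : R21 :=
  -(1 / (2 * H)) • ofSu11 (F * (I • sigma3) * F⁻¹ + (2 : ℂ) • W)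

theorem toSu11_e₃ : toSu11 ![0, 0, 1] = I • sigma3 := by
  ext i j; fin_cases i <;> fin_cases j <;> simp [toSu11, sigma3]

theorem symFormula_eq (H : ℝ) (F W : Matrix (Fin 2) (Fin 2) ℂ) :
    symFormula H F W = -(1 / (2 * H)) • (adAct F ![0, 0, 1] + (2 : ℝ) • ofSu11 W) := by
  rw [symFormula, map_add, adAct_apply, toSu11_e₃, ← map_smul]
  congr 3

/-- The Sym-Bobenko formula gives a solution of the structure equations. -/
theorem frameSystem_symFormula {a b H : ℝ} (l : Circle) {U : Set ℂ} (hU : IsOpen U)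
    {v r : ℂ → ℝ} {F W : ℂ → Matrix (Fin 2) (Fin 2) ℂ}
    (hv : ∀ z ∈ U, v z ≠ 0) (gv : ∀ z ∈ U, HasGrad v (2 * v z * r z) 0 z)
    (gr : ∀ z ∈ U, HasGrad r (2 * a ^ 2 * v z ^ 2 - 2 * b ^ 2 * (v z)⁻¹ ^ 2) 0 z)
    (hF : ∀ z ∈ U, IsSU11 (F z))
    (gF : ∀ z ∈ U, HasGrad F (F z * frameX (a * v z) (b * (v z)⁻¹) l)
      (F z * (I • dpwA (a * v z) (b * (v z)⁻¹) (r z) l)) z)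
    (gW : ∀ z ∈ U, HasGrad W (F z * frameX' (a * v z) (b * (v z)⁻¹) l * (F z)⁻¹)
      (F z * (I • dpwA' (a * v z) (b * (v z)⁻¹) l) * (F z)⁻¹) z) :
    FrameSystem a b H (((l : ℂ) ^ 2).re) (((l : ℂ) ^ 2).im) U v r
      (fun z => adAct (F z) ![(l : ℂ).im, (l : ℂ).re, 0])
      (fun z => adAct (F z) ![(l : ℂ).re, -(l : ℂ).im, 0])
      (fun z => adAct (F z) ![0, 0, 1]) (fun z => symFormula H (F z) (W z)) := by
  obtain ⟨x, hx⟩ : ∃ x, x = (l : ℂ).re := ⟨_, rfl⟩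
  obtain ⟨y, hy⟩ : ∃ y, y = (l : ℂ).im := ⟨_, rfl⟩
  have hl : (l : ℂ) = x + y * I := by rw [hx, hy, Complex.re_add_im]
  have hxy : x ^ 2 + y ^ 2 = 1 := by
    have := l.normSq_coe
    rw [Complex.normSq_apply] at this
    rw [hx, hy]; linarith
  have hxyc : (x : ℂ) ^ 2 + (y : ℂ) ^ 2 = 1 := by exact_mod_cast hxy
  have hli : (l : ℂ)⁻¹ = x - y * I := by
    rw [← Circle.coe_inv, Circle.coe_inv_eq_conj, hl]
    simp [sub_eq_add_neg]
  have hl' : ∀ c : ℂ, c * (l : ℂ) = c * (x + y * I) := fun c => by rw [hl]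
  have hli' : ∀ c : ℂ, c * (l : ℂ)⁻¹ = c * (x - y * I) := fun c => by rw [hli]
  have hp : ((l : ℂ) ^ 2).re = x ^ 2 - y ^ 2 := by rw [hl]; simp [pow_two]
  have hq : ((l : ℂ) ^ 2).im = 2 * x * y := by rw [hl]; simp [pow_two]; ring
  rw [hp, hq, ← hx, ← hy]
  have hd : ∀ z ∈ U, ∀ᶠ w in nhds z, (F w).det = 1 := fun z hz =>
    Filter.eventually_of_mem (hU.mem_nhds hz) fun w hw => (hF w hw).1
  have tX : ∀ a b : ℝ, frameX a b l 1 1 = -frameX a b l 0 0 := fun a b => by simp [frameX]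
  have tY : ∀ a b r : ℝ, (I • dpwA a b r l) 1 1 = -(I • dpwA a b r l) 0 0 := fun a b r => by
    simp [dpwA]
  have hI2 : I ^ 2 = -1 := Complex.I_sq
  -- The horizontal basis vectors are rotated according to `λ₀ = x + iy`, so that `f_x` will point
  -- along the first one. The six brackets are the coefficients of the structure equations.
  have c1X : ∀ a b : ℝ, frameX a b l * toSu11 ![y, x, 0] - toSu11 ![y, x, 0] * frameX a b l =
      toSu11 (-(2 * a - 2 * b * (x ^ 2 - y ^ 2)) • ![0, 0, 1]) := by
    intro a b
    ext i j; fin_cases i <;> fin_cases j <;> simp [toSu11, frameX, hl', hli'] <;> grind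
  have c2X : ∀ a b : ℝ, frameX a b l * toSu11 ![x, -y, 0] - toSu11 ![x, -y, 0] * frameX a b l =
      toSu11 (-(2 * b * (2 * x * y)) • ![0, 0, 1]) := by
    intro a b
    ext i j; fin_cases i <;> fin_cases j <;> simp [toSu11, frameX, hl', hli'] <;> grind
  have c3X : ∀ a b : ℝ, frameX a b l * toSu11 ![0, 0, 1] - toSu11 ![0, 0, 1] * frameX a b l =
      toSu11 (-(2 * a - 2 * b * (x ^ 2 - y ^ 2)) • ![y, x, 0] - (2 * b * (2 * x * y)) • ![x, -y, 0]) := by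
    intro a b
    ext i j; fin_cases i <;> fin_cases j <;> simp [toSu11, frameX, hl', hli'] <;> grind
  have c1Y : ∀ a b r : ℝ, (I • dpwA a b r l) * toSu11 ![y, x, 0] - toSu11 ![y, x, 0] * (I • dpwA a b r l) =
      toSu11 (-(2 * r) • ![x, -y, 0] + (2 * b * (2 * x * y)) • ![0, 0, 1]) := by
    intro a b r
    ext i j; fin_cases i <;> fin_cases j <;> simp [toSu11, dpwA, hl', hli'] <;> grind
  have c2Y : ∀ a b r : ℝ, (I • dpwA a b r l) * toSu11 ![x, -y, 0] - toSu11 ![x, -y, 0] * (I • dpwA a b r l) =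
      toSu11 ((2 * r) • ![y, x, 0] + (2 * a + 2 * b * (x ^ 2 - y ^ 2)) • ![0, 0, 1]) := by
    intro a b r
    ext i j; fin_cases i <;> fin_cases j <;> simp [toSu11, dpwA, hl', hli'] <;> grind
  have c3Y : ∀ a b r : ℝ, (I • dpwA a b r l) * toSu11 ![0, 0, 1] - toSu11 ![0, 0, 1] * (I • dpwA a b r l) =
      toSu11 ((2 * b * (2 * x * y)) • ![y, x, 0] + (2 * a + 2 * b * (x ^ 2 - y ^ 2)) • ![x, -y, 0]) := by
    intro a b r
    ext i j; fin_cases i <;> fin_cases j <;> simp [toSu11, dpwA, hl', hli'] <;> grind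
  -- The parameter derivative of `F⁻¹F_x` is `-2a e₁` minus half its bracket with `e₃`. In the
  -- Sym-Bobenko formula that half bracket cancels the derivative of `Ad F e₃`, leaving `(2a/H) e₁`;
  -- `dY` does the same for `f_y`.
  have dX : ∀ a b : ℝ, frameX' a b l = toSu11 (-(2 * a) • ![y, x, 0] -
      (1 / 2 : ℝ) • (-(2 * a - 2 * b * (x ^ 2 - y ^ 2)) • ![y, x, 0] - (2 * b * (2 * x * y)) • ![x, -y, 0])) := by
    intro a b
    ext i j; fin_cases i <;> fin_cases j <;> simp [toSu11, frameX', hl', hli'] <;> grind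
  have dY : ∀ a b : ℝ, I • dpwA' a b l = toSu11 ((2 * a) • ![x, -y, 0] -
      (1 / 2 : ℝ) • ((2 * b * (2 * x * y)) • ![y, x, 0] + (2 * a + 2 * b * (x ^ 2 - y ^ 2)) • ![x, -y, 0])) := by
    intro a b
    ext i j; fin_cases i <;> fin_cases j <;> simp [toSu11, dpwA', hl', hli'] <;> grind
  refine ⟨hU, hv, gv, gr, fun z hz => ?_, fun z hz => ?_, fun z hz => ?_, fun z hz => ?_,
    fun z hz => ?_, fun z hz => ?_, fun z hz => ?_, fun z hz => ?_, fun z hz => ?_, fun z hz => ?_,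
    fun z hz => ?_⟩
  · have h1 := (gF z hz).adAct (hd z hz) (tX _ _) (tY _ _ _) _ (c3X _ _) (c3Y _ _ _)
    have gW' := gW z hz
    rw [dX, dY] at gW'
    have h2 : HasGrad (fun w => ofSu11 (W w)) (adAct (F z) _) (adAct (F z) _) z :=
      gW'.clm_comp ofSu11
    refine (((h1.add (h2.const_smul 2)).const_smul (-(1 / (2 * H)))).congr_of_eventuallyEq
      (Filter.Eventually.of_forall fun w => symFormula_eq H (F w) (W w))).congr_grad ?_ ?_
    · simp only [map_add, map_sub, map_smul]
      match_scalars <;> ring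
    · simp only [map_add, map_sub, map_smul]
      match_scalars <;> ring
  · refine ((gF z hz).adAct (hd z hz) (tX _ _) (tY _ _ _) _ (c1X _ _) (c1Y _ _ _)).congr_grad ?_ ?_
    · simp only [map_add, map_sub, map_smul]
      module
    · simp only [map_add, map_sub, map_smul]
      module
  · refine ((gF z hz).adAct (hd z hz) (tX _ _) (tY _ _ _) _ (c2X _ _) (c2Y _ _ _)).congr_grad ?_ ?_
    · simp only [map_add, map_sub, map_smul]
      module
    · simp only [map_add, map_sub, map_smul]
      module
  · refine ((gF z hz).adAct (hd z hz) (tX _ _) (tY _ _ _) _ (c3X _ _) (c3Y _ _ _)).congr_grad ?_ ?_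
    · simp only [map_add, map_sub, map_smul]
      module
    · simp only [map_add, map_sub, map_smul]
      module
  all_goals first | rw [(hF z hz).lorentz_adAct] | rw [(hF z hz).lorentzCross_adAct, ← map_neg]
  · simp [lorentz]; linarith
  · simp [lorentz]; linarith
  · simp [lorentz]
  · simp [lorentz]; ring
  · simp [lorentz]
  · simp [lorentz]
  · congr 1
    ext i; fin_cases i <;> simp [lorentzCross]; linarith

end Frames


/-! ## Linear differential equations with a parameter -/

section Dyson

open Set

variable {𝔸 : Type*} [NormedRing 𝔸] [NormedAlgebra ℂ 𝔸]

theorem exists_Icc_subset_of_mem {I : Set ℝ} (hI : IsOpen I) (hI' : I.OrdConnected) (h0 : 0 ∈ I)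
    {x : ℝ} (hx : x ∈ I) : ∃ α β, α < 0 ∧ 0 < β ∧ α < x ∧ x < β ∧ Icc α β ⊆ I := by
  have hmin : min 0 x ∈ I := by rcases min_choice 0 x with h | h <;> rw [h] <;> assumption
  have hmax : max 0 x ∈ I := by rcases max_choice 0 x with h | h <;> rw [h] <;> assumption
  obtain ⟨ε, hε, hε'⟩ := Metric.isOpen_iff.1 hI _ hmin
  obtain ⟨δ, hδ, hδ'⟩ := Metric.isOpen_iff.1 hI _ hmax
  refine ⟨min 0 x - ε / 2, max 0 x + δ / 2, ?_, ?_, ?_, ?_, hI'.out (hε' ?_) (hδ' ?_)⟩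
  · linarith [min_le_left 0 x]
  · linarith [le_max_left 0 x]
  · linarith [min_le_right 0 x]
  · linarith [le_max_right 0 x]
  · rw [Metric.mem_ball, Real.dist_eq, abs_lt]; constructor <;> linarith
  · rw [Metric.mem_ball, Real.dist_eq, abs_lt]; constructor <;> linarith

/-- The terms of the Dyson series of the equation `C' = λ M C`. -/
noncomputable def dysonTerm (M : ℝ → 𝔸) : ℕ → ℝ → 𝔸
  | 0, _ => 1
  | n + 1, x => ∫ t in (0 : ℝ)..x, M t * dysonTerm M n t

variable {I : Set ℝ} {M : ℝ → 𝔸}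

theorem hasDerivAt_integral_of_continuousOn [CompleteSpace 𝔸] {g : ℝ → 𝔸} (hI : IsOpen I)
    (hI' : I.OrdConnected) (h0 : 0 ∈ I) (hg : ContinuousOn g I) {x : ℝ} (hx : x ∈ I) :
    HasDerivAt (fun y => ∫ t in (0 : ℝ)..y, g t) (g x) x :=
  intervalIntegral.integral_hasDerivAt_right
    ((hg.mono (hI'.uIcc_subset h0 hx)).intervalIntegrable)
    (hg.stronglyMeasurableAtFilter hI x hx) (hg.continuousAt (hI.mem_nhds hx))

theorem continuousOn_dysonTerm [CompleteSpace 𝔸] (hI : IsOpen I) (hI' : I.OrdConnected) (h0 : 0 ∈ I)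
    (hM : ContinuousOn M I) (n : ℕ) : ContinuousOn (dysonTerm M n) I := by
  induction n with
  | zero => exact continuousOn_const
  | succ n ih => exact fun x hx => (hasDerivAt_integral_of_continuousOn hI hI' h0
      (hM.mul ih) hx).continuousAt.continuousWithinAt

theorem hasDerivAt_dysonTerm [CompleteSpace 𝔸] (hI : IsOpen I) (hI' : I.OrdConnected) (h0 : 0 ∈ I)
    (hM : ContinuousOn M I) (n : ℕ) {x : ℝ} (hx : x ∈ I) :
    HasDerivAt (dysonTerm M (n + 1)) (M x * dysonTerm M n x) x :=
  hasDerivAt_integral_of_continuousOn hI hI' h0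
    (hM.mul (continuousOn_dysonTerm hI hI' h0 hM n)) hx

/-- Each integration of `|t|ⁿ` contributes a factor `1/(n+1)`. The factorial makes the series
converge for every value of the loop parameter, so the solution is entire in it. -/
theorem norm_dysonTerm_le [NormOneClass 𝔸] {K : ℝ} {J : Set ℝ} (hJ : J.OrdConnected) (h0 : 0 ∈ J)
    (hK : ∀ x ∈ J, ‖M x‖ ≤ K) (n : ℕ) :
    ∀ x ∈ J, ‖dysonTerm M n x‖ ≤ (K * |x|) ^ n / n.factorial := by
  have hK0 : 0 ≤ K := (norm_nonneg _).trans (hK 0 h0)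
  induction n with
  | zero => intro x _; simp [dysonTerm]
  | succ n ih =>
    intro x hx
    have hsub : Set.uIoc 0 x ⊆ J := Set.uIoc_subset_uIcc.trans (hJ.uIcc_subset h0 hx)
    have hi : ∫ t in Set.uIoc 0 x, K * ((K * |t|) ^ n / n.factorial) =
        (K * |x|) ^ (n + 1) / (n + 1).factorial := by
      have := integral_pow_abs_sub_uIoc (a := 0) (b := x) n
      simp only [sub_zero] at this
      simp only [mul_pow, mul_div_assoc]
      rw [MeasureTheory.integral_const_mul, MeasureTheory.integral_const_mul,
        MeasureTheory.integral_div, this, Nat.factorial_succ]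
      push_cast
      field_simp
      ring
    rw [dysonTerm, ← hi]
    refine (intervalIntegral.norm_integral_le_integral_norm_uIoc).trans ?_
    refine MeasureTheory.integral_mono_of_nonneg (Filter.Eventually.of_forall fun _ => norm_nonneg _)
      ?_ ?_
    · refine (Continuous.integrableOn_uIcc ?_ (a := 0) (b := x)).mono_set Set.uIoc_subset_uIcc
      fun_prop
    · refine (MeasureTheory.ae_restrict_iff' measurableSet_uIoc).2
        (Filter.Eventually.of_forall fun t ht => ?_)
      exact (norm_mul_le _ _).trans
        (mul_le_mul (hK t (hsub ht)) (ih t (hsub ht)) (norm_nonneg _) hK0)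

/-- The sum of the Dyson series. -/
noncomputable def dysonSum (M : ℝ → 𝔸) (x : ℝ) (w : ℂ) :
    𝔸 := ∑' n, w ^ n • dysonTerm M n x

theorem exists_norm_dysonTerm_le [NormOneClass 𝔸] (hI : IsOpen I) (hI' : I.OrdConnected) (h0 : 0 ∈ I)
    (hM : ContinuousOn M I) {x : ℝ} (hx : x ∈ I) : ∃ α β K : ℝ, α < 0 ∧ 0 < β ∧ α < x ∧ x < β ∧
      Icc α β ⊆ I ∧ 0 ≤ K ∧ (∀ t ∈ Icc α β, ‖M t‖ ≤ K) ∧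
      ∃ ρ, 0 ≤ ρ ∧ ∀ n, ∀ t ∈ Icc α β, ‖dysonTerm M n t‖ ≤ ρ ^ n / n.factorial := by
  obtain ⟨α, β, h1, h2, h3, h4, h5⟩ := exists_Icc_subset_of_mem hI hI' h0 hx
  obtain ⟨K, hK⟩ := isCompact_Icc.exists_bound_of_continuousOn (hM.mono h5)
  have hK0 : 0 ≤ K := (norm_nonneg _).trans (hK 0 ⟨h1.le, h2.le⟩)
  refine ⟨α, β, K, h1, h2, h3, h4, h5, hK0, hK, K * (|α| + |β|), by positivity, fun n t ht => ?_⟩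
  refine (norm_dysonTerm_le ordConnected_Icc ⟨h1.le, h2.le⟩ hK n t ht).trans ?_
  have : |t| ≤ |α| + |β| := by
    rw [abs_le]
    constructor <;> linarith [neg_abs_le α, le_abs_self β, abs_nonneg α, abs_nonneg β, ht.1, ht.2]
  gcongr

theorem summable_dyson [NormOneClass 𝔸] [CompleteSpace 𝔸]
    (hI : IsOpen I) (hI' : I.OrdConnected) (h0 : 0 ∈ I)
    (hM : ContinuousOn M I) {x : ℝ} (hx : x ∈ I) (w : ℂ) :
    Summable fun n => w ^ n • dysonTerm M n x := by
  obtain ⟨α, β, K, h1, h2, h3, h4, h5, hK0, hK, ρ, hρ, hb⟩ :=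
    exists_norm_dysonTerm_le hI hI' h0 hM hx
  refine Summable.of_norm_bounded (Real.summable_pow_div_factorial (‖w‖ * ρ)) fun n => ?_
  rw [norm_smul, norm_pow, mul_pow, mul_div_assoc]
  exact mul_le_mul_of_nonneg_left (hb n x ⟨h3.le, h4.le⟩) (by positivity)

theorem dysonSum_zero (w : ℂ) : dysonSum M 0 w = 1 := by
  rw [dysonSum, tsum_eq_single 0]
  · simp [dysonTerm]
  · intro n hn
    obtain ⟨m, rfl⟩ := Nat.exists_eq_succ_of_ne_zero hn
    simp [dysonTerm]

theorem differentiable_dysonSum [NormOneClass 𝔸] [CompleteSpace 𝔸]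
    (hI : IsOpen I) (hI' : I.OrdConnected) (h0 : 0 ∈ I)
    (hM : ContinuousOn M I) {x : ℝ} (hx : x ∈ I) : Differentiable ℂ (dysonSum M x) := by
  obtain ⟨α, β, K, h1, h2, h3, h4, h5, hK0, hK, ρ, hρ, hb⟩ :=
    exists_norm_dysonTerm_le hI hI' h0 hM hx
  intro w
  have := Complex.differentiableOn_tsum_of_summable_norm (U := Metric.ball 0 (‖w‖ + 1))
    (F := fun n w => w ^ n • dysonTerm M n x)
    (Real.summable_pow_div_factorial ((‖w‖ + 1) * ρ))
    (fun n => by fun_prop) Metric.isOpen_ball (fun n w' hw' => ?_)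
  · exact this.differentiableAt (Metric.isOpen_ball.mem_nhds (by simp))
  · have hw'' : ‖w'‖ ≤ ‖w‖ + 1 := by simpa using (mem_ball_zero_iff.1 hw').le
    rw [norm_smul, norm_pow, mul_pow, mul_div_assoc]
    have := hb n x ⟨h3.le, h4.le⟩
    gcongr

theorem continuousOn_dysonSum [NormOneClass 𝔸] [CompleteSpace 𝔸]
    (hI : IsOpen I) (hI' : I.OrdConnected) (h0 : 0 ∈ I)
    (hM : ContinuousOn M I) :
    ContinuousOn (fun p : ℝ × ℂ => dysonSum M p.1 p.2) (I ×ˢ univ) := by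
  rintro ⟨x, w⟩ ⟨hx, -⟩
  obtain ⟨α, β, K, h1, h2, h3, h4, h5, hK0, hK, ρ, hρ, hb⟩ :=
    exists_norm_dysonTerm_le hI hI' h0 hM hx
  have hopen : IsOpen (Ioo α β ×ˢ Metric.ball (0 : ℂ) (‖w‖ + 1)) := isOpen_Ioo.prod Metric.isOpen_ball
  have : ContinuousOn (fun p : ℝ × ℂ => dysonSum M p.1 p.2)
      (Ioo α β ×ˢ Metric.ball (0 : ℂ) (‖w‖ + 1)) := by
    refine continuousOn_tsum (f := fun n (p : ℝ × ℂ) => p.2 ^ n • dysonTerm M n p.1)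
      (u := fun n => ((‖w‖ + 1) * ρ) ^ n / n.factorial) (fun n => ?_)
      (Real.summable_pow_div_factorial _) fun n p hp => ?_
    · have hc : ContinuousOn (fun p : ℝ × ℂ => dysonTerm M n p.1)
          (Ioo α β ×ˢ Metric.ball (0 : ℂ) (‖w‖ + 1)) :=
        ContinuousOn.comp (g := dysonTerm M n) (continuousOn_dysonTerm hI hI' h0 hM n)
          continuousOn_fst fun p hp => h5 (Ioo_subset_Icc_self hp.1)
      exact (continuous_snd.pow n).continuousOn.smul hc
    · have hw'' : ‖p.2‖ ≤ ‖w‖ + 1 := by simpa using (mem_ball_zero_iff.1 hp.2).le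
      rw [norm_smul, norm_pow, mul_pow, mul_div_assoc]
      have := hb n p.1 (Ioo_subset_Icc_self hp.1)
      gcongr
  exact (this.continuousAt (hopen.mem_nhds ⟨⟨h3, h4⟩, by simp⟩)).continuousWithinAt

theorem hasDerivAt_dysonSum [NormOneClass 𝔸] [CompleteSpace 𝔸]
    (hI : IsOpen I) (hI' : I.OrdConnected) (h0 : 0 ∈ I)
    (hM : ContinuousOn M I) {x : ℝ} (hx : x ∈ I) (w : ℂ) :
    HasDerivAt (fun t => dysonSum M t w) (w • (M x * dysonSum M x w)) x := by
  obtain ⟨α, β, K, h1, h2, h3, h4, h5, hK0, hK, ρ, hρ, hb⟩ :=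
    exists_norm_dysonTerm_le hI hI' h0 hM hx
  -- Differentiation lowers the index by one: the constant zeroth term contributes nothing, and term
  -- `n + 1` returns term `n` times `w M`.
  let g' : ℕ → ℝ → 𝔸 := fun n t =>
    Nat.casesOn n 0 fun m => w ^ (m + 1) • (M t * dysonTerm M m t)
  have hsum : ∑' n, g' n x = w • (M x * dysonSum M x w) := by
    have hs : Summable fun n => w • (M x * (w ^ n • dysonTerm M n x)) :=
      ((summable_dyson hI hI' h0 hM hx w).mul_left (M x)).const_smul w
    have hs' : Summable fun n => g' n x := by
      rw [← summable_nat_add_iff 1]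
      refine hs.congr fun n => ?_
      show _ = w ^ (n + 1) • (M x * dysonTerm M n x)
      simp only [g', mul_smul_comm, smul_smul, pow_succ']
    rw [hs'.tsum_eq_zero_add, dysonSum, ← (summable_dyson hI hI' h0 hM hx w).tsum_mul_left (M x),
      ← ((summable_dyson hI hI' h0 hM hx w).mul_left (M x)).tsum_const_smul w]
    refine (zero_add _).trans ?_
    congr 1
    funext n
    show w ^ (n + 1) • (M x * dysonTerm M n x) = _
    simp only [mul_smul_comm, smul_smul, pow_succ']
  rw [← hsum]
  let u : ℕ → ℝ := fun n => Nat.casesOn n 0 fun m => ‖w‖ * K * ((‖w‖ * ρ) ^ m / m.factorial)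
  have hu : Summable u := by
    rw [← summable_nat_add_iff 1]
    exact (Real.summable_pow_div_factorial (‖w‖ * ρ)).mul_left (‖w‖ * K)
  refine hasDerivAt_tsum_of_isPreconnected (t := Ioo α β) (g := fun n t => w ^ n • dysonTerm M n t)
    (g' := g') (y₀ := x) hu isOpen_Ioo isPreconnected_Ioo (fun n t ht => ?_) (fun n t ht => ?_)
    ⟨h3, h4⟩ (summable_dyson hI hI' h0 hM hx w) ⟨h3, h4⟩
  · cases n with
    | zero => simpa [g', dysonTerm] using hasDerivAt_const t (1 : 𝔸)
    | succ n =>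
      exact (hasDerivAt_dysonTerm hI hI' h0 hM n (h5 (Ioo_subset_Icc_self ht))).fun_const_smul _
  · cases n with
    | zero => simp [g', u]
    | succ n =>
      simp only [g', u]
      rw [norm_smul, norm_pow, pow_succ]
      have hb' := hb n t (Ioo_subset_Icc_self ht)
      have hK' := hK t (Ioo_subset_Icc_self ht)
      calc ‖w‖ ^ n * ‖w‖ * ‖M t * dysonTerm M n t‖
          ≤ ‖w‖ ^ n * ‖w‖ * (K * (ρ ^ n / n.factorial)) := by
            gcongr
            exact (norm_mul_le _ _).trans (by gcongr)
        _ = _ := by rw [mul_pow]; ring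

end Dyson


section Parameter

open Set MeasureTheory

variable {𝔸 : Type*} [NormedRing 𝔸] [NormedAlgebra ℂ 𝔸]

/-- Because `c` vanishes at `0`, continuity of `K` suffices for the product rule. This avoids
presupposing the differentiability in `θ` that is to be proved. -/
theorem hasDerivAt_smul_of_continuousAt {c : ℝ → ℂ} {c' : ℂ} {K : ℝ → 𝔸} (hc : HasDerivAt c c' 0)
    (hc0 : c 0 = 0) (hK : ContinuousAt K 0) :
    HasDerivAt (fun θ => c θ • K θ) (c' • K 0) 0 := by
  rw [hasDerivAt_iff_tendsto_slope_zero] at hc ⊢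
  have h0 : Filter.Tendsto K (nhdsWithin 0 {0}ᶜ) (nhds (K 0)) := hK.tendsto.mono_left nhdsWithin_le_nhds
  refine (hc.smul h0).congr' (Filter.Eventually.of_forall fun t => ?_)
  simp [hc0, mul_smul]
  norm_cast

theorem continuousAt_integral_of_continuousOn [CompleteSpace 𝔸] {I : Set ℝ} (hI' : I.OrdConnected)
    (h0 : 0 ∈ I) {g : ℝ → ℝ → 𝔸} (hg : ContinuousOn (fun p : ℝ × ℝ => g p.1 p.2) (I ×ˢ univ)) {x : ℝ}
    (hx : x ∈ I) : ContinuousAt (fun θ => ∫ s in (0 : ℝ)..x, g s θ) 0 := by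
  have hsub : uIcc 0 x ⊆ I := hI'.uIcc_subset h0 hx
  obtain ⟨C, hC⟩ := (isCompact_uIcc.prod (isCompact_Icc (a := (-1 : ℝ)) (b := 1)))
    |>.exists_bound_of_continuousOn (f := fun p : ℝ × ℝ => g p.1 p.2)
      (s := uIcc 0 x ×ˢ Icc (-1) 1) (hg.mono (prod_mono hsub (subset_univ _)))
  have hs : ∀ θ, ContinuousOn (fun s => g s θ) (uIcc 0 x) := fun θ =>
    ContinuousOn.comp (g := fun p : ℝ × ℝ => g p.1 p.2) hg
      (continuousOn_id.prodMk continuousOn_const) fun s hs => ⟨hsub hs, trivial⟩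
  refine intervalIntegral.continuousAt_of_dominated_interval (bound := fun _ => C)
    (Filter.Eventually.of_forall fun θ => ((hs θ).mono uIoc_subset_uIcc).aestronglyMeasurable
      measurableSet_uIoc) ?_ intervalIntegrable_const ?_
  · filter_upwards [Icc_mem_nhds (show (-1 : ℝ) < 0 by norm_num) zero_lt_one] with θ hθ
    exact Filter.Eventually.of_forall fun s hs => hC (s, θ) ⟨uIoc_subset_uIcc hs, hθ⟩
  · refine Filter.Eventually.of_forall fun s hs => ?_
    have : ContinuousOn (fun θ => g s θ) univ :=
      ContinuousOn.comp (g := fun p : ℝ × ℝ => g p.1 p.2) hg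
        (continuousOn_const.prodMk continuousOn_id) fun θ _ => ⟨hsub (uIoc_subset_uIcc hs), trivial⟩
    exact this.continuousAt Filter.univ_mem

/-- Differentiation of the solution of a linear differential equation in a parameter. -/
theorem exists_hasDerivAt_parameter [CompleteSpace 𝔸] {I : Set ℝ} (hI : IsOpen I)
    (hI' : I.OrdConnected) (h0 : 0 ∈ I) {F : ℝ → ℝ → 𝔸} {α A₁ A₂ G : ℝ → 𝔸} {c₁ c₂ : ℝ → ℂ} {d₁ d₂ : ℂ}
    (hA₁ : ContinuousOn A₁ I) (hA₂ : ContinuousOn A₂ I)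
    (hc₁ : HasDerivAt c₁ d₁ 0) (hc₂ : HasDerivAt c₂ d₂ 0) (hc₁0 : c₁ 0 = 0) (hc₂0 : c₂ 0 = 0)
    (hFc : ContinuousOn (fun p : ℝ × ℝ => F p.1 p.2) (I ×ˢ univ)) (hF0 : ∀ θ, F 0 θ = 1)
    (hF : ∀ x ∈ I, ∀ θ, HasDerivAt (fun t => F t θ) (F x θ * (α x + c₁ θ • A₁ x + c₂ θ • A₂ x)) x)
    (hG0 : G 0 = 1) (hGF : ∀ x ∈ I, G x * F x 0 = 1)
    (hG : ∀ x ∈ I, HasDerivAt G (-(α x * G x)) x) :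
    ∃ W : ℝ → 𝔸, W 0 = 0 ∧ ∀ x ∈ I, HasDerivAt (fun θ => F x θ) (W x * F x 0) 0 ∧
      HasDerivAt W (F x 0 * (d₁ • A₁ x + d₂ • A₂ x) * G x) x := by
  have hGc : ContinuousOn G I := fun x hx => (hG x hx).continuousAt.continuousWithinAt
  have hgc : ∀ {A : ℝ → 𝔸}, ContinuousOn A I →
      ContinuousOn (fun p : ℝ × ℝ => F p.1 p.2 * A p.1 * G p.1) (I ×ˢ univ) := fun {A} hA =>
    (hFc.mul (ContinuousOn.comp (g := A) hA continuousOn_fst fun p hp => hp.1)).mul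
      (ContinuousOn.comp (g := G) hGc continuousOn_fst fun p hp => hp.1)
  have hgc' : ∀ {A : ℝ → 𝔸}, ContinuousOn A I → ∀ θ, ContinuousOn (fun s => F s θ * A s * G s) I :=
    fun {A} hA θ => ContinuousOn.comp (g := fun p : ℝ × ℝ => F p.1 p.2 * A p.1 * G p.1) (hgc hA)
      (continuousOn_id.prodMk continuousOn_const) fun s hs => ⟨hs, trivial⟩
  have hW : ContinuousOn (fun s => F s 0 * (d₁ • A₁ s + d₂ • A₂ s) * G s) I :=
    hgc' ((hA₁.const_smul d₁).add (hA₂.const_smul d₂)) 0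
  refine ⟨fun x => ∫ s in (0 : ℝ)..x, F s 0 * (d₁ • A₁ s + d₂ • A₂ s) * G s, by simp,
    fun x hx => ⟨?_, hasDerivAt_integral_of_continuousOn hI hI' h0 hW hx⟩⟩
  have hsub : uIcc 0 x ⊆ I := hI'.uIcc_subset h0 hx
  have hint' : ∀ {A : ℝ → 𝔸}, ContinuousOn A I → ∀ (θ : ℝ) (c : ℂ),
      IntervalIntegrable (fun s => c • (F s θ * A s * G s)) volume 0 x := fun {A} hA θ c =>
    (((hgc' hA θ).mono hsub).const_smul c).intervalIntegrable
  have hcont : ∀ {A : ℝ → 𝔸}, ContinuousOn A I →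
      ContinuousAt (fun θ => ∫ s in (0 : ℝ)..x, F s θ * A s * G s) 0 := fun {A} hA =>
    continuousAt_integral_of_continuousOn (g := fun s θ => F s θ * A s * G s) hI' h0 (hgc hA) hx
  -- Duhamel's formula: in the `x`-derivative of `F(x,θ) G(x)` the terms with `α` cancel, and the
  -- rest carries the factors `c₁ θ`, `c₂ θ`. The integrals need only be continuous at `θ = 0`.
  have key : ∀ θ, F x θ = (1 + c₁ θ • (∫ s in (0 : ℝ)..x, F s θ * A₁ s * G s) +
      c₂ θ • (∫ s in (0 : ℝ)..x, F s θ * A₂ s * G s)) * F x 0 := by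
    intro θ
    have hd : ∀ s ∈ uIcc 0 x, HasDerivAt (fun s => F s θ * G s)
        (c₁ θ • (F s θ * A₁ s * G s) + c₂ θ • (F s θ * A₂ s * G s)) s := by
      intro s hs
      refine ((hF s (hsub hs) θ).mul (hG s (hsub hs))).congr_deriv ?_
      simp only [mul_add, add_mul, mul_smul_comm, smul_mul_assoc, mul_assoc, mul_neg]
      abel
    have := intervalIntegral.integral_eq_sub_of_hasDerivAt hd
      ((hint' hA₁ θ _).add (hint' hA₂ θ _))
    rw [intervalIntegral.integral_add (hint' hA₁ θ _) (hint' hA₂ θ _),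
      intervalIntegral.integral_smul, intervalIntegral.integral_smul, hF0, hG0, mul_one] at this
    rw [add_assoc, this, add_sub_cancel, mul_assoc, hGF x hx, mul_one]
  have hk := ((((hasDerivAt_smul_of_continuousAt hc₁ hc₁0
    (hcont hA₁)).const_add 1).add
      (hasDerivAt_smul_of_continuousAt hc₂ hc₂0 (hcont hA₂))).mul_const (F x 0))
  refine (hk.congr_deriv ?_).congr_of_eventuallyEq (Filter.Eventually.of_forall key)
  congr 1
  rw [← intervalIntegral.integral_smul, ← intervalIntegral.integral_smul,
    ← intervalIntegral.integral_add (hint' hA₁ 0 _) (hint' hA₂ 0 _)]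
  simp only [mul_add, add_mul, mul_smul_comm, smul_mul_assoc]

end Parameter


/-! ## Holomorphic functions with boundary values -/

section Boundary

open Set Metric
open Complex (I)
open scoped ComplexConjugate

/-- By the maximum principle for `exp(±ih)` the imaginary part of `h` vanishes on the whole closed
disc. Then `exp(ith)` has constant modulus one, hence is constant for each real `t`. -/
theorem DiffContOnCl.eq_of_im_eq_zero {h : ℂ → ℂ} (hh : DiffContOnCl ℂ h (ball 0 1))
    (hr : ∀ l : Circle, (h l).im = 0) {w : ℂ} (hw : w ∈ closedBall (0 : ℂ) 1) : h w = h 0 := by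
  have hfr : frontier (ball (0 : ℂ) 1) = sphere 0 1 := frontier_ball 0 one_ne_zero
  have hcl : closure (ball (0 : ℂ) 1) = closedBall 0 1 := closure_ball 0 one_ne_zero
  have hd : ∀ t : ℝ, DiffContOnCl ℂ (fun w => Complex.exp ((t * I) * h w)) (ball 0 1) := fun t =>
    (Complex.differentiable_exp.comp (f := fun u => (t * I) * u)
      (differentiable_id.const_mul (t * I))).comp_diffContOnCl hh
  have hle : ∀ t : ℝ, ∀ w ∈ closedBall (0 : ℂ) 1, ‖Complex.exp ((t * I) * h w)‖ ≤ 1 := by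
    intro t w hw
    refine Complex.norm_le_of_forall_mem_frontier_norm_le isBounded_ball (hd t) (fun z hz => ?_)
      (hcl ▸ hw)
    rw [hfr] at hz
    have := hr ⟨z, hz⟩
    rw [Complex.norm_exp]
    simp only at this
    simp [this]
  have him : ∀ w ∈ closedBall (0 : ℂ) 1, (h w).im = 0 := by
    intro w hw
    have h1 := hle 1 w hw
    have h2 := hle (-1) w hw
    rw [Complex.norm_exp, Real.exp_le_one_iff] at h1 h2
    simp at h1 h2
    linarith
  have hnorm : ∀ t : ℝ, ∀ w ∈ closedBall (0 : ℂ) 1, ‖Complex.exp ((t * I) * h w)‖ = 1 := by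
    intro t w hw
    rw [Complex.norm_exp]
    simp [him w hw]
  have heq : ∀ t : ℝ, Complex.exp ((t * I) * h w) = Complex.exp ((t * I) * h 0) := by
    intro t
    have := Complex.eqOn_closedBall_of_isMaxOn_norm (hd t) (z := 0) (r := 1) ?_ hw
    · exact this
    · intro z hz
      simp only [mem_ofPred_eq, Function.comp]
      rw [hnorm t z (ball_subset_closedBall hz), hnorm t 0 (by simp)]
  -- The derivative in `t` at `0` recovers `h` itself, so no logarithm has to be chosen.
  have hder : ∀ c : ℂ, HasDerivAt (fun t : ℝ => Complex.exp ((t * I) * c)) (I * c) 0 := by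
    intro c
    have : HasDerivAt (fun t : ℝ => (t * I) * c) (I * c) 0 := by
      simpa using ((Complex.ofRealCLM.hasDerivAt (x := 0)).mul_const I).mul_const c
    simpa using this.cexp
  have := (hder (h w)).unique (funext heq ▸ hder (h 0))
  exact mul_left_cancel₀ Complex.I_ne_zero this

/-- Functions which are holomorphic inside respectively outside of the unit circle, with the same
boundary values, are constant. -/
theorem DiffContOnCl.eq_of_eq_conj {P Q : ℂ → ℂ} (hP : DiffContOnCl ℂ P (ball 0 1))
    (hQ : DiffContOnCl ℂ Q (ball 0 1)) (h : ∀ l : Circle, P l = conj (Q l)) {w : ℂ}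
    (hw : w ∈ closedBall (0 : ℂ) 1) : P w = P 0 := by
  -- Both `P + Q` and `i(P - Q)` are real on the circle.
  have h1 := (hP.add hQ).eq_of_im_eq_zero (fun l => by simp [h]) hw
  have h2 := ((hP.sub hQ).const_smul I).eq_of_im_eq_zero (fun l => by simp [h]) hw
  simp only [Pi.add_apply, Pi.sub_apply, Pi.smul_apply, smul_eq_mul] at h1 h2
  have h3 := mul_left_cancel₀ Complex.I_ne_zero h2
  linear_combination (h1 + h3) / 2

theorem DiffContOnCl.conj_comp_conj {g : ℂ → ℂ} (hg : DiffContOnCl ℂ g (ball 0 1)) :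
    DiffContOnCl ℂ (fun w => conj (g (conj w))) (ball 0 1) := by
  have hc : ∀ {w : ℂ}, w ∈ ball (0 : ℂ) 1 → conj w ∈ ball (0 : ℂ) 1 := by simp
  refine ⟨fun w hw => ?_, ?_⟩
  · have := (hg.differentiableAt isOpen_ball (hc hw)).conj_conj
    simp only [Complex.conj_conj] at this
    exact this.differentiableWithinAt
  · have h := hg.continuousOn
    rw [closure_ball 0 one_ne_zero] at h ⊢
    exact Complex.continuous_conj.comp_continuousOn (h.comp Complex.continuous_conj.continuousOn
      fun w hw => by simpa using hw)

theorem DiffContOnCl.comp_neg_unit {g : ℂ → ℂ} (hg : DiffContOnCl ℂ g (ball 0 1)) :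
    DiffContOnCl ℂ (fun w => g (-w)) (ball 0 1) :=
  DiffContOnCl.comp (f := g) (g := fun w => -w) hg differentiable_neg.diffContOnCl fun w hw => by simpa using hw

theorem DiffContOnCl.dslope_zero {g : ℂ → ℂ} (hg : DiffContOnCl ℂ g (ball 0 1)) :
    DiffContOnCl ℂ (dslope g 0) (ball 0 1) := by
  refine ⟨(Complex.differentiableOn_dslope (ball_mem_nhds 0 one_pos)).2 hg.differentiableOn, ?_⟩
  have hcl : closure (ball (0 : ℂ) 1) ∈ nhds 0 :=
    Filter.mem_of_superset (ball_mem_nhds 0 one_pos) subset_closure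
  exact (continuousOn_dslope hcl).2 ⟨hg.continuousOn,
    hg.differentiableAt isOpen_ball (mem_ball_self one_pos)⟩

theorem DiffContOnCl.eqOn_of_circle {P Q : ℂ → ℂ} (hP : DiffContOnCl ℂ P (ball 0 1))
    (hQ : DiffContOnCl ℂ Q (ball 0 1)) (h : ∀ l : Circle, P l = Q l) : P 0 = Q 0 := by
  refine Complex.eqOn_of_eqOn_frontier isBounded_ball hP hQ (fun z hz => ?_) (mem_ball_self one_pos)
  rw [frontier_ball 0 one_ne_zero] at hz
  exact h ⟨z, hz⟩

/-- The Schwarz reflection principle. -/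
theorem differentiable_of_reflection {h : ℂ → ℂ} (hc : Continuous h)
    (hd : ∀ z : ℂ, z.im ≠ 0 → DifferentiableAt ℂ h z) : Differentiable ℂ h := by
  have hcons : Complex.IsConservativeOn h univ := by
    have hi : ∀ (x y₀ y₁ : ℝ), IntervalIntegrable (fun y : ℝ => h (x + y * I)) MeasureTheory.volume
        y₀ y₁ := fun x y₀ y₁ => (Continuous.intervalIntegrable (by fun_prop) _ _)
    -- Morera's theorem: Cauchy's theorem applies to rectangles whose interior misses the real axis,
    -- and a general rectangle is cut along the axis into two of these.
    have key : ∀ x₀ x₁ y₀ y₁ : ℝ, (∀ y ∈ Ioo (min y₀ y₁) (max y₀ y₁), y ≠ 0) →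
        (∫ x in x₀..x₁, h (x + y₀ * I)) - (∫ x in x₀..x₁, h (x + y₁ * I)) +
          I • (∫ y in y₀..y₁, h (x₁ + y * I)) - I • (∫ y in y₀..y₁, h (x₀ + y * I)) = 0 := by
      intro x₀ x₁ y₀ y₁ hy
      exact Complex.integral_boundary_rect_eq_zero_of_continuousOn_of_differentiableOn h
        ⟨x₀, y₀⟩ ⟨x₁, y₁⟩ hc.continuousOn (fun x hx => (hd x (hy _ hx.2)).differentiableWithinAt)
    intro z w _
    rw [← add_eq_zero_iff_eq_neg, Complex.wedgeIntegral_add_wedgeIntegral_eq]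
    have h1 := key z.re w.re z.im 0 fun y hy => by
      rcases le_total z.im 0 with h | h
      · rw [max_eq_right h] at hy; exact hy.2.ne
      · rw [min_eq_right h] at hy; exact hy.1.ne'
    have h2 := key z.re w.re 0 w.im fun y hy => by
      rcases le_total w.im 0 with h | h
      · rw [max_eq_left h] at hy; exact hy.2.ne
      · rw [min_eq_left h] at hy; exact hy.1.ne'
    rw [← intervalIntegral.integral_add_adjacent_intervals (hi w.re z.im 0) (hi w.re 0 w.im),
      ← intervalIntegral.integral_add_adjacent_intervals (hi z.re z.im 0) (hi z.re 0 w.im)]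
    simp only [smul_eq_mul] at h1 h2 ⊢
    linear_combination h1 + h2
  have := Complex.isConservativeOn_and_continuousOn_iff_isDifferentiableOn (f := h) isOpen_univ
  exact differentiableOn_univ.1 (this.1 ⟨hcons, hc.continuousOn⟩)

/-- A function with continuous boundary values on the real line, which agree with those of a function
in the lower half plane, is differentiable along the real line. -/
theorem differentiable_of_eq_conj {P Q : ℂ → ℂ} (hPc : ContinuousOn P {z | 0 ≤ z.im})
    (hQc : ContinuousOn Q {z | 0 ≤ z.im}) (hP : ∀ z : ℂ, 0 < z.im → DifferentiableAt ℂ P z)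
    (hQ : ∀ z : ℂ, 0 < z.im → DifferentiableAt ℂ Q z) (h : ∀ x : ℝ, P x = conj (Q x)) :
    Differentiable ℝ fun x : ℝ => P x := by
  -- `P` above the axis is glued to the reflection of `Q` below it; the boundary condition `h` makes
  -- the result continuous.
  let g : ℂ → ℂ := fun z => if 0 ≤ z.im then P z else conj (Q (conj z))
  have hg : Differentiable ℂ g := by
    refine differentiable_of_reflection ?_ fun z hz => ?_
    · refine continuous_if_le (f := fun z : ℂ => (0 : ℝ)) continuous_const Complex.continuous_im hPc ?_ ?_
      · exact Complex.continuous_conj.comp_continuousOn (hQc.comp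
          Complex.continuous_conj.continuousOn fun z hz => by simpa using hz)
      · intro z hz
        obtain ⟨x, rfl⟩ : ∃ x : ℝ, z = x := ⟨z.re, Complex.ext rfl (by simp [← hz])⟩
        simp [h]
    · rcases lt_or_gt_of_ne hz with hz | hz
      · have := (hQ (conj z) (by simpa using hz)).conj_conj
        rw [Complex.conj_conj] at this
        refine this.congr_of_eventuallyEq ?_
        filter_upwards [(isOpen_lt Complex.continuous_im continuous_const).mem_nhds hz] with w hw
        simp only [g, if_neg (not_le.2 hw), Function.comp]
      · refine (hP z hz).congr_of_eventuallyEq ?_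
        filter_upwards [(isOpen_lt continuous_const Complex.continuous_im).mem_nhds hz] with w hw
        exact if_pos (le_of_lt hw)
  intro x
  have h1 : DifferentiableAt ℝ (fun x : ℝ => g x) x :=
    ((hg x).restrictScalars ℝ).comp x Complex.ofRealCLM.differentiableAt
  refine h1.congr_of_eventuallyEq (Filter.Eventually.of_forall fun y => ?_)
  simp [g]

end Boundary


/-! ## Loop groups -/

section LoopGroups

open Metric
open Complex (I)
open scoped ComplexConjugate

/-- The Pauli matrix `σ₁`. -/
def sigma1 : Matrix (Fin 2) (Fin 2) ℂ := !![0, 1; 1, 0]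

/-- The involution `τ` on matrices of determinant one. -/
noncomputable def tauMat (X : Matrix (Fin 2) (Fin 2) ℂ) : Matrix (Fin 2) (Fin 2) ℂ :=
  !![conj (X 1 1), conj (X 1 0); conj (X 0 1), conj (X 0 0)]

theorem tauMat_mul (X Y : Matrix (Fin 2) (Fin 2) ℂ) : tauMat (X * Y) = tauMat X * tauMat Y := by
  ext i j; fin_cases i <;> fin_cases j <;> simp [tauMat, Matrix.mul_apply] <;> ring

theorem tauMat_one : tauMat 1 = 1 := by
  ext i j; fin_cases i <;> fin_cases j <;> simp [tauMat]

theorem tauMat_tauMat (X : Matrix (Fin 2) (Fin 2) ℂ) : tauMat (tauMat X) = X := by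
  ext i j; fin_cases i <;> fin_cases j <;> simp [tauMat]

theorem tauMat_smul (c : ℂ) (X : Matrix (Fin 2) (Fin 2) ℂ) : tauMat (c • X) = conj c • tauMat X := by
  ext i j; fin_cases i <;> fin_cases j <;> simp [tauMat]

theorem tauMat_diag (k k' : ℂ) : tauMat !![k, 0; 0, k'] = !![conj k', 0; 0, conj k] := by
  simp [tauMat]

theorem det_tauMat {X : Matrix (Fin 2) (Fin 2) ℂ} (h : X.det = 1) : (tauMat X).det = 1 := by
  have := congrArg conj h
  rw [Matrix.det_fin_two] at this ⊢
  simp [tauMat] at this ⊢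
  linear_combination this

theorem inv_eq_of_mul_eq_one {X Y : Matrix (Fin 2) (Fin 2) ℂ} (h : X * Y = 1) : X⁻¹ = Y :=
  Matrix.inv_eq_right_inv h

theorem tauMat_inv {X : Matrix (Fin 2) (Fin 2) ℂ} (h : X.det = 1) : tauMat X⁻¹ = (tauMat X)⁻¹ := by
  refine (inv_eq_of_mul_eq_one ?_).symm
  rw [← tauMat_mul, mul_inv_of_det_one h, tauMat_one]

/-- At determinant one the inverse in `τ` is an adjugate. The resulting entrywise formula makes
sense, and is multiplicative and conjugate linear, on all matrices, so it can also be applied to the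
potential. -/
theorem tauLoop_apply {x : MatLoop} {l : Circle} (h : (x l).det = 1) :
    tauLoop x l = tauMat (x l) := by
  have : (x l)ᴴ.det = 1 := by rw [Matrix.det_conjTranspose, h, star_one]
  rw [tauLoop, inv_eq_of_det_one this]
  ext i j; fin_cases i <;> fin_cases j <;> simp [tauMat, sigma3, Matrix.conjTranspose_apply]

theorem sigma3_mul_sigma3 : sigma3 * sigma3 = 1 := by
  ext i j; fin_cases i <;> fin_cases j <;> simp [sigma3]

theorem inv_det_one {X : Matrix (Fin 2) (Fin 2) ℂ} (h : X.det = 1) : X⁻¹.det = 1 := by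
  rw [Matrix.det_nonsing_inv, h, Ring.inverse_one]

theorem sigma3_conj (X : Matrix (Fin 2) (Fin 2) ℂ) :
    sigma3 * X * sigma3 = !![X 0 0, -X 0 1; -X 1 0, X 1 1] := by
  ext i j; fin_cases i <;> fin_cases j <;> simp [sigma3, Matrix.mul_apply, Matrix.vecMul, dotProduct]

theorem mul_mem_twistedLoops {x y : MatLoop} (hx : x ∈ twistedLoops) (hy : y ∈ twistedLoops) :
    x * y ∈ twistedLoops := by
  refine ⟨hx.1.mul hy.1, fun l => ?_, fun l => ?_⟩
  · rw [Pi.mul_apply, Matrix.det_mul, hx.2.1, hy.2.1, mul_one]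
  · rw [Pi.mul_apply, Pi.mul_apply, ← hx.2.2 l, ← hy.2.2 l]
    simp only [mul_assoc]
    rw [← mul_assoc sigma3 sigma3, sigma3_mul_sigma3, one_mul]

theorem inv_mem_twistedLoops {x : MatLoop} (hx : x ∈ twistedLoops) : x⁻¹ ∈ twistedLoops := by
  have h : x⁻¹ = fun l => (x l).adjugate := funext fun l => inv_eq_adjugate (hx.2.1 l)
  refine ⟨?_, fun l => inv_det_one (hx.2.1 l), fun l => ?_⟩
  · rw [h]; exact hx.1.matrix_adjugate
  · have h1 := hx.2.2 l
    rw [sigma3_conj] at h1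
    rw [h, sigma3_conj]
    show _ = (x l).adjugate
    rw [← h1]
    simp [Matrix.adjugate_fin_two]

theorem one_mem_twistedLoops : (1 : MatLoop) ∈ twistedLoops :=
  ⟨continuous_const, fun _ => by simp, fun _ => by simp [sigma3_mul_sigma3]⟩

theorem neg_mem_twistedLoops {x : MatLoop} (hx : x ∈ twistedLoops) : -x ∈ twistedLoops := by
  refine ⟨hx.1.neg, fun l => ?_, fun l => ?_⟩
  · rw [Pi.neg_apply, Matrix.det_neg, hx.2.1]; simp
  · rw [Pi.neg_apply, Pi.neg_apply, ← hx.2.2 l]; simp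

theorem tauMat_mem_twistedLoops {x : MatLoop} (hx : x ∈ twistedLoops) :
    (fun l => tauMat (x l)) ∈ twistedLoops := by
  have hc : ∀ i j, Continuous fun l => conj (x l i j) := fun i j =>
    Complex.continuous_conj.comp (hx.1.matrix_elem i j)
  refine ⟨?_, fun l => det_tauMat (hx.2.1 l), fun l => ?_⟩
  · refine continuous_matrix fun i j => ?_
    fin_cases i <;> fin_cases j <;> simp [tauMat] <;> exact hc _ _
  · have h1 := hx.2.2 l
    rw [sigma3_conj] at h1
    rw [sigma3_conj]
    show _ = tauMat (x l)
    rw [← h1]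
    simp [tauMat]

theorem diag_mem_twistedLoops {k : ℂ} (hk : k ≠ 0) :
    (fun _ => !![k, 0; 0, k⁻¹] : MatLoop) ∈ twistedLoops :=
  ⟨continuous_const, fun _ => by simp [hk], fun _ => by rw [sigma3_conj]; simp⟩

theorem mem_realLoops_iff {x : MatLoop} : x ∈ realLoops ↔ x ∈ twistedLoops ∧
    ∃ ε : ℂ, (ε = 1 ∨ ε = -1) ∧ ∀ l, tauMat (x l) = ε • x l := by
  refine and_congr_right fun hx => ?_
  have h : tauLoop x = fun l => tauMat (x l) := funext fun l => tauLoop_apply (hx.2.1 l)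
  rw [h]
  constructor
  · rintro (h | h)
    · exact ⟨1, Or.inl rfl, fun l => by rw [one_smul]; exact congrFun h l⟩
    · exact ⟨-1, Or.inr rfl, fun l => by rw [neg_smul, one_smul]; exact congrFun h l⟩
  · rintro ⟨ε, rfl | rfl, h⟩
    · exact Or.inl (funext fun l => by rw [h l, one_smul])
    · exact Or.inr (funext fun l => by rw [h l, neg_smul, one_smul]; rfl)

theorem isSU11_of_tauMat {X : Matrix (Fin 2) (Fin 2) ℂ} {ε : ℂ} (hd : X.det = 1)
    (hε : ε = 1 ∨ ε = -1) (h : tauMat X = ε • X) : IsSU11 X := by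
  have hε2 : ε * ε = 1 := by rcases hε with rfl | rfl <;> simp
  have hεc : conj ε = ε := by rcases hε with rfl | rfl <;> simp
  refine ⟨hd, ε, hε, ?_, ?_⟩
  · have := congrFun (congrFun h 1) 1
    simp [tauMat] at this
    rw [this, ← mul_assoc, hε2, one_mul]
  · have := congrFun (congrFun h 1) 0
    simp [tauMat] at this
    rw [this, ← mul_assoc, hε2, one_mul]

theorem isSU11_of_mem_realLoops {x : MatLoop} (hx : x ∈ realLoops) (l : Circle) : IsSU11 (x l) := by
  obtain ⟨ht, ε, hε, h⟩ := mem_realLoops_iff.1 hx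
  exact isSU11_of_tauMat (ht.2.1 l) hε (h l)

theorem mul_mem_realLoops {x y : MatLoop} (hx : x ∈ realLoops) (hy : y ∈ realLoops) :
    x * y ∈ realLoops := by
  obtain ⟨ht, ε, hε, h⟩ := mem_realLoops_iff.1 hx
  obtain ⟨ht', ε', hε', h'⟩ := mem_realLoops_iff.1 hy
  refine mem_realLoops_iff.2 ⟨mul_mem_twistedLoops ht ht', ε * ε', ?_, fun l => ?_⟩
  · rcases hε with rfl | rfl <;> rcases hε' with rfl | rfl <;> simp
  · rw [Pi.mul_apply, tauMat_mul, h, h', Matrix.smul_mul, Matrix.mul_smul, smul_smul]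

theorem inv_mem_realLoops {x : MatLoop} (hx : x ∈ realLoops) : x⁻¹ ∈ realLoops := by
  obtain ⟨ht, ε, hε, h⟩ := mem_realLoops_iff.1 hx
  refine mem_realLoops_iff.2 ⟨inv_mem_twistedLoops ht, ε, hε, fun l => ?_⟩
  have hε2 : ε * ε = 1 := by rcases hε with rfl | rfl <;> simp
  rw [Pi.inv_apply, tauMat_inv (ht.2.1 l), h]
  refine inv_eq_of_mul_eq_one ?_
  rw [Matrix.smul_mul, Matrix.mul_smul, smul_smul, hε2, one_smul, mul_inv_of_det_one (ht.2.1 l)]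

/-- Matrix valued functions on the closed unit disc which are holomorphic inside. -/
def IsDiscMap (g : ℂ → Matrix (Fin 2) (Fin 2) ℂ) : Prop :=
  ∀ i j, DiffContOnCl ℂ (fun w => g w i j) (ball 0 1)

theorem DiffContOnCl.fun_mul {f g : ℂ → ℂ} {s : Set ℂ} (hf : DiffContOnCl ℂ f s)
    (hg : DiffContOnCl ℂ g s) : DiffContOnCl ℂ (fun w => f w * g w) s := hf.smul hg

theorem DiffContOnCl.fun_add {f g : ℂ → ℂ} {s : Set ℂ} (hf : DiffContOnCl ℂ f s)
    (hg : DiffContOnCl ℂ g s) : DiffContOnCl ℂ (fun w => f w + g w) s := hf.add hg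

theorem DiffContOnCl.fun_sub {f g : ℂ → ℂ} {s : Set ℂ} (hf : DiffContOnCl ℂ f s)
    (hg : DiffContOnCl ℂ g s) : DiffContOnCl ℂ (fun w => f w - g w) s := hf.sub hg

theorem DiffContOnCl.fun_neg {f : ℂ → ℂ} {s : Set ℂ} (hf : DiffContOnCl ℂ f s) :
    DiffContOnCl ℂ (fun w => -f w) s := hf.neg

theorem IsDiscMap.mul {g h : ℂ → Matrix (Fin 2) (Fin 2) ℂ} (hg : IsDiscMap g) (hh : IsDiscMap h) :
    IsDiscMap fun w => g w * h w := by
  intro i j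
  simp only [Matrix.mul_apply, Fin.sum_univ_two]
  exact ((hg i 0).fun_mul (hh 0 j)).fun_add ((hg i 1).fun_mul (hh 1 j))

theorem IsDiscMap.neg {g : ℂ → Matrix (Fin 2) (Fin 2) ℂ} (hg : IsDiscMap g) :
    IsDiscMap fun w => -g w := fun i j => (hg i j).fun_neg

theorem IsDiscMap.adjugate {g : ℂ → Matrix (Fin 2) (Fin 2) ℂ} (hg : IsDiscMap g) :
    IsDiscMap fun w => (g w).adjugate := by
  intro i j
  fin_cases i <;> fin_cases j <;> simp [Matrix.adjugate_fin_two]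
  exacts [hg 1 1, (hg 0 1).fun_neg, (hg 1 0).fun_neg, hg 0 0]

theorem IsDiscMap.tauMat {g : ℂ → Matrix (Fin 2) (Fin 2) ℂ} (hg : IsDiscMap g) :
    IsDiscMap fun w => tauMat (g (conj w)) := by
  intro i j
  fin_cases i <;> fin_cases j <;> simp [_root_.tauMat]
  exacts [(hg 1 1).conj_comp_conj, (hg 1 0).conj_comp_conj, (hg 0 1).conj_comp_conj,
    (hg 0 0).conj_comp_conj]

theorem isDiscMap_const (M : Matrix (Fin 2) (Fin 2) ℂ) : IsDiscMap fun _ => M :=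
  fun _ _ => diffContOnCl_const

theorem circle_inv_eq_conj (l : Circle) : (l : ℂ)⁻¹ = conj (l : ℂ) := by
  rw [← Circle.coe_inv, Circle.coe_inv_eq_conj]

theorem mul_mem_plusLoops {x y : MatLoop} (hx : x ∈ plusLoops) (hy : y ∈ plusLoops) :
    x * y ∈ plusLoops := by
  obtain ⟨hx, g, hg, h⟩ := hx
  obtain ⟨hy, g', hg', h'⟩ := hy
  exact ⟨mul_mem_twistedLoops hx hy, _, IsDiscMap.mul hg hg', fun l => by rw [Pi.mul_apply, h, h']⟩

theorem mul_mem_minusLoops {x y : MatLoop} (hx : x ∈ minusLoops) (hy : y ∈ minusLoops) :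
    x * y ∈ minusLoops := by
  obtain ⟨hx, g, hg, h⟩ := hx
  obtain ⟨hy, g', hg', h'⟩ := hy
  exact ⟨mul_mem_twistedLoops hx hy, _, IsDiscMap.mul hg hg', fun l => by rw [Pi.mul_apply, h, h']⟩

theorem inv_mem_plusLoops {x : MatLoop} (hx : x ∈ plusLoops) : x⁻¹ ∈ plusLoops := by
  obtain ⟨hx, g, hg, h⟩ := hx
  exact ⟨inv_mem_twistedLoops hx, _, IsDiscMap.adjugate hg, fun l => by
    rw [Pi.inv_apply, inv_eq_adjugate (hx.2.1 l), h]⟩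

theorem inv_mem_minusLoops {x : MatLoop} (hx : x ∈ minusLoops) : x⁻¹ ∈ minusLoops := by
  obtain ⟨hx, g, hg, h⟩ := hx
  exact ⟨inv_mem_twistedLoops hx, _, IsDiscMap.adjugate hg, fun l => by
    rw [Pi.inv_apply, inv_eq_adjugate (hx.2.1 l), h]⟩

theorem neg_mem_minusLoops {x : MatLoop} (hx : x ∈ minusLoops) : -x ∈ minusLoops := by
  obtain ⟨hx, g, hg, h⟩ := hx
  exact ⟨neg_mem_twistedLoops hx, _, IsDiscMap.neg hg, fun l => by rw [Pi.neg_apply, h]⟩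

theorem diag_mem_plusLoops {k : ℂ} (hk : k ≠ 0) :
    (fun _ => !![k, 0; 0, k⁻¹] : MatLoop) ∈ plusLoops :=
  ⟨diag_mem_twistedLoops hk, _, isDiscMap_const _, fun _ => rfl⟩

/-- Conjugation replaces an extension `g(w)` by one built from `conj (g (conj w))`, and `conj λ =
λ⁻¹` on the circle; this exchanges the two sides. -/
theorem tauMat_mem_minusLoops {x : MatLoop} (hx : x ∈ plusLoops) :
    (fun l => tauMat (x l)) ∈ minusLoops := by
  obtain ⟨hx, g, hg, h⟩ := hx
  refine ⟨tauMat_mem_twistedLoops hx, _, IsDiscMap.tauMat hg, fun l => ?_⟩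
  show tauMat (x l) = _
  rw [circle_inv_eq_conj, Complex.conj_conj, h]

theorem tauMat_mem_plusLoops {x : MatLoop} (hx : x ∈ minusLoops) :
    (fun l => tauMat (x l)) ∈ plusLoops := by
  obtain ⟨hx, g, hg, h⟩ := hx
  refine ⟨tauMat_mem_twistedLoops hx, _, IsDiscMap.tauMat hg, fun l => ?_⟩
  show tauMat (x l) = _
  rw [h, circle_inv_eq_conj]

/-- Loops which extend to both sides of the unit circle are constant. -/
theorem eq_diag_of_mem_plusLoops_of_mem_minusLoops {x : MatLoop} (hx : x ∈ plusLoops)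
    (hx' : x ∈ minusLoops) : ∃ k : ℂ, k ≠ 0 ∧ ∀ l, x l = !![k, 0; 0, k⁻¹] := by
  obtain ⟨ht, g, hg, h⟩ := hx
  obtain ⟨-, g', hg', h'⟩ := hx'
  have hconst : ∀ (l : Circle) i j, x l i j = g 0 i j := by
    intro l i j
    rw [h]
    refine DiffContOnCl.eq_of_eq_conj (hg i j) ((hg' i j).conj_comp_conj) (fun l => ?_)
      (by simp [l.norm_coe])
    rw [← h, h', Complex.conj_conj, circle_inv_eq_conj]
  -- For a constant loop the twisting condition says that the off-diagonal entries are their own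
  -- negatives.
  have htw := ht.2.2 1
  rw [sigma3_conj] at htw
  have h01 := congrFun (congrFun htw 0) 1
  have h10 := congrFun (congrFun htw 1) 0
  have hd := ht.2.1 1
  rw [Matrix.det_fin_two] at hd
  simp [hconst] at h01 h10 hd
  have h01' : g 0 0 1 = 0 := by linear_combination -h01 / 2
  have h10' : g 0 1 0 = 0 := by linear_combination -h10 / 2
  rw [h01', zero_mul, sub_zero] at hd
  have hk : g 0 0 0 ≠ 0 := left_ne_zero_of_mul_eq_one hd
  refine ⟨g 0 0 0, hk, fun l => ?_⟩
  ext i j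
  rw [hconst]
  fin_cases i <;> fin_cases j <;> simp [h01', h10']
  exact (inv_eq_of_mul_eq_one_right hd).symm

/-- Uniqueness of the Iwasawa splitting. -/
theorem eq_mul_diag_of_splittings {F F' B B' : MatLoop} (hF : F ∈ realLoops) (hF' : F' ∈ realLoops)
    (hB : B ∈ plusLoops) (hB' : B' ∈ plusLoops) (h : F * B = F' * B') :
    ∃ k : ℂ, conj k * k = 1 ∧ ∀ l, F l = F' l * !![k, 0; 0, k⁻¹] := by
  -- This quotient is positive as a product of the `B` factors. It is real as a product of the `F`
  -- factors, so up to sign it equals its image under `τ`, which is negative.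
  have hK : F'⁻¹ * F = B' * B⁻¹ := by
    funext l
    have hl : F l * B l = F' l * B' l := congrFun h l
    simp only [Pi.mul_apply, Pi.inv_apply]
    rw [← mul_one (F l), ← mul_inv_of_det_one (hB.1.2.1 l), ← mul_assoc (F l), hl, mul_assoc,
      ← mul_assoc, inv_mul_of_det_one (hF'.1.2.1 l), one_mul]
  have hp : F'⁻¹ * F ∈ plusLoops := by
    rw [hK]; exact mul_mem_plusLoops hB' (inv_mem_plusLoops hB)
  obtain ⟨ht, ε, hε, hr⟩ := mem_realLoops_iff.1 (mul_mem_realLoops (inv_mem_realLoops hF') hF)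
  have hm : F'⁻¹ * F ∈ minusLoops := by
    have := tauMat_mem_minusLoops hp
    rcases hε with rfl | rfl
    · rwa [show (fun l => tauMat ((F'⁻¹ * F) l)) = F'⁻¹ * F from funext fun l => by
        rw [hr, one_smul]] at this
    · have := neg_mem_minusLoops this
      rwa [show -(fun l => tauMat ((F'⁻¹ * F) l)) = F'⁻¹ * F from funext fun l => by
        rw [Pi.neg_apply, hr, neg_smul, one_smul, neg_neg]] at this
  obtain ⟨k, hk, hkl⟩ := eq_diag_of_mem_plusLoops_of_mem_minusLoops hp hm
  refine ⟨k, ?_, fun l => ?_⟩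
  · have := hr 1
    rw [hkl, tauMat_diag] at this
    have h1 := congrFun (congrFun this 0) 0
    have h1' : conj k⁻¹ = ε * k := by simpa using h1
    have h2 : ε * (conj k * k) = 1 := by
      rw [map_inv₀] at h1'
      have hk' : conj k ≠ 0 := by simpa using hk
      field_simp at h1'
      linear_combination -h1'
    rcases hε with rfl | rfl
    · rwa [one_mul] at h2
    -- The sign `-1` would force `|k|² = -1`.
    · exfalso
      rw [← Complex.normSq_eq_conj_mul_self] at h2
      have h3 := congrArg Complex.re h2
      simp at h3
      linarith [Complex.normSq_nonneg k]
  · rw [← hkl l, Pi.mul_apply, Pi.inv_apply, ← mul_assoc, mul_inv_of_det_one (hF'.1.2.1 l), one_mul]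

/-- The factor `F` drops out of `τ(FB)⁻¹ FB` up to its sign, leaving `± τ(B)⁻¹ B`, which is already
a Birkhoff factorization. -/
theorem mem_iwasawaBigCell_of_splitting {F B : MatLoop} (hF : F ∈ realLoops) (hB : B ∈ plusLoops) :
    F * B ∈ iwasawaBigCell := by
  obtain ⟨ht, ε, hε, hr⟩ := mem_realLoops_iff.1 hF
  have hε2 : ε * ε = 1 := by rcases hε with rfl | rfl <;> simp
  have hFB := mul_mem_twistedLoops ht hB.1
  refine ⟨hFB, (fun l => ε • (tauMat (B l))⁻¹ : MatLoop), ?_, B, hB, ?_⟩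
  · have := inv_mem_minusLoops (tauMat_mem_minusLoops hB)
    rcases hε with rfl | rfl
    · simpa using! this
    · simpa using! neg_mem_minusLoops this
  · funext l
    simp only [Pi.mul_apply, Pi.inv_apply]
    rw [tauLoop_apply (hFB.2.1 l), Pi.mul_apply, tauMat_mul, hr, Matrix.mul_inv_rev,
      inv_eq_of_mul_eq_one (X := ε • F l) (Y := ε • (F l)⁻¹) (by
        rw [Matrix.smul_mul, Matrix.mul_smul, smul_smul, hε2, one_smul,
          mul_inv_of_det_one (ht.2.1 l)])]
    rw [Matrix.mul_smul, Matrix.smul_mul, Matrix.smul_mul, ← mul_assoc, mul_assoc _ (F l)⁻¹,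
      inv_mul_of_det_one (ht.2.1 l), mul_one]

/-- Write `τ(x)⁻¹x = XY`. Applying `τ` inverts this loop, so `Yτ(X) = X⁻¹τ(Y)⁻¹` is both positive
and negative, hence a constant diagonal matrix, and it turns out to be real. A suitable square root
`S` of it makes `x (SY)⁻¹` real. -/
theorem exists_splitting_of_mem_iwasawaBigCell {x : MatLoop} (hx : x ∈ iwasawaBigCell) :
    ∃ F ∈ realLoops, ∃ B ∈ plusLoops, x = F * B := by
  obtain ⟨ht, X, hX, Y, hY, hXY⟩ := hx
  have hw : ∀ l, (tauMat (x l))⁻¹ * x l = X l * Y l := fun l => by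
    rw [← tauLoop_apply (ht.2.1 l)]; exact (congrFun hXY l).symm
  have hdx := ht.2.1
  have hdX := hX.1.2.1
  have hdY := hY.1.2.1
  have hx' : ∀ l, x l = tauMat (x l) * (X l * Y l) := fun l => by
    rw [← hw, ← mul_assoc, mul_inv_of_det_one (det_tauMat (hdx l)), one_mul]
  have hτ : ∀ l, tauMat (X l) * tauMat (Y l) * (X l * Y l) = 1 := by
    intro l
    have h1 := hx' l
    have h2 : tauMat (x l) = x l * (tauMat (X l) * tauMat (Y l)) := by
      conv_lhs => rw [h1]
      rw [tauMat_mul, tauMat_mul, tauMat_tauMat]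
    rw [h2, mul_assoc] at h1
    have h3 := congrArg (fun M => (x l)⁻¹ * M) h1
    simp only [← mul_assoc (x l)⁻¹, inv_mul_of_det_one (hdx l), one_mul] at h3
    exact h3.symm
  have hD : Y * (fun l => tauMat (X l)) = X⁻¹ * (fun l => tauMat (Y l))⁻¹ := by
    funext l
    simp only [Pi.mul_apply, Pi.inv_apply]
    rw [← Matrix.mul_inv_rev]
    refine (inv_eq_of_mul_eq_one ?_).symm
    refine mul_eq_one_comm.1 ?_
    have h3 := mul_eq_one_comm.1 (hτ l)
    have h4 : (X l)⁻¹ * (X l * (Y l * tauMat (X l) * tauMat (Y l))) * X l = 1 := by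
      rw [mul_assoc, show X l * (Y l * tauMat (X l) * tauMat (Y l)) =
        X l * Y l * (tauMat (X l) * tauMat (Y l)) by simp only [mul_assoc], h3, one_mul,
        inv_mul_of_det_one (hdX l)]
    rw [← mul_assoc, inv_mul_of_det_one (hdX l), one_mul] at h4
    rw [← h4]; simp only [mul_assoc]
  have hp := mul_mem_plusLoops hY (tauMat_mem_plusLoops hX)
  have hm : Y * (fun l => tauMat (X l)) ∈ minusLoops := by
    rw [hD]
    exact mul_mem_minusLoops (inv_mem_minusLoops hX) (inv_mem_minusLoops (tauMat_mem_minusLoops hY))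
  obtain ⟨k, hk, hkl⟩ := eq_diag_of_mem_plusLoops_of_mem_minusLoops hp hm
  have hkl' : ∀ l, Y l * tauMat (X l) = !![k, 0; 0, k⁻¹] := hkl
  have hkr : conj k = k := by
    have h1 : tauMat (Y 1) * X 1 = !![conj k⁻¹, 0; 0, conj k] := by
      rw [← tauMat_diag, ← hkl' 1, tauMat_mul, tauMat_tauMat]
    have h2 : tauMat (X 1) * (tauMat (Y 1) * X 1) * Y 1 = 1 := by
      rw [← hτ 1]; simp only [mul_assoc]
    rw [h1] at h2
    have h3 : (Y 1 * tauMat (X 1)) * !![conj k⁻¹, 0; 0, conj k] = 1 := by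
      have := mul_eq_one_comm.1 h2
      rw [← this]; simp only [mul_assoc]
    rw [hkl' 1] at h3
    have h4 := congrFun (congrFun h3 1) 1
    simp at h4
    rw [inv_mul_eq_iff_eq_mul₀ hk, mul_one] at h4
    exact h4
  obtain ⟨κ, rfl⟩ := Complex.conj_eq_iff_real.1 hkr
  have hκ : κ ≠ 0 := by exact_mod_cast hk
  -- A real number has a real square root only up to sign. The sign `ε` of `κ` is the sign in `τ(F)
  -- = ±F`, which is why both cosets belong to the real loops.
  obtain ⟨s, hs, ε, hε, hsε⟩ : ∃ s : ℝ, 0 < s ∧ ∃ ε : ℝ, (ε = 1 ∨ ε = -1) ∧ ε * (s * s) = κ⁻¹ := by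
    refine ⟨√|κ⁻¹|, Real.sqrt_pos.2 (by positivity), ?_⟩
    rw [Real.mul_self_sqrt (abs_nonneg _)]
    rcases abs_choice κ⁻¹ with h | h
    · exact ⟨1, Or.inl rfl, by rw [h, one_mul]⟩
    · exact ⟨-1, Or.inr rfl, by rw [h]; ring⟩
  have hsc : (s : ℂ) ≠ 0 := by exact_mod_cast hs.ne'
  have hB := mul_mem_plusLoops (diag_mem_plusLoops hsc) hY
  refine ⟨x * ((fun _ => !![(s : ℂ), 0; 0, (s : ℂ)⁻¹] : MatLoop) * Y)⁻¹, ?_, _, hB, ?_⟩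
  · have hF := mul_mem_twistedLoops ht (inv_mem_twistedLoops hB.1)
    refine mem_realLoops_iff.2 ⟨hF, ε, ?_, fun l => ?_⟩
    · rcases hε with rfl | rfl <;> simp
    have hY' := hdY l
    have hX' := hdX l
    obtain ⟨S, hS⟩ : ∃ S : Matrix (Fin 2) (Fin 2) ℂ, S = !![(s : ℂ), 0; 0, (s : ℂ)⁻¹] := ⟨_, rfl⟩
    have hdS : S.det = 1 := by rw [hS]; simp [hsc]
    have hdSY : (S * Y l).det = 1 := by rw [Matrix.det_mul, hdS, hY', mul_one]
    have h1 : tauMat (Y l) * X l = !![(κ : ℂ)⁻¹, 0; 0, κ] := by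
      have := congrArg tauMat (hkl' l)
      rw [tauMat_mul, tauMat_tauMat, tauMat_diag] at this
      simpa using this
    have h2 : S = (ε : ℂ) • (tauMat (S * Y l) * X l) := by
      have hsε' : (ε : ℂ) * (s * s) = (κ : ℂ)⁻¹ := by exact_mod_cast hsε
      have hκ' : (κ : ℂ) = ((ε : ℂ) * (s * s))⁻¹ := by rw [hsε', inv_inv]
      have hε2 : (ε : ℂ) * ε = 1 := by rcases hε with rfl | rfl <;> simp
      have hε0 : (ε : ℂ) ≠ 0 := left_ne_zero_of_mul_eq_one hε2
      rw [tauMat_mul, mul_assoc, h1, hS, tauMat_diag, hκ']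
      ext i j; fin_cases i <;> fin_cases j <;> simp <;> field_simp
      linear_combination -hε2
    have h3 : tauMat (x l * (S * Y l)⁻¹) = (ε : ℂ) • (x l * (S * Y l)⁻¹) := by
      have h4 : (tauMat (S * Y l))⁻¹ * S = (ε : ℂ) • X l := by
        refine (congrArg (fun M => (tauMat (S * Y l))⁻¹ * M) h2).trans ?_
        rw [Matrix.mul_smul, ← mul_assoc, inv_mul_of_det_one (det_tauMat hdSY), one_mul]
      have h5 : tauMat (x l * (S * Y l)⁻¹) * (S * Y l) = (ε : ℂ) • x l := by
        rw [tauMat_mul, tauMat_inv hdSY, mul_assoc, ← mul_assoc _ S, h4, Matrix.smul_mul,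
          Matrix.mul_smul, ← hx']
      rw [← Matrix.smul_mul, ← h5, mul_assoc, mul_inv_of_det_one hdSY, mul_one]
    rw [hS] at h3
    exact h3
  · funext l
    rw [Pi.mul_apply, Pi.mul_apply, Pi.inv_apply, mul_assoc, inv_mul_of_det_one (hB.1.2.1 l),
      mul_one]

end LoopGroups


/-! ## The solution of the potential and its splittings -/

section Potential

open Metric
open Complex (I)
open scoped ComplexConjugate

theorem isUnit_of_mul_eq_one {X Y : Matrix (Fin 2) (Fin 2) ℂ} (h : X * Y = 1) : IsUnit X :=
  IsUnit.of_mul_eq_one Y h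

theorem sigma1_mul_sigma1 : sigma1 * sigma1 = 1 := by
  ext i j; fin_cases i <;> fin_cases j <;> simp [sigma1]

/-- `tauMat` is entrywise complex conjugation followed by conjugation with `σ₁`, and both operations
commute with the exponential. -/
theorem tauMat_eq (X : Matrix (Fin 2) (Fin 2) ℂ) : tauMat X = sigma1 * Xᴴᵀ * sigma1⁻¹ := by
  rw [inv_eq_of_mul_eq_one sigma1_mul_sigma1]
  ext i j
  fin_cases i <;> fin_cases j <;>
    simp [tauMat, sigma1, Matrix.mul_apply, Matrix.vecMul, dotProduct, Matrix.conjTranspose_apply]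

theorem tauMat_exp (X : Matrix (Fin 2) (Fin 2) ℂ) :
    tauMat (NormedSpace.exp X) = NormedSpace.exp (tauMat X) := by
  rw [tauMat_eq, tauMat_eq, Matrix.exp_conj _ _ (isUnit_of_mul_eq_one sigma1_mul_sigma1),
    Matrix.exp_transpose, Matrix.exp_conjTranspose]

theorem sigma3_conj_exp (X : Matrix (Fin 2) (Fin 2) ℂ) :
    sigma3 * NormedSpace.exp X * sigma3 = NormedSpace.exp (sigma3 * X * sigma3) := by
  have := Matrix.exp_conj sigma3 X (isUnit_of_mul_eq_one sigma3_mul_sigma3)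
  rw [inv_eq_of_mul_eq_one sigma3_mul_sigma3] at this
  exact this.symm

/-- For `2 × 2` matrices the adjugate is the transpose conjugated by `J`, so `adj (exp X) = exp (adj
X) = exp (-X)` is the inverse of `exp X`. Comparing with `M · adj M = det M · 1` gives the
determinant. -/
theorem det_exp_eq_one {X : Matrix (Fin 2) (Fin 2) ℂ} (h : X 1 1 = -X 0 0) :
    (NormedSpace.exp X).det = 1 := by
  obtain ⟨J, hJ⟩ : ∃ J : Matrix (Fin 2) (Fin 2) ℂ, J = !![0, 1; -1, 0] := ⟨_, rfl⟩
  have hJJ : J * -J = 1 := by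
    rw [hJ]; ext i j; fin_cases i <;> fin_cases j <;> simp [Matrix.mul_apply]
  have hadj : ∀ Y : Matrix (Fin 2) (Fin 2) ℂ, Y.adjugate = J * Yᵀ * J⁻¹ := by
    intro Y
    rw [inv_eq_of_mul_eq_one hJJ, hJ, Matrix.adjugate_fin_two]
    ext i j; fin_cases i <;> fin_cases j <;> simp [Matrix.mul_apply, Matrix.vecMul, dotProduct]
  have h1 : (NormedSpace.exp X).adjugate = (NormedSpace.exp X)⁻¹ := by
    rw [hadj, ← Matrix.exp_transpose, ← Matrix.exp_conj _ _ (isUnit_of_mul_eq_one hJJ), ← hadj,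
      adjugate_eq_neg h, Matrix.exp_neg]
  have h2 := Matrix.mul_adjugate (NormedSpace.exp X)
  rw [h1, Matrix.mul_nonsing_inv _ ((Matrix.isUnit_iff_isUnit_det _).1 (Matrix.isUnit_exp X))] at h2
  have := congrFun (congrFun h2 0) 0
  simpa using this.symm

theorem dpwA_neg (a b c : ℝ) (l : Circle) : sigma3 * dpwA a b c (-l) * sigma3 = dpwA a b c l := by
  rw [sigma3_conj]
  ext i j; fin_cases i <;> fin_cases j <;> simp [dpwA, inv_neg] <;> ring

theorem tauMat_dpwA (a b c : ℝ) (l : Circle) : tauMat (dpwA a b c l) = -dpwA a b c l := by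
  have h := circle_inv_eq_conj l
  have h' : conj ((l : ℂ)⁻¹) = l := by rw [h, Complex.conj_conj]
  ext i j; fin_cases i <;> fin_cases j <;> simp [tauMat, dpwA, ← h] <;> ring

theorem dpwA_one_one (a b c : ℝ) (l : Circle) : dpwA a b c l 1 1 = -dpwA a b c l 0 0 := by
  simp [dpwA]

/-- The matrix `dpwA` as a function on the punctured plane. -/
noncomputable def dpwAExt (a b c : ℝ) (w : ℂ) : Matrix (Fin 2) (Fin 2) ℂ :=
  !![(c : ℂ), (a : ℂ) * w⁻¹ + (b : ℂ) * w; -((a : ℂ) * w) - (b : ℂ) * w⁻¹, -(c : ℂ)]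

theorem dpwA_eq_ext (a b c : ℝ) (l : Circle) : dpwA a b c l = dpwAExt a b c l := rfl

section Norm

open scoped Matrix.Norms.Operator

theorem differentiableAt_matrix {f : ℂ → Matrix (Fin 2) (Fin 2) ℂ} {w : ℂ}
    (h : ∀ i j, DifferentiableAt ℂ (fun w => f w i j) w) : DifferentiableAt ℂ f w := by
  have key : ∀ N : Matrix (Fin 2) (Fin 2) ℂ, N = ∑ i, ∑ j, N i j • Matrix.single i j (1 : ℂ) := by
    intro N
    conv_lhs => rw [Matrix.matrix_eq_sum_single N]
    simp [Matrix.smul_single]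
  rw [funext fun w => key (f w)]
  exact DifferentiableAt.fun_sum fun i _ => DifferentiableAt.fun_sum fun j _ =>
    (h i j).smul_const _

theorem DifferentiableAt.matrix_elem {f : ℂ → Matrix (Fin 2) (Fin 2) ℂ} {w : ℂ}
    (h : DifferentiableAt ℂ f w) (i j : Fin 2) : DifferentiableAt ℂ (fun w => f w i j) w := by
  let T : Matrix (Fin 2) (Fin 2) ℂ →L[ℂ] ℂ := LinearMap.toContinuousLinearMap
    { toFun := fun M => M i j, map_add' := fun _ _ => rfl, map_smul' := fun _ _ => rfl }
  exact T.differentiableAt.comp w h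

theorem differentiableAt_dpwAExt (a b c : ℝ) {w : ℂ} (hw : w ≠ 0) :
    DifferentiableAt ℂ (dpwAExt a b c) w := by
  refine differentiableAt_matrix fun i j => ?_
  fin_cases i <;> fin_cases j <;> simp [dpwAExt] <;> fun_prop (disch := assumption)

theorem differentiableAt_exp_dpwAExt (a b c : ℝ) (z : ℂ) {w : ℂ} (hw : w ≠ 0) (i j : Fin 2) :
    DifferentiableAt ℂ (fun w => NormedSpace.exp (z • dpwAExt a b c w) i j) w := by
  refine DifferentiableAt.matrix_elem (f := fun w => NormedSpace.exp (z • dpwAExt a b c w)) ?_ i j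
  have h1 : DifferentiableAt ℂ (NormedSpace.exp : Matrix (Fin 2) (Fin 2) ℂ → _)
      (z • dpwAExt a b c w) := (NormedSpace.exp_analytic (𝕂 := ℂ) _).differentiableAt
  exact DifferentiableAt.comp (g := (NormedSpace.exp : Matrix (Fin 2) (Fin 2) ℂ → _))
    (f := fun w => z • dpwAExt a b c w) w h1 ((differentiableAt_dpwAExt a b c hw).const_smul z)

end Norm

theorem continuous_dpwSolution (a b c : ℝ) (z : ℂ) : Continuous (dpwSolution a b c z) := by
  refine continuous_matrix fun i j => continuous_iff_continuousAt.2 fun l => ?_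
  exact ContinuousAt.comp (g := fun w => NormedSpace.exp (z • dpwAExt a b c w) i j)
    (f := fun l : Circle => (l : ℂ))
    (differentiableAt_exp_dpwAExt a b c z l.coe_ne_zero i j).continuousAt
    continuous_subtype_val.continuousAt

theorem dpwSolution_mem_twistedLoops (a b c : ℝ) (z : ℂ) : dpwSolution a b c z ∈ twistedLoops := by
  refine ⟨continuous_dpwSolution a b c z, fun l => det_exp_eq_one ?_, fun l => ?_⟩
  · simp [dpwA]
  · rw [dpwSolution, dpwSolution, sigma3_conj_exp, Matrix.mul_smul, Matrix.smul_mul, dpwA_neg]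

/-- Since `τ(A) = -A` and `τ` is conjugate linear, `tiA` is fixed by `τ`. This is the source of the
equivariance: left multiplication by `φ(ti)` changes only the real factor of a splitting. -/
theorem dpwSolution_mem_realLoops (a b c : ℝ) (t : ℝ) :
    dpwSolution a b c (t * I) ∈ realLoops := by
  refine mem_realLoops_iff.2 ⟨dpwSolution_mem_twistedLoops a b c _, 1, Or.inl rfl, fun l => ?_⟩
  rw [dpwSolution, tauMat_exp, tauMat_smul, tauMat_dpwA, one_smul]
  simp

theorem dpwSolution_add (a b c : ℝ) (z w : ℂ) :
    dpwSolution a b c (z + w) = dpwSolution a b c z * dpwSolution a b c w := by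
  funext l
  rw [Pi.mul_apply, dpwSolution, dpwSolution, dpwSolution, add_smul]
  exact Matrix.exp_add_of_commute _ _ (((Commute.refl _).smul_left z).smul_right w)

theorem dpwSolution_zero (a b c : ℝ) : dpwSolution a b c 0 = 1 := by
  funext l
  rw [dpwSolution, zero_smul, NormedSpace.exp_zero, Pi.one_apply]

theorem commute_dpwA_dpwSolution (a b c : ℝ) (z : ℂ) (l : Circle) :
    dpwA a b c l * dpwSolution a b c z l = dpwSolution a b c z l * dpwA a b c l :=
  ((((Commute.refl (dpwA a b c l)).smul_right z)).exp_right).eq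

theorem mem_dpwDomain_of_splitting {a b c : ℝ} {z : ℂ} {F B : MatLoop} (hF : F ∈ realLoops)
    (hB : B ∈ plusLoops) (h : dpwSolution a b c z = F * B) : z ∈ dpwDomain a b c := by
  show dpwSolution a b c z ∈ iwasawaBigCell
  rw [h]; exact mem_iwasawaBigCell_of_splitting hF hB

theorem one_mem_realLoops : (1 : MatLoop) ∈ realLoops :=
  mem_realLoops_iff.2 ⟨one_mem_twistedLoops, 1, Or.inl rfl, fun l => by
    rw [Pi.one_apply, tauMat_one, one_smul]⟩

theorem one_mem_plusLoops : (1 : MatLoop) ∈ plusLoops :=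
  ⟨one_mem_twistedLoops, _, isDiscMap_const 1, fun _ => rfl⟩

theorem zero_mem_dpwDomain (a b c : ℝ) : (0 : ℂ) ∈ dpwDomain a b c :=
  mem_dpwDomain_of_splitting one_mem_realLoops one_mem_plusLoops
    (by rw [dpwSolution_zero, one_mul])

theorem exists_isIwasawaFrame (a b c : ℝ) : ∃ F, IsIwasawaFrame a b c F := by
  have h : ∀ z, ∃ F : MatLoop, z ∈ dpwDomain a b c →
      F ∈ realLoops ∧ ∃ B ∈ plusLoops, dpwSolution a b c z = F * B := fun z => by
    by_cases hz : z ∈ dpwDomain a b c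
    · obtain ⟨F, hF, hB⟩ := exists_splitting_of_mem_iwasawaBigCell hz
      exact ⟨F, fun _ => ⟨hF, hB⟩⟩
    · exact ⟨1, fun h => absurd h hz⟩
  choose F hF using h
  exact ⟨F, fun z hz => hF z hz⟩

/-- Conjugation of the potential by the positive factor of a splitting. -/
theorem exists_conj_dpwA {a b c β : ℝ} {z : ℂ} {F B : MatLoop} (hF : F ∈ realLoops)
    (hφ : dpwSolution a b c z = F * B) (hB : B ∈ twistedLoops) {g : ℂ → Matrix (Fin 2) (Fin 2) ℂ}
    (hg : IsDiscMap g) (hgB : ∀ l : Circle, B l = g l) (hg0 : g 0 = !![(β : ℂ), 0; 0, (β : ℂ)⁻¹]) :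
    ∃ r : ℝ, ∀ l, B l * dpwA a b c l = dpwA (a * β ^ 2) (b * (β ^ 2)⁻¹) r l * B l := by
  obtain ⟨hFt, ε, hε, hFr⟩ := mem_realLoops_iff.1 hF
  have hε2 : ε * ε = 1 := by rcases hε with rfl | rfl <;> simp
  -- As `A` commutes with `φ = FB`, this is also `F⁻¹AF`. The positive factor controls the pole of
  -- `L` at `0`, the real factor gives `τ(L) = -L`.
  let L : MatLoop := fun l => B l * dpwA a b c l * (B l)⁻¹
  have hL : ∀ l, L l = (F l)⁻¹ * dpwA a b c l * F l := by
    intro l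
    have h1 := commute_dpwA_dpwSolution a b c z l
    rw [hφ, Pi.mul_apply] at h1
    have h2 : (F l)⁻¹ * (dpwA a b c l * (F l * B l)) * (B l)⁻¹ = B l * dpwA a b c l * (B l)⁻¹ := by
      rw [h1, ← mul_assoc, ← mul_assoc, inv_mul_of_det_one (hFt.2.1 l), one_mul]
    simp only [L]
    rw [← h2]
    simp only [mul_assoc]
    rw [mul_inv_of_det_one (hB.2.1 l), mul_one]
  have hτ : ∀ l, tauMat (L l) = -L l := by
    intro l
    rw [hL, tauMat_mul, tauMat_mul, tauMat_inv (hFt.2.1 l), hFr, tauMat_dpwA,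
      inv_eq_of_mul_eq_one (X := ε • F l) (Y := ε • (F l)⁻¹) (by
        rw [Matrix.smul_mul, Matrix.mul_smul, smul_smul, hε2, one_smul,
          mul_inv_of_det_one (hFt.2.1 l)])]
    rw [Matrix.smul_mul, Matrix.smul_mul, Matrix.mul_smul, smul_smul, hε2, one_smul]
    simp
  have htw : ∀ l, sigma3 * L (-l) * sigma3 = L l := by
    intro l
    have h1 := (inv_mem_twistedLoops hB).2.2 l
    simp only [Pi.inv_apply] at h1
    simp only [L]
    rw [← hB.2.2 l, ← dpwA_neg a b c l]
    conv_rhs => rw [hB.2.2 l, ← h1, ← hB.2.2 l]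
    simp only [← mul_assoc]
    rw [mul_assoc _ sigma3 sigma3, sigma3_mul_sigma3, mul_one, mul_assoc _ sigma3 sigma3,
      sigma3_mul_sigma3, mul_one]
  have htr : ∀ l, L l 1 1 = -L l 0 0 := by
    intro l
    have : (L l).trace = 0 := by
      simp only [L]
      rw [Matrix.trace_mul_comm, ← mul_assoc, inv_mul_of_det_one (hB.2.1 l), one_mul,
        Matrix.trace_fin_two, dpwA_one_one]
      ring
    rw [Matrix.trace_fin_two] at this
    linear_combination this
  -- This is `λL`, extended holomorphically to the disc. Its value at `0` is the residue of `L`,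
  -- computed from the diagonal matrix `g 0`; the slope of `G` at `0` is `L` without its pole.
  let G : ℂ → Matrix (Fin 2) (Fin 2) ℂ := fun w =>
    g w * !![(c : ℂ) * w, (a : ℂ) + b * w ^ 2; -((a : ℂ) * w ^ 2) - b, -((c : ℂ) * w)] *
      (g w).adjugate
  have hGd : IsDiscMap G := by
    refine (hg.mul fun i j => ?_).mul hg.adjugate
    refine Differentiable.diffContOnCl ?_
    fin_cases i <;> fin_cases j <;> simp <;> fun_prop
  have hG : ∀ l : Circle, G l = (l : ℂ) • L l := by
    intro l
    simp only [G, L]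
    rw [← hgB, ← inv_eq_adjugate (hB.2.1 l), ← Matrix.smul_mul, ← Matrix.mul_smul]
    congr 2
    ext i j
    have := l.coe_ne_zero
    fin_cases i <;> fin_cases j <;> simp [dpwA] <;> field_simp
  have hG01 : G 0 0 1 = (a * β ^ 2 : ℝ) := by
    simp [G, hg0, Matrix.adjugate_fin_two]; ring
  have hG10 : G 0 1 0 = -(b * (β ^ 2)⁻¹ : ℝ) := by
    simp [G, hg0, Matrix.adjugate_fin_two]; ring
  have hG00 : G 0 0 0 = 0 := by
    simp [G, hg0, Matrix.adjugate_fin_two]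
  have hds : ∀ (l : Circle) i j, dslope (fun w => G w i j) 0 l = L l i j - (l : ℂ)⁻¹ * G 0 i j := by
    intro l i j
    have h1 := sub_smul_dslope (fun w => G w i j) 0 (l : ℂ)
    have h2 := congrFun (congrFun (hG l) i) j
    simp only [sub_zero, smul_eq_mul, Matrix.smul_apply] at h1 h2
    rw [h2] at h1
    have := l.coe_ne_zero
    field_simp
    linear_combination h1
  have hc00 : ∀ l, conj (L l 0 0) = L l 0 0 := by
    intro l
    have := congrFun (congrFun (hτ l) 1) 1
    simp [tauMat] at this
    rw [this, htr, neg_neg]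
  have hc10 : ∀ l, L l 1 0 = -conj (L l 0 1) := by
    intro l
    have := congrFun (congrFun (hτ l) 1) 0
    simp [tauMat] at this
    rw [this, neg_neg]
  have ho : ∀ l, -L (-l) 0 1 = L l 0 1 := by
    intro l
    have h1 := htw l
    rw [sigma3_conj] at h1
    simpa using congrFun (congrFun h1 0) 1
  -- The diagonal entry has no pole and is real on the circle, so it is constant.
  have hconst : ∀ l, L l 0 0 = dslope (fun w => G w 0 0) 0 0 := by
    intro l
    have h1 : ∀ l : Circle, dslope (fun w => G w 0 0) 0 l = L l 0 0 := fun l => by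
      rw [hds, hG00]; ring
    rw [← h1]
    refine DiffContOnCl.eq_of_eq_conj (hGd 0 0).dslope_zero (hGd 0 0).dslope_zero (fun l => ?_)
      (by simp [l.norm_coe])
    rw [h1, hc00]
  -- The pole of `L₁₀` becomes, through `L₁₀ = -conj L₀₁`, the linear term of `L₀₁`. Once this term
  -- is removed, both sides extend holomorphically and only a constant is left.
  have hconst' : ∀ l : Circle, dslope (fun w => G w 0 1) 0 l - (b * (β ^ 2)⁻¹ : ℝ) * l =
      dslope (fun w => G w 0 1) 0 0 := by
    intro l
    have hd : ∀ k : ℝ, DiffContOnCl ℂ (fun w : ℂ => k * w) (ball 0 1) := fun k =>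
      (differentiable_id.const_mul _).diffContOnCl
    have h1 := DiffContOnCl.eq_of_eq_conj (P := fun w => dslope (fun w => G w 0 1) 0 w -
        (b * (β ^ 2)⁻¹ : ℝ) * w)
      (Q := fun w => -(dslope (fun w => G w 1 0) 0 w + (a * β ^ 2 : ℝ) * w))
      ((hGd 0 1).dslope_zero.fun_sub (hd _)) ((hGd 1 0).dslope_zero.fun_add (hd _)).fun_neg
      (fun l => ?_) (w := l) (by simp [l.norm_coe])
    · simpa using h1
    · simp only [hds, hG01, hG10, hc10, map_neg, map_add, map_sub, map_mul, Complex.conj_conj,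
        Complex.conj_ofReal, ← circle_inv_eq_conj]
      rw [circle_inv_eq_conj, Complex.conj_conj]
      ring
  have hL01 : ∀ l : Circle, L l 0 1 = (a * β ^ 2 : ℝ) * (l : ℂ)⁻¹ + (b * (β ^ 2)⁻¹ : ℝ) * l := by
    have h0 : ∀ l : Circle, L l 0 1 = (a * β ^ 2 : ℝ) * (l : ℂ)⁻¹ + (b * (β ^ 2)⁻¹ : ℝ) * l +
        dslope (fun w => G w 0 1) 0 0 := by
      intro l
      rw [← hconst' l, hds, hG01]; ring
    -- The entry is odd in `λ` by the twisting condition, so the leftover constant is zero.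
    have h1 := ho 1
    rw [h0, h0] at h1
    simp only [Circle.coe_neg, Circle.coe_one, inv_neg, inv_one] at h1
    intro l
    rw [h0]
    linear_combination -h1 / 2
  have hr : conj (dslope (fun w => G w 0 0) 0 0) = dslope (fun w => G w 0 0) 0 0 := by
    rw [← hconst 1, hc00]
  obtain ⟨r, hr⟩ := Complex.conj_eq_iff_real.1 hr
  refine ⟨r, fun l => ?_⟩
  have hLl : L l = dpwA (a * β ^ 2) (b * (β ^ 2)⁻¹) r l := by
    have h10 := hc10 l
    have h11 := htr l
    rw [hL01, map_add, map_mul, map_mul, Complex.conj_ofReal, Complex.conj_ofReal,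
      circle_inv_eq_conj, Complex.conj_conj, ← circle_inv_eq_conj] at h10
    rw [hconst, hr] at h11
    ext i j
    fin_cases i <;> fin_cases j
    · exact (hconst l).trans hr
    · exact hL01 l
    · refine h10.trans ?_
      simp [dpwA]; ring
    · exact h11
  rw [← hLl]
  simp only [L]
  rw [mul_assoc _ _ (B l), inv_mul_of_det_one (hB.2.1 l), mul_one]

/-- Twisting makes the value of the positive factor at `λ = 0` diagonal. The phase `u` of its first
entry is moved into the real factor, and the modulus `β > 0` rescales the potential. -/
theorem exists_normalized_splitting {a b c : ℝ} {z : ℂ} (hz : z ∈ dpwDomain a b c) :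
    ∃ F ∈ realLoops, ∃ B ∈ plusLoops, ∃ β r : ℝ, 0 < β ∧ dpwSolution a b c z = F * B ∧
      ∀ l, B l * dpwA a b c l = dpwA (a * β ^ 2) (b * (β ^ 2)⁻¹) r l * B l := by
  obtain ⟨F, hF, B, hB, hφ⟩ := exists_splitting_of_mem_iwasawaBigCell hz
  obtain ⟨hBt, g, hg, hgB⟩ := hB
  have htw := fun l => hBt.2.2 l
  simp only [sigma3_conj] at htw
  have h01 : g 0 0 1 = 0 := by
    have := DiffContOnCl.eqOn_of_circle (hg 0 1).comp_neg_unit (hg 0 1).fun_neg fun l => by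
      have := congrFun (congrFun (htw l) 0) 1
      simp [hgB] at this
      linear_combination -this
    simp only [neg_zero] at this
    linear_combination this / 2
  have h10 : g 0 1 0 = 0 := by
    have := DiffContOnCl.eqOn_of_circle (hg 1 0).comp_neg_unit (hg 1 0).fun_neg fun l => by
      have := congrFun (congrFun (htw l) 1) 0
      simp [hgB] at this
      linear_combination -this
    simp only [neg_zero] at this
    linear_combination this / 2
  have hdet : g 0 0 0 * g 0 1 1 = 1 := by
    have := DiffContOnCl.eqOn_of_circle (Q := fun _ => (1 : ℂ))
      (((hg 0 0).fun_mul (hg 1 1)).fun_sub ((hg 0 1).fun_mul (hg 1 0))) diffContOnCl_const fun l => by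
        have := hBt.2.1 l
        rwa [Matrix.det_fin_two, hgB] at this
    simp only [h01, zero_mul, sub_zero] at this
    exact this
  have hk : g 0 0 0 ≠ 0 := left_ne_zero_of_mul_eq_one hdet
  obtain ⟨β, hβ⟩ : ∃ β : ℝ, β = ‖g 0 0 0‖ := ⟨_, rfl⟩
  have hβ0 : 0 < β := by rw [hβ]; exact norm_pos_iff.2 hk
  have hβc : (β : ℂ) ≠ 0 := by exact_mod_cast hβ0.ne'
  obtain ⟨u, hu⟩ : ∃ u : ℂ, u = g 0 0 0 / β := ⟨_, rfl⟩
  have hu0 : u ≠ 0 := by rw [hu]; exact div_ne_zero hk hβc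
  have huu : conj u = u⁻¹ := by
    refine eq_inv_of_mul_eq_one_left ?_
    rw [← Complex.normSq_eq_conj_mul_self, Complex.normSq_eq_norm_sq, hu, norm_div, ← hβ,
      Complex.norm_real, Real.norm_of_nonneg hβ0.le, div_self hβ0.ne']
    simp
  let K : MatLoop := fun _ => !![u, 0; 0, u⁻¹]
  let K' : MatLoop := fun _ => !![u⁻¹, 0; 0, u]
  have hKK : K * K' = 1 := by
    funext l
    ext i j
    fin_cases i <;> fin_cases j <;> simp [K, K', hu0]
  have hK : K ∈ realLoops := mem_realLoops_iff.2 ⟨diag_mem_twistedLoops hu0, 1, Or.inl rfl,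
    fun l => by simp only [K]; rw [tauMat_diag, map_inv₀, huu, inv_inv, one_smul]⟩
  have hK' : K' ∈ plusLoops := by
    have := diag_mem_plusLoops (inv_ne_zero hu0)
    rwa [inv_inv] at this
  have hB' : K' * B ∈ plusLoops := mul_mem_plusLoops hK' ⟨hBt, g, hg, hgB⟩
  have hφ' : dpwSolution a b c z = (F * K) * (K' * B) := by
    rw [mul_assoc, ← mul_assoc K, hKK, one_mul, hφ]
  have hF' := mul_mem_realLoops hF hK
  obtain ⟨r, hr⟩ := exists_conj_dpwA (β := β) (g := fun w => !![u⁻¹, 0; 0, u] * g w) hF' hφ' hB'.1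
    ((isDiscMap_const _).mul hg) (fun l => by rw [Pi.mul_apply, hgB]) (by
      ext i j
      have h11 : g 0 1 1 = (g 0 0 0)⁻¹ := (inv_eq_of_mul_eq_one_right hdet).symm
      fin_cases i <;> fin_cases j <;> simp [Matrix.mul_apply, h01, h10, h11]
      · rw [hu]; field_simp
      · rw [hu]; field_simp)
  exact ⟨F * K, hF', K' * B, hB', β, r, hβ0, hφ', hr⟩

/-- The real factor of a splitting is differentiable along the unit circle. -/
theorem differentiableAt_of_splitting {a b c : ℝ} {z : ℂ} {F B : MatLoop} (hF : F ∈ realLoops)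
    (hB : B ∈ plusLoops) (hφ : dpwSolution a b c z = F * B) (l : Circle) (i j : Fin 2) :
    DifferentiableAt ℝ (fun θ : ℝ => F (l * Circle.exp θ) i j) 0 := by
  obtain ⟨hFt, ε, hε, hFr⟩ := mem_realLoops_iff.1 hF
  have hε2 : ε * ε = 1 := by rcases hε with rfl | rfl <;> simp
  have hεc : conj ε = ε := by rcases hε with rfl | rfl <;> simp
  obtain ⟨hBt, g, hg, hgB⟩ := hB
  -- This covers the punctured plane by `ζ`, with the upper half plane going into the disc and the
  -- real line onto the circle. There `F = φB⁻¹` extends to `Φ`, holomorphic above the axis.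
  let s : ℂ → ℂ := fun ζ => l * Complex.exp (ζ * I)
  have hs0 : ∀ ζ, s ζ ≠ 0 := fun ζ => mul_ne_zero l.coe_ne_zero (Complex.exp_ne_zero _)
  have hsn : ∀ ζ : ℂ, ‖s ζ‖ = Real.exp (-ζ.im) := fun ζ => by
    simp [s, Complex.norm_exp, l.norm_coe]
  have hsd : Differentiable ℂ s := by simp only [s]; fun_prop
  let E : ℂ → Matrix (Fin 2) (Fin 2) ℂ := fun ζ => NormedSpace.exp (z • dpwAExt a b c (s ζ))
  have hE : ∀ i j, Differentiable ℂ fun ζ => E ζ i j := fun i j ζ =>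
    DifferentiableAt.comp (g := fun w => NormedSpace.exp (z • dpwAExt a b c w) i j) (f := s) ζ
      (differentiableAt_exp_dpwAExt a b c z (hs0 ζ) i j) (hsd ζ)
  let Φ : ℂ → Matrix (Fin 2) (Fin 2) ℂ := fun ζ => E ζ * (g (s ζ)).adjugate
  have hΦd : ∀ i j (ζ : ℂ), 0 < ζ.im → DifferentiableAt ℂ (fun ζ => Φ ζ i j) ζ := by
    intro i j ζ hζ
    have hm : s ζ ∈ ball (0 : ℂ) 1 := by
      rw [mem_ball_zero_iff, hsn, Real.exp_lt_one_iff]; linarith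
    have h1 : ∀ i j, DifferentiableAt ℂ (fun ζ => (g (s ζ)).adjugate i j) ζ := fun i j =>
      DifferentiableAt.comp (g := fun w => (g w).adjugate i j) (f := s) ζ
        ((IsDiscMap.adjugate hg i j).differentiableAt isOpen_ball hm) (hsd ζ)
    simp only [Φ, Matrix.mul_apply, Fin.sum_univ_two]
    exact ((hE _ _ ζ).mul (h1 _ _)).add ((hE _ _ ζ).mul (h1 _ _))
  have hΦc : ∀ i j, ContinuousOn (fun ζ => Φ ζ i j) {ζ | 0 ≤ ζ.im} := by
    intro i j
    have h1 : ∀ i j, ContinuousOn (fun ζ => (g (s ζ)).adjugate i j) {ζ | 0 ≤ ζ.im} := by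
      intro i j
      refine ContinuousOn.comp (g := fun w => (g w).adjugate i j) (f := s)
        (IsDiscMap.adjugate hg i j).continuousOn hsd.continuous.continuousOn fun ζ hζ => ?_
      rw [closure_ball 0 one_ne_zero, mem_closedBall_zero_iff, hsn, Real.exp_le_one_iff]
      simpa using hζ
    simp only [Φ, Matrix.mul_apply, Fin.sum_univ_two]
    exact ((hE _ _).continuous.continuousOn.mul (h1 _ _)).add
      ((hE _ _).continuous.continuousOn.mul (h1 _ _))
  have hΦF : ∀ θ : ℝ, F (l * Circle.exp θ) = Φ θ := by
    intro θ
    have h1 : s θ = (l * Circle.exp θ : Circle) := by simp [s, Circle.coe_exp]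
    simp only [Φ, E]
    rw [h1, ← hgB, ← dpwA_eq_ext, ← inv_eq_adjugate (hBt.2.1 _)]
    have h2 := congrFun hφ (l * Circle.exp θ)
    rw [Pi.mul_apply] at h2
    refine (?_ : _ = dpwSolution a b c z (l * Circle.exp θ) * (B (l * Circle.exp θ))⁻¹)
    rw [h2, mul_assoc, mul_inv_of_det_one (hBt.2.1 _), mul_one]
  -- The reality of `F` is the reflection condition. `tauMat` replaces the indices `i`, `j` by `1 -
  -- i`, `1 - j`.
  have hrefl : ∀ i j, ∀ θ : ℝ, Φ θ i j = conj (ε * Φ θ (1 - i) (1 - j)) := by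
    intro i j θ
    rw [← hΦF, map_mul, hεc]
    have h1 := congrFun (congrFun (hFr (l * Circle.exp θ)) i) j
    have h2 : tauMat (F (l * Circle.exp θ)) i j = conj (F (l * Circle.exp θ) (1 - i) (1 - j)) := by
      fin_cases i <;> fin_cases j <;> simp [tauMat]
    rw [← h2, h1, Matrix.smul_apply, smul_eq_mul, ← mul_assoc, hε2, one_mul]
  have := differentiable_of_eq_conj (hΦc i j) ((hΦc (1 - i) (1 - j)).const_smul ε) (hΦd i j)
    (fun ζ hζ => (hΦd (1 - i) (1 - j) ζ hζ).const_smul ε) (hrefl i j) 0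
  simpa only [hΦF] using this

end Potential


/-! ## The Sym-Bobenko formula of a frame -/

section Sym

open Complex (I)
open scoped ComplexConjugate

theorem IsSu11.of_tauMat_eq {M : Matrix (Fin 2) (Fin 2) ℂ} (h : tauMat M = M) (ht : M 1 1 = -M 0 0) :
    IsSu11 M := by
  have h0 := congrFun (congrFun h 0) 0
  have h1 := congrFun (congrFun h 1) 0
  simp [tauMat] at h0 h1
  refine ⟨?_, ht, h1.symm⟩
  rw [ht, map_neg] at h0
  linear_combination -h0

/-- Differentiating `τ(F) = εF` gives the reality of `D F⁻¹`, and differentiating `det F = 1` makes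
it traceless. -/
theorem isSu11_of_hasDerivAt {F : MatLoop} {D : Matrix (Fin 2) (Fin 2) ℂ} {l : Circle}
    (hF : F ∈ realLoops)
    (hD : ∀ i j, HasDerivAt (fun θ : ℝ => F (l * Circle.exp θ) i j) (D i j) 0) :
    IsSu11 (D * (F l)⁻¹) := by
  obtain ⟨hFt, ε, hε, hFr⟩ := mem_realLoops_iff.1 hF
  have hε2 : ε * ε = 1 := by rcases hε with rfl | rfl <;> simp
  have hl : l * Circle.exp 0 = l := by rw [Circle.exp_zero, mul_one]
  have hτ : tauMat D = ε • D := by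
    have hc : ∀ i j, HasDerivAt (fun θ : ℝ => conj (F (l * Circle.exp θ) i j)) (conj (D i j)) 0 :=
      fun i j => (hD i j).star
    have hu : ∀ i j, HasDerivAt (fun θ : ℝ => tauMat (F (l * Circle.exp θ)) i j)
        (tauMat D i j) 0 := by
      intro i j
      fin_cases i <;> fin_cases j <;> simp [tauMat] <;> exact hc _ _
    ext i j
    refine (hu i j).unique ?_
    simp only [hFr, Matrix.smul_apply]
    exact (hD i j).const_smul ε
  refine IsSu11.of_tauMat_eq ?_ ?_
  · rw [tauMat_mul, tauMat_inv (hFt.2.1 l), hτ, hFr,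
      inv_eq_of_mul_eq_one (X := ε • F l) (Y := ε • (F l)⁻¹) (by
        rw [Matrix.smul_mul, Matrix.mul_smul, smul_smul, hε2, one_smul,
          mul_inv_of_det_one (hFt.2.1 l)]), Matrix.smul_mul, Matrix.mul_smul, smul_smul, hε2, one_smul]
  · have hdet := ((hD 0 0).mul (hD 1 1)).sub ((hD 0 1).mul (hD 1 0))
    have h1 : (fun θ : ℝ => F (l * Circle.exp θ) 0 0) * (fun θ : ℝ => F (l * Circle.exp θ) 1 1) -
        (fun θ : ℝ => F (l * Circle.exp θ) 0 1) * (fun θ : ℝ => F (l * Circle.exp θ) 1 0) =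
        fun _ => 1 := by
      funext θ
      have := hFt.2.1 (l * Circle.exp θ)
      rw [Matrix.det_fin_two] at this
      exact this
    rw [h1] at hdet
    have h2 := hdet.unique (hasDerivAt_const (0 : ℝ) (1 : ℂ))
    rw [hl] at h2
    rw [inv_eq_of_det_one (hFt.2.1 l)]
    simp [Matrix.mul_apply]
    linear_combination h2

/-- The Sym-Bobenko formula as an equation in `ℝ^{2,1}`. -/
theorem isSymBobenko_iff {H : ℝ} {F : MatLoop} {D : Matrix (Fin 2) (Fin 2) ℂ} {l : Circle}
    (hF : F ∈ realLoops)
    (hD : ∀ i j, HasDerivAt (fun θ : ℝ => F (l * Circle.exp θ) i j) (D i j) 0) (p : R21) :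
    IsSymBobenko H l F p ↔ p = symFormula H (F l) (D * (F l)⁻¹) := by
  have hsu : IsSu11 (F l * (I • sigma3) * (F l)⁻¹ + (2 : ℂ) • (D * (F l)⁻¹)) := by
    refine IsSu11.add ?_ ?_
    · rw [← toSu11_e₃]
      exact (isSU11_of_mem_realLoops hF l).conj_isSu11 (isSu11_toSu11 _)
    · have := (isSu11_of_hasDerivAt hF hD).smul 2
      convert this using 1
      ext i j; simp
  have hsm : ∀ M : Matrix (Fin 2) (Fin 2) ℂ,
      (-(1 / (2 * (H : ℂ)))) • M = (-(1 / (2 * H)) : ℝ) • M := by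
    intro M; ext i j; simp
  have hkey : toSu11 (symFormula H (F l) (D * (F l)⁻¹)) = (-(1 / (2 * (H : ℂ)))) •
      (F l * (I • sigma3) * (F l)⁻¹ + (2 : ℂ) • (D * (F l)⁻¹)) := by
    rw [symFormula, toSu11_smul, hsu.toSu11_ofSu11, hsm]
  constructor
  · rintro ⟨D', hD', h⟩
    have : D' = D := by ext i j; exact (hD' i j).unique (hD i j)
    rw [this] at h
    exact toSu11_injective (h.trans hkey.symm)
  · rintro rfl
    exact ⟨D, hD, hkey⟩

/-- The Sym-Bobenko formula does not depend on the choice of the frame. -/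
theorem isSymBobenko_iff_of_splittings {H : ℝ} {F F' B B' : MatLoop}
    {D : Matrix (Fin 2) (Fin 2) ℂ} {l : Circle} (hF : F ∈ realLoops) (hF' : F' ∈ realLoops)
    (hB : B ∈ plusLoops) (hB' : B' ∈ plusLoops) (h : F * B = F' * B')
    (hD : ∀ i j, HasDerivAt (fun θ : ℝ => F' (l * Circle.exp θ) i j) (D i j) 0) (p : R21) :
    IsSymBobenko H l F p ↔ p = symFormula H (F' l) (D * (F' l)⁻¹) := by
  obtain ⟨k, hk, hkl⟩ := eq_mul_diag_of_splittings hF hF' hB hB' h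
  have hk0 : k ≠ 0 := right_ne_zero_of_mul_eq_one hk
  obtain ⟨K, hK⟩ : ∃ K : Matrix (Fin 2) (Fin 2) ℂ, K = !![k, 0; 0, k⁻¹] := ⟨_, rfl⟩
  rw [← hK] at hkl
  have hKd : K.det = 1 := by rw [hK]; simp [hk0]
  have hD' : ∀ i j, HasDerivAt (fun θ : ℝ => F (l * Circle.exp θ) i j) ((D * K) i j) 0 := by
    intro i j
    simp only [hkl, Matrix.mul_apply, Fin.sum_univ_two]
    exact ((hD i 0).mul_const _).add ((hD i 1).mul_const _)
  rw [isSymBobenko_iff hF hD', hkl, Matrix.mul_inv_rev]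
  -- The two frames differ by a diagonal `K`, which commutes with `σ₃` and, being independent of
  -- `λ`, also cancels in the derivative term.
  have h1 : F' l * K * (I • sigma3) * (K⁻¹ * (F' l)⁻¹) = F' l * (I • sigma3) * (F' l)⁻¹ := by
    have : K * (I • sigma3) = (I • sigma3) * K := by
      rw [hK]
      ext i j
      fin_cases i <;> fin_cases j <;> simp [sigma3, Matrix.mul_apply, mul_comm]
    rw [mul_assoc (F' l), this, ← mul_assoc, ← mul_assoc, mul_assoc _ K,
      mul_inv_of_det_one hKd, mul_one]
  have h2 : D * K * (K⁻¹ * (F' l)⁻¹) = D * (F' l)⁻¹ := by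
    rw [← mul_assoc, mul_assoc D, mul_inv_of_det_one hKd, mul_one]
  rw [symFormula, symFormula, Matrix.mul_inv_rev, h1, h2]

theorem exists_isSymBobenko_of_splitting {a b c H : ℝ} {z : ℂ} {F B : MatLoop} {l : Circle}
    (hF : F ∈ realLoops) (hB : B ∈ plusLoops) (h : dpwSolution a b c z = F * B) :
    ∃ p, IsSymBobenko H l F p :=
  ⟨_, (isSymBobenko_iff (D := fun i j => deriv (fun θ : ℝ => F (l * Circle.exp θ) i j) 0) hF
    (fun i j => (differentiableAt_of_splitting hF hB h l i j).hasDerivAt) _).2 rfl⟩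

end Sym


/-! ## Explicit splittings on strips -/

section Strip

open scoped Matrix.Norms.Operator
open Complex (I)
open scoped ComplexConjugate

theorem HasDerivAt.adjugate_of_left {X : ℝ → Matrix (Fin 2) (Fin 2) ℂ}
    {P : Matrix (Fin 2) (Fin 2) ℂ} {x : ℝ} (h : HasDerivAt X (P * X x) x) (hP : P 1 1 = -P 0 0) :
    HasDerivAt (fun t => (X t).adjugate) (-((X x).adjugate * P)) x := by
  refine (adjugateCLM.hasFDerivAt.comp_hasDerivAt x h).congr_deriv ?_
  refine (adjugateCLM_apply _).trans ?_
  rw [Matrix.adjugate_mul_distrib, adjugate_eq_neg hP, mul_neg]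

theorem HasDerivAt.adjugate_of_right {X : ℝ → Matrix (Fin 2) (Fin 2) ℂ}
    {P : Matrix (Fin 2) (Fin 2) ℂ} {x : ℝ} (h : HasDerivAt X (X x * P) x) (hP : P 1 1 = -P 0 0) :
    HasDerivAt (fun t => (X t).adjugate) (-(P * (X x).adjugate)) x := by
  refine (adjugateCLM.hasFDerivAt.comp_hasDerivAt x h).congr_deriv ?_
  refine (adjugateCLM_apply _).trans ?_
  rw [Matrix.adjugate_mul_distrib, adjugate_eq_neg hP, neg_mul]

theorem eq_of_hasDerivAt_zero {E : Type*} [NormedAddCommGroup E] [NormedSpace ℝ E] {J : Set ℝ}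
    (hJ : IsOpen J) (hJ' : J.OrdConnected) {f : ℝ → E} (h : ∀ x ∈ J, HasDerivAt f 0 x) {x y : ℝ}
    (hx : x ∈ J) (hy : y ∈ J) : f x = f y :=
  hJ.is_const_of_deriv_eq_zero hJ'.isPreconnected
    (fun z hz => (h z hz).differentiableAt.differentiableWithinAt) (fun z hz => (h z hz).deriv) hx hy

/-- For a traceless coefficient the product `adj(X) X = det X · 1` has derivative zero. -/
theorem det_eq_one_of_hasDerivAt {J : Set ℝ} (hJ : IsOpen J) (hJ' : J.OrdConnected) (h0 : 0 ∈ J)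
    {X P : ℝ → Matrix (Fin 2) (Fin 2) ℂ} (hX : ∀ x ∈ J, HasDerivAt X (P x * X x) x)
    (hP : ∀ x, P x 1 1 = -P x 0 0) (hX0 : X 0 = 1) {x : ℝ} (hx : x ∈ J) : (X x).det = 1 := by
  have h : ∀ x ∈ J, HasDerivAt (fun t => (X t).adjugate * X t) 0 x := fun x hx =>
    (((hX x hx).adjugate_of_left (hP x)).mul (hX x hx)).congr_deriv (by noncomm_ring)
  have h1 := eq_of_hasDerivAt_zero hJ hJ' h hx h0
  rw [Matrix.adjugate_mul, hX0, Matrix.adjugate_one, mul_one] at h1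
  have := congrFun (congrFun h1 0) 0
  simpa using this

theorem eq_of_hasDerivAt_left {J : Set ℝ} (hJ : IsOpen J) (hJ' : J.OrdConnected) (h0 : 0 ∈ J)
    {X Y P : ℝ → Matrix (Fin 2) (Fin 2) ℂ} (hX : ∀ x ∈ J, HasDerivAt X (P x * X x) x)
    (hY : ∀ x ∈ J, HasDerivAt Y (P x * Y x) x)
    (hP : ∀ x, P x 1 1 = -P x 0 0) (hX0 : X 0 = 1) (hY0 : Y 0 = 1) {x : ℝ} (hx : x ∈ J) :
    X x = Y x := by
  have hd := det_eq_one_of_hasDerivAt hJ hJ' h0 hX hP hX0 hx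
  have h : ∀ x ∈ J, HasDerivAt (fun t => (X t).adjugate * Y t) 0 x := fun x hx =>
    (((hX x hx).adjugate_of_left (hP x)).mul (hY x hx)).congr_deriv (by noncomm_ring)
  have h1 := eq_of_hasDerivAt_zero hJ hJ' h hx h0
  rw [hX0, hY0, Matrix.adjugate_one, mul_one] at h1
  rw [← mul_one (X x), ← h1, ← mul_assoc, Matrix.mul_adjugate, hd, one_smul, one_mul]

theorem continuousOn_matrix_iff {Y : Type*} [TopologicalSpace Y] {s : Set Y}
    {M : Y → Matrix (Fin 2) (Fin 2) ℂ} :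
    ContinuousOn M s ↔ ∀ i j, ContinuousOn (fun t => M t i j) s :=
  continuousOn_pi.trans (forall_congr' fun _ => continuousOn_pi)

/-- Solutions of the structure equations of an equivariant surface. -/
structure ProfileSystem (a b c : ℝ) (J : Set ℝ) (v r : ℝ → ℝ) : Prop where
  isOpen : IsOpen J
  ordConnected : J.OrdConnected
  zero_mem : 0 ∈ J
  pos : ∀ x ∈ J, 0 < v x
  hasDerivAt_v : ∀ x ∈ J, HasDerivAt v (2 * v x * r x) x
  hasDerivAt_r : ∀ x ∈ J, HasDerivAt r (2 * a ^ 2 * v x ^ 2 - 2 * b ^ 2 * (v x)⁻¹ ^ 2) x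
  v_zero : v 0 = 1
  r_zero : r 0 = c

/-- The diagonal part of the positive factor. -/
noncomputable def stripDiag (v : ℝ → ℝ) (x : ℝ) : Matrix (Fin 2) (Fin 2) ℂ :=
  !![(√(v x) : ℝ), 0; 0, ((√(v x))⁻¹ : ℝ)]

/-- The coefficients of the differential equation of the positive factor. -/
noncomputable def stripCoeff (a b : ℝ) (v : ℝ → ℝ) (x : ℝ) : Matrix (Fin 2) (Fin 2) ℂ :=
  !![0, (2 * b * (v x)⁻¹ ^ 2 : ℝ); (-(2 * a * v x ^ 2) : ℝ), 0]

/-- The positive factor of the splitting. -/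
noncomputable def stripB (a b : ℝ) (v : ℝ → ℝ) (x : ℝ) (w : ℂ) : Matrix (Fin 2) (Fin 2) ℂ :=
  stripDiag v x * dysonSum (stripCoeff a b v) x w

variable {a b c : ℝ} {J : Set ℝ} {v r : ℝ → ℝ}

namespace ProfileSystem

theorem continuousOn_v (h : ProfileSystem a b c J v r) : ContinuousOn v J := fun x hx =>
  (h.hasDerivAt_v x hx).continuousAt.continuousWithinAt

theorem continuousOn_inv (h : ProfileSystem a b c J v r) : ContinuousOn (fun x => (v x)⁻¹) J :=
  h.continuousOn_v.inv₀ fun x hx => (h.pos x hx).ne'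

theorem continuousOn_stripCoeff (h : ProfileSystem a b c J v r) :
    ContinuousOn (stripCoeff a b v) J := by
  have h1 := h.continuousOn_v
  have h2 := h.continuousOn_inv
  refine continuousOn_matrix_iff.2 fun i j => ?_
  fin_cases i <;> fin_cases j
  · exact continuousOn_const
  · exact Complex.continuous_ofReal.comp_continuousOn ((h2.pow 2).const_mul (2 * b))
  · exact Complex.continuous_ofReal.comp_continuousOn ((h1.pow 2).const_mul (2 * a)).neg
  · exact continuousOn_const

theorem hasDerivAt_sqrt (h : ProfileSystem a b c J v r) {x : ℝ} (hx : x ∈ J) :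
    HasDerivAt (fun t => √(v t)) (r x * √(v x)) x := by
  have hp := h.pos x hx
  refine ((h.hasDerivAt_v x hx).sqrt hp.ne').congr_deriv ?_
  have hs := Real.sqrt_pos.2 hp
  have : v x = √(v x) * √(v x) := (Real.mul_self_sqrt hp.le).symm
  field_simp
  rw [pow_two, ← this]; ring

theorem hasDerivAt_stripDiag (h : ProfileSystem a b c J v r) {x : ℝ} (hx : x ∈ J) :
    HasDerivAt (stripDiag v) (!![(r x : ℂ), 0; 0, -(r x : ℂ)] * stripDiag v x) x := by
  have h1 := h.hasDerivAt_sqrt hx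
  have hs := Real.sqrt_pos.2 (h.pos x hx)
  have h2 : HasDerivAt (fun t => (√(v t))⁻¹) (-(r x * (√(v x))⁻¹)) x :=
    (h1.inv hs.ne').congr_deriv (by field_simp)
  refine hasDerivAt_matrix_iff.2 fun i j => ?_
  fin_cases i <;> fin_cases j <;> simp [stripDiag, Matrix.mul_apply]
  · exact h1.ofReal_comp.congr_deriv (by push_cast; ring)
  · exact hasDerivAt_const _ _
  · exact hasDerivAt_const _ _
  · simpa using h2.ofReal_comp

theorem stripDiag_mul_stripCoeff (h : ProfileSystem a b c J v r) {x : ℝ} (hx : x ∈ J) :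
    stripDiag v x * stripCoeff a b v x =
      !![0, ((2 * b * (v x)⁻¹ : ℝ) : ℂ); ((-(2 * a * v x) : ℝ) : ℂ), 0] * stripDiag v x := by
  have hp := h.pos x hx
  have hs := Real.sqrt_pos.2 hp
  obtain ⟨s, hs'⟩ : ∃ s, s = √(v x) := ⟨_, rfl⟩
  have hv : v x = s * s := by rw [hs']; exact (Real.mul_self_sqrt hp.le).symm
  have hsc : (s : ℂ) ≠ 0 := by rw [hs']; exact_mod_cast hs.ne'
  simp only [stripDiag, stripCoeff, ← hs']
  rw [hv]
  ext i j
  fin_cases i <;> fin_cases j <;> simp [Matrix.mul_apply] <;> field_simp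

/-- The coefficient is the potential matrix minus `frameX`, which has no negative powers of `λ`. The
diagonal factor absorbs its part of degree zero; the remaining equation is proportional to `w` and
is solved by a power series in `w`. -/
theorem hasDerivAt_stripB (h : ProfileSystem a b c J v r) {x : ℝ} (hx : x ∈ J) (w : ℂ) :
    HasDerivAt (fun t => stripB a b v t w)
      (!![(r x : ℂ), w * (2 * b * (v x)⁻¹ : ℝ); w * (-(2 * a * v x) : ℝ), -(r x : ℂ)] *
        stripB a b v x w) x := by
  refine ((h.hasDerivAt_stripDiag hx).mul (hasDerivAt_dysonSum h.isOpen h.ordConnected h.zero_mem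
    h.continuousOn_stripCoeff hx w)).congr_deriv ?_
  rw [Matrix.mul_smul, ← mul_assoc, h.stripDiag_mul_stripCoeff hx]
  simp only [stripB]
  rw [mul_assoc, mul_assoc, ← Matrix.smul_mul, ← add_mul]
  congr 1
  ext i j
  fin_cases i <;> fin_cases j <;> simp

theorem stripB_zero (h : ProfileSystem a b c J v r) (w : ℂ) : stripB a b v 0 w = 1 := by
  rw [stripB, dysonSum_zero, mul_one, stripDiag, h.v_zero]
  ext i j
  fin_cases i <;> fin_cases j <;> simp

theorem det_stripB (h : ProfileSystem a b c J v r) {x : ℝ} (hx : x ∈ J) (w : ℂ) :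
    (stripB a b v x w).det = 1 :=
  det_eq_one_of_hasDerivAt h.isOpen h.ordConnected h.zero_mem
    (fun x hx => h.hasDerivAt_stripB hx w) (fun x => by simp) (h.stripB_zero w) hx

/-- Replacing `w` by `-w` changes the sign of the off-diagonal coefficients, as conjugation by `σ₃`
does; uniqueness for the linear equation identifies the two sides. -/
theorem sigma3_conj_stripB (h : ProfileSystem a b c J v r) {x : ℝ} (hx : x ∈ J) (w : ℂ) :
    sigma3 * stripB a b v x (-w) * sigma3 = stripB a b v x w := by
  refine eq_of_hasDerivAt_left h.isOpen h.ordConnected h.zero_mem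
    (X := fun t => sigma3 * stripB a b v t (-w) * sigma3) (fun x hx => ?_)
    (fun x hx => h.hasDerivAt_stripB hx w) (fun x => by simp)
    (by simp only [h.stripB_zero, mul_one, sigma3_mul_sigma3]) (h.stripB_zero w) hx
  refine (((h.hasDerivAt_stripB hx (-w)).const_mul sigma3).mul_const sigma3).congr_deriv ?_
  have : sigma3 * !![(r x : ℂ), -w * (2 * b * (v x)⁻¹ : ℝ); -w * (-(2 * a * v x) : ℝ), -(r x : ℂ)] =
      !![(r x : ℂ), w * (2 * b * (v x)⁻¹ : ℝ); w * (-(2 * a * v x) : ℝ), -(r x : ℂ)] * sigma3 := by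
    ext i j
    fin_cases i <;> fin_cases j <;> simp [sigma3, Matrix.mul_apply]
  rw [← mul_assoc, this]
  simp only [mul_assoc]

theorem differentiable_stripB (h : ProfileSystem a b c J v r) {x : ℝ} (hx : x ∈ J) :
    Differentiable ℂ (stripB a b v x) :=
  (differentiable_dysonSum h.isOpen h.ordConnected h.zero_mem
    h.continuousOn_stripCoeff hx).const_mul _

theorem stripB_mem_plusLoops (h : ProfileSystem a b c J v r) {x : ℝ} (hx : x ∈ J) :
    (fun l : Circle => stripB a b v x l) ∈ plusLoops := by
  refine ⟨⟨?_, fun l => h.det_stripB hx l, fun l => h.sigma3_conj_stripB hx l⟩, stripB a b v x,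
    fun i j => ?_, fun l => rfl⟩
  · exact (h.differentiable_stripB hx).continuous.comp continuous_subtype_val
  · exact Differentiable.diffContOnCl fun w => (h.differentiable_stripB hx w).matrix_elem i j

theorem continuousOn_stripB (h : ProfileSystem a b c J v r) :
    ContinuousOn (fun p : ℝ × ℂ => stripB a b v p.1 p.2) (J ×ˢ Set.univ) := by
  refine ContinuousOn.mul ?_ (continuousOn_dysonSum h.isOpen h.ordConnected h.zero_mem
    h.continuousOn_stripCoeff)
  have : ContinuousOn (stripDiag v) J := fun x hx =>
    (h.hasDerivAt_stripDiag hx).continuousAt.continuousWithinAt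
  exact ContinuousOn.comp (g := stripDiag v) this continuousOn_fst fun p hp => hp.1

/-- The conjugate of the potential by the positive factor. -/
theorem stripB_mul_dpwA (h : ProfileSystem a b c J v r) {x : ℝ} (hx : x ∈ J) (l : Circle) :
    stripB a b v x l * dpwA a b c l =
      dpwA (a * v x) (b * (v x)⁻¹) (r x) l * stripB a b v x l := by
  let L : ℝ → Matrix (Fin 2) (Fin 2) ℂ := fun x => dpwA (a * v x) (b * (v x)⁻¹) (r x) l
  let α : ℝ → Matrix (Fin 2) (Fin 2) ℂ := fun x => frameX (a * v x) (b * (v x)⁻¹) l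
  have hl := l.coe_ne_zero
  -- The equations for `v` and `r` are exactly the Lax equation `L' = [L, α]`.
  have hL : ∀ x ∈ J, HasDerivAt L (L x * α x - α x * L x) x := by
    intro x hx
    have hv := h.pos x hx
    have hvc : (v x : ℂ) ≠ 0 := by exact_mod_cast hv.ne'
    have h1 := h.hasDerivAt_v x hx
    have h2 := h.hasDerivAt_r x hx
    have h3 : HasDerivAt (fun t => (v t)⁻¹) (-(2 * (v x)⁻¹ * r x)) x :=
      (h1.inv hv.ne').congr_deriv (by field_simp)
    have h1' := (h1.const_mul a).ofReal_comp
    have h3' := (h3.const_mul b).ofReal_comp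
    refine hasDerivAt_matrix_iff.2 fun i j => ?_
    fin_cases i <;> fin_cases j
    · refine h2.ofReal_comp.congr_deriv ?_
      simp [L, α, dpwA, frameX, Matrix.mul_apply]
      field_simp
      ring
    · refine ((h1'.mul_const ((l : ℂ)⁻¹)).add (h3'.mul_const (l : ℂ))).congr_deriv ?_
      simp [L, α, dpwA, frameX, Matrix.mul_apply]
      field_simp
      ring
    · refine ((h1'.mul_const (l : ℂ)).neg.sub (h3'.mul_const ((l : ℂ)⁻¹))).congr_deriv ?_
      simp [L, α, dpwA, frameX, Matrix.mul_apply]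
      field_simp
      ring
    · refine h2.ofReal_comp.neg.congr_deriv ?_
      simp [L, α, dpwA, frameX, Matrix.mul_apply]
      field_simp
      ring
  have hB : ∀ x ∈ J, HasDerivAt (fun t => stripB a b v t l)
      ((L x - α x) * stripB a b v x l) x := by
    intro x hx
    refine (h.hasDerivAt_stripB hx l).congr_deriv ?_
    congr 1
    ext i j
    fin_cases i <;> fin_cases j <;> simp [L, α, dpwA, frameX] <;> ring
  -- With `B' = (L - α)B` the Lax equation makes `B⁻¹LB` constant, and at `x = 0` its value is `A`.
  have hZ : ∀ x ∈ J, HasDerivAt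
      (fun t => (stripB a b v t l).adjugate * L t * stripB a b v t l) 0 x := by
    intro x hx
    refine ((((hB x hx).adjugate_of_left (by simp [L, α, dpwA, frameX])).mul (hL x hx)).mul
      (hB x hx)).congr_deriv ?_
    simp only [Pi.mul_apply]
    noncomm_ring
  have h1 := eq_of_hasDerivAt_zero h.isOpen h.ordConnected hZ hx h.zero_mem
  simp only [h.stripB_zero, Matrix.adjugate_one, one_mul, mul_one] at h1
  have h2 : L 0 = dpwA a b c l := by simp [L, h.v_zero, h.r_zero]
  rw [h2] at h1
  rw [← h1, ← mul_assoc, ← mul_assoc, Matrix.mul_adjugate, h.det_stripB hx, one_smul, one_mul]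

end ProfileSystem

end Strip


/-! ### The real factor of the splitting over a strip. -/

section StripFrame

open scoped Matrix.Norms.Operator
open Complex (I)
open scoped ComplexConjugate

theorem hasDerivAt_dpwSolution (a b c : ℝ) (d : ℂ) (l : Circle) (t : ℝ) :
    HasDerivAt (fun t : ℝ => dpwSolution a b c (t * d) l)
      (dpwSolution a b c (t * d) l * (d • dpwA a b c l)) t := by
  have h := HasDerivAt.scomp (h := fun t : ℝ => (t : ℂ)) t
    (hasDerivAt_exp_smul_const (𝕂 := ℂ) (d • dpwA a b c l) (t : ℂ)) Complex.ofRealCLM.hasDerivAt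
  refine (HasDerivAt.congr_deriv h ?_).congr_of_eventuallyEq (Filter.Eventually.of_forall fun s => ?_)
  · simp [dpwSolution, smul_smul]
    rfl
  · simp [dpwSolution, smul_smul]
    rfl

theorem continuous_dpwSolution_uncurry (a b c : ℝ) (d : ℂ) :
    Continuous fun p : ℝ × Circle => dpwSolution a b c (p.1 * d) p.2 := by
  have hA : Continuous (dpwA a b c) := by
    refine continuous_matrix fun i j => ?_
    have h1 : Continuous fun l : Circle => (l : ℂ) := continuous_subtype_val
    have h2 : Continuous fun l : Circle => (l : ℂ)⁻¹ := h1.inv₀ fun l => l.coe_ne_zero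
    fin_cases i <;> fin_cases j <;> simp [dpwA] <;> fun_prop
  have h1 : Continuous fun p : ℝ × Circle => ((p.1 : ℂ) * d) • dpwA a b c p.2 := by
    exact Continuous.smul (f := fun p : ℝ × Circle => (p.1 : ℂ) * d) (by fun_prop)
      (hA.comp continuous_snd)
  exact (NormedSpace.exp_continuous (𝔸 := Matrix (Fin 2) (Fin 2) ℂ)).comp h1

/-- The involution `τ` as a real linear map. -/
noncomputable def tauCLM : Matrix (Fin 2) (Fin 2) ℂ →L[ℝ] Matrix (Fin 2) (Fin 2) ℂ :=
  LinearMap.toContinuousLinearMap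
    { toFun := tauMat
      map_add' := fun M N => by
        ext i j; fin_cases i <;> fin_cases j <;> simp [tauMat]
      map_smul' := fun c M => by
        ext i j; fin_cases i <;> fin_cases j <;> simp [tauMat] }

theorem eq_of_hasDerivAt_right {J : Set ℝ} (hJ : IsOpen J) (hJ' : J.OrdConnected) (h0 : 0 ∈ J)
    {X Y P : ℝ → Matrix (Fin 2) (Fin 2) ℂ} (hX : ∀ x ∈ J, HasDerivAt X (X x * P x) x)
    (hY : ∀ x ∈ J, HasDerivAt Y (Y x * P x) x)
    (hP : ∀ x, P x 1 1 = -P x 0 0) (hX0 : X 0 = 1) (hY0 : Y 0 = 1) {x : ℝ} (hx : x ∈ J)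
    (hd : (Y x).det = 1) : X x = Y x := by
  have h : ∀ x ∈ J, HasDerivAt (fun t => X t * (Y t).adjugate) 0 x := fun x hx =>
    ((hX x hx).mul ((hY x hx).adjugate_of_right (hP x))).congr_deriv (by noncomm_ring)
  have h1 := eq_of_hasDerivAt_zero hJ hJ' h hx h0
  rw [hX0, hY0, Matrix.adjugate_one, mul_one] at h1
  rw [← one_mul (Y x), ← h1, mul_assoc, Matrix.adjugate_mul, hd, one_smul, mul_one]

/-- The real factor of the splitting along the real axis. -/
noncomputable def stripF (a b c : ℝ) (v : ℝ → ℝ) (x : ℝ) : MatLoop :=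
  fun l => dpwSolution a b c x l * (stripB a b v x l)⁻¹

theorem tauMat_frameX (a b : ℝ) (l : Circle) : tauMat (frameX a b l) = frameX a b l := by
  have h := circle_inv_eq_conj l
  have h' : conj ((l : ℂ)⁻¹) = l := by rw [h, Complex.conj_conj]
  ext i j; fin_cases i <;> fin_cases j <;> simp [tauMat, frameX, ← h]

/-- The part of the coefficient matrices of degree `-1` in `λ`. -/
noncomputable def lowerCoeff (a b : ℝ) (l : Circle) : Matrix (Fin 2) (Fin 2) ℂ :=
  !![0, (a : ℂ) * (l : ℂ)⁻¹; -((b : ℂ) * (l : ℂ)⁻¹), 0]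

/-- The part of the coefficient matrices of degree `1` in `λ`. -/
noncomputable def upperCoeff (a b : ℝ) (l : Circle) : Matrix (Fin 2) (Fin 2) ℂ :=
  !![0, -((b : ℂ) * (l : ℂ)); (a : ℂ) * (l : ℂ), 0]

theorem frameX_mul_exp (a b : ℝ) (l : Circle) (θ : ℝ) :
    frameX a b (l * Circle.exp θ) = frameX a b l + (Complex.exp (-(θ * I)) - 1) • lowerCoeff a b l +
      (Complex.exp (θ * I) - 1) • upperCoeff a b l := by
  ext i j
  fin_cases i <;> fin_cases j <;>
    simp [frameX, lowerCoeff, upperCoeff, Circle.coe_exp, mul_inv, Complex.exp_neg] <;> ring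

theorem dpwA_mul_exp (a b c : ℝ) (l : Circle) (θ : ℝ) :
    dpwA a b c (l * Circle.exp θ) = dpwA a b c l + (Complex.exp (-(θ * I)) - 1) • lowerCoeff a b l +
      (Complex.exp (θ * I) - 1) • -upperCoeff a b l := by
  ext i j
  fin_cases i <;> fin_cases j <;>
    simp [dpwA, lowerCoeff, upperCoeff, Circle.coe_exp, mul_inv, Complex.exp_neg] <;> ring

theorem frameX'_eq (a b : ℝ) (l : Circle) :
    frameX' a b l = (-I) • lowerCoeff a b l + I • upperCoeff a b l := by
  ext i j
  fin_cases i <;> fin_cases j <;> simp [frameX', lowerCoeff, upperCoeff] <;> ring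

theorem dpwA'_eq (a b : ℝ) (l : Circle) :
    dpwA' a b l = (-I) • lowerCoeff a b l + I • -upperCoeff a b l := by
  ext i j
  fin_cases i <;> fin_cases j <;> simp [dpwA', lowerCoeff, upperCoeff] <;> ring

theorem hasDerivAt_exp_sub_one :
    HasDerivAt (fun θ : ℝ => Complex.exp (θ * I) - 1) I 0 := by
  have : HasDerivAt (fun θ : ℝ => (θ : ℂ) * I) I 0 := by
    simpa using (Complex.ofRealCLM.hasDerivAt (x := 0)).mul_const I
  simpa using this.cexp.sub_const 1

theorem hasDerivAt_exp_neg_sub_one :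
    HasDerivAt (fun θ : ℝ => Complex.exp (-(θ * I)) - 1) (-I) 0 := by
  have : HasDerivAt (fun θ : ℝ => -((θ : ℂ) * I)) (-I) 0 := by
    simpa using ((Complex.ofRealCLM.hasDerivAt (x := 0)).mul_const I).fun_neg
  simpa using this.cexp.sub_const 1

theorem hasDerivAt_dpwA_mul_exp (a b c : ℝ) (l : Circle) :
    HasDerivAt (fun θ : ℝ => dpwA a b c (l * Circle.exp θ)) (dpwA' a b l) 0 := by
  rw [dpwA'_eq]
  simp only [dpwA_mul_exp]
  exact ((hasDerivAt_exp_neg_sub_one.smul_const _).const_add _).add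
    (hasDerivAt_exp_sub_one.smul_const _)

/-- The parameter derivative of the frame along the imaginary axis. -/
theorem exists_hasDerivAt_dpwSolution (a b c : ℝ) (l : Circle) :
    ∃ W : ℝ → Matrix (Fin 2) (Fin 2) ℂ, W 0 = 0 ∧ ∀ t : ℝ,
      HasDerivAt (fun θ : ℝ => dpwSolution a b c (t * I) (l * Circle.exp θ))
        (W t * dpwSolution a b c (t * I) l) 0 ∧
      HasDerivAt W (dpwSolution a b c (t * I) l * (I • dpwA' a b l) *
        (dpwSolution a b c (t * I) l)⁻¹) t := by
  have hd : ∀ t : ℝ, (dpwSolution a b c (t * I) l).det = 1 := fun t =>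
    (dpwSolution_mem_twistedLoops a b c _).2.1 l
  have hl : l * Circle.exp 0 = l := by rw [Circle.exp_zero, mul_one]
  have hmap : Continuous fun p : ℝ × ℝ => ((p.1, l * Circle.exp p.2) : ℝ × Circle) := by fun_prop
  obtain ⟨W, hW0, hW⟩ := exists_hasDerivAt_parameter (I := Set.univ) isOpen_univ
    Set.ordConnected_univ trivial (F := fun t θ => dpwSolution a b c (t * I) (l * Circle.exp θ))
    (α := fun _ => I • dpwA a b c l) (A₁ := fun _ => I • lowerCoeff a b l)
    (A₂ := fun _ => I • -upperCoeff a b l) (G := fun t => (dpwSolution a b c (t * I) l)⁻¹)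
    (c₁ := fun θ : ℝ => Complex.exp (-(θ * I)) - 1) (c₂ := fun θ : ℝ => Complex.exp (θ * I) - 1)
    continuousOn_const continuousOn_const hasDerivAt_exp_neg_sub_one hasDerivAt_exp_sub_one
    (by simp) (by simp)
    ((continuous_dpwSolution_uncurry a b c I).comp hmap).continuousOn
    (fun θ => by simp [dpwSolution_zero])
    (fun t _ θ => (hasDerivAt_dpwSolution a b c I _ t).congr_deriv (by
      rw [dpwA_mul_exp, smul_add, smul_add, smul_comm I, smul_comm I (_ - _) (-upperCoeff a b l)]))
    (by simp [dpwSolution_zero]) (fun t _ => by rw [hl]; exact inv_mul_of_det_one (hd t))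
    (fun t _ => by
      have := (hasDerivAt_dpwSolution a b c I l t).adjugate_of_right (by simp [dpwA])
      rw [← inv_eq_adjugate (hd t)] at this
      exact this.congr_of_eventuallyEq (Filter.Eventually.of_forall fun s => inv_eq_adjugate (hd s)))
  refine ⟨W, hW0, fun t => ?_⟩
  have := hW t trivial
  rw [hl] at this
  refine ⟨this.1, this.2.congr_deriv ?_⟩
  rw [dpwA'_eq, smul_add, smul_comm I (-I), smul_comm I I (-upperCoeff a b l)]

namespace ProfileSystem

variable {a b c : ℝ} {J : Set ℝ} {v r : ℝ → ℝ}

theorem stripF_eq (h : ProfileSystem a b c J v r) {x : ℝ} (hx : x ∈ J) (l : Circle) :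
    stripF a b c v x l = dpwSolution a b c x l * (stripB a b v x l).adjugate := by
  rw [stripF, inv_eq_adjugate (h.det_stripB hx l)]

theorem stripF_splitting (h : ProfileSystem a b c J v r) {x : ℝ} (hx : x ∈ J) :
    dpwSolution a b c x = stripF a b c v x * fun l : Circle => stripB a b v x l := by
  funext l
  rw [Pi.mul_apply, stripF, mul_assoc, inv_mul_of_det_one (h.det_stripB hx l), mul_one]

theorem stripF_mem_twistedLoops (h : ProfileSystem a b c J v r) {x : ℝ} (hx : x ∈ J) :
    stripF a b c v x ∈ twistedLoops :=
  mul_mem_twistedLoops (dpwSolution_mem_twistedLoops a b c x)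
    (inv_mem_twistedLoops (h.stripB_mem_plusLoops hx).1)

theorem stripF_zero (h : ProfileSystem a b c J v r) (l : Circle) : stripF a b c v 0 l = 1 := by
  rw [h.stripF_eq h.zero_mem, h.stripB_zero, Complex.ofReal_zero, dpwSolution_zero]
  simp

theorem dpwA_mul_stripF (h : ProfileSystem a b c J v r) {x : ℝ} (hx : x ∈ J) (l : Circle) :
    dpwA a b c l * stripF a b c v x l =
      stripF a b c v x l * dpwA (a * v x) (b * (v x)⁻¹) (r x) l := by
  have h1 := h.stripB_mul_dpwA hx l
  have hd := h.det_stripB hx l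
  rw [stripF, ← mul_assoc, commute_dpwA_dpwSolution]
  have h2 : dpwA a b c l * (stripB a b v x l)⁻¹ =
      (stripB a b v x l)⁻¹ * dpwA (a * v x) (b * (v x)⁻¹) (r x) l := by
    rw [← one_mul (dpwA a b c l), ← inv_mul_of_det_one hd, mul_assoc _ _ (dpwA a b c l), h1,
      mul_assoc, mul_assoc, mul_inv_of_det_one hd, mul_one]
  rw [mul_assoc, h2, mul_assoc]

/-- With `F = φB⁻¹` one gets `F' = F L - F (L - α) = F α`, using `A F = F L`. -/
theorem hasDerivAt_stripF (h : ProfileSystem a b c J v r) {x : ℝ} (hx : x ∈ J) (l : Circle) :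
    HasDerivAt (fun t => stripF a b c v t l)
      (stripF a b c v x l * frameX (a * v x) (b * (v x)⁻¹) l) x := by
  have h1 := hasDerivAt_dpwSolution a b c 1 l x
  simp only [mul_one, one_smul] at h1
  have h2 := (h.hasDerivAt_stripB hx l).adjugate_of_left (by simp)
  refine ((h1.mul h2).congr_deriv ?_).congr_of_eventuallyEq
    (Filter.eventually_of_mem (h.isOpen.mem_nhds hx) fun t ht => h.stripF_eq ht l)
  have h3 := h.dpwA_mul_stripF hx l
  rw [← commute_dpwA_dpwSolution, mul_assoc, ← h.stripF_eq hx, h3, mul_neg, ← mul_assoc,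
    ← h.stripF_eq hx, ← sub_eq_add_neg, ← mul_sub]
  congr 1
  ext i j
  fin_cases i <;> fin_cases j <;> simp [dpwA, frameX] <;> ring

/-- The coefficient `frameX` is fixed by `τ`, so `τ(F)` and `F` solve the same linear equation with
the same initial value. -/
theorem stripF_mem_realLoops (h : ProfileSystem a b c J v r) {x : ℝ} (hx : x ∈ J) :
    stripF a b c v x ∈ realLoops := by
  refine mem_realLoops_iff.2 ⟨h.stripF_mem_twistedLoops hx, 1, Or.inl rfl, fun l => ?_⟩
  rw [one_smul]
  refine eq_of_hasDerivAt_right h.isOpen h.ordConnected h.zero_mem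
    (X := fun t => tauMat (stripF a b c v t l)) (Y := fun t => stripF a b c v t l)
    (P := fun t => frameX (a * v t) (b * (v t)⁻¹) l) (fun x hx => ?_)
    (fun x hx => h.hasDerivAt_stripF hx l) (fun x => by simp [frameX])
    (by simp only [h.stripF_zero, tauMat_one]) (h.stripF_zero l) hx
    ((h.stripF_mem_twistedLoops hx).2.1 l)
  refine (tauCLM.hasFDerivAt.comp_hasDerivAt x (h.hasDerivAt_stripF hx l)).congr_deriv ?_
  refine (tauMat_mul _ _).trans ?_
  rw [tauMat_frameX]

theorem continuousOn_stripF (h : ProfileSystem a b c J v r) (l : Circle) :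
    ContinuousOn (fun p : ℝ × ℝ => stripF a b c v p.1 (l * Circle.exp p.2)) (J ×ˢ Set.univ) := by
  have hmap : Continuous fun p : ℝ × ℝ => ((p.1, l * Circle.exp p.2) : ℝ × Circle) := by fun_prop
  have h1 := ((continuous_dpwSolution_uncurry a b c 1).comp hmap).continuousOn (s := J ×ˢ Set.univ)
  have h2 : ContinuousOn (fun p : ℝ × ℝ => stripB a b v p.1 (l * Circle.exp p.2 : Circle))
      (J ×ˢ Set.univ) :=
    ContinuousOn.comp (g := fun p : ℝ × ℂ => stripB a b v p.1 p.2)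
      (f := fun p : ℝ × ℝ => ((p.1, ((l * Circle.exp p.2 : Circle) : ℂ)) : ℝ × ℂ))
      h.continuousOn_stripB (Continuous.continuousOn
        (continuous_fst.prodMk (continuous_subtype_val.comp (by fun_prop)))) fun p hp => ⟨hp.1, trivial⟩
  have h3 := adjugateCLM.continuous.comp_continuousOn h2
  refine (h1.mul h3).congr fun p hp => ?_
  rw [h.stripF_eq hp.1]
  simp only [Function.comp, mul_one]
  rfl

/-- The parameter derivative of the real factor along the real axis. -/
theorem exists_hasDerivAt_stripF (h : ProfileSystem a b c J v r) (l : Circle) :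
    ∃ W : ℝ → Matrix (Fin 2) (Fin 2) ℂ, W 0 = 0 ∧ ∀ x ∈ J,
      HasDerivAt (fun θ : ℝ => stripF a b c v x (l * Circle.exp θ)) (W x * stripF a b c v x l) 0 ∧
      HasDerivAt W (stripF a b c v x l * frameX' (a * v x) (b * (v x)⁻¹) l *
        (stripF a b c v x l)⁻¹) x := by
  have hd : ∀ x ∈ J, (stripF a b c v x l).det = 1 := fun x hx =>
    (h.stripF_mem_twistedLoops hx).2.1 l
  have hl : l * Circle.exp 0 = l := by rw [Circle.exp_zero, mul_one]
  have h1 := h.continuousOn_v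
  have h2 := h.continuousOn_inv
  have h3 : ContinuousOn (fun x => ((a * v x : ℝ) : ℂ)) J :=
    Complex.continuous_ofReal.comp_continuousOn (h1.const_mul a)
  have h4 : ContinuousOn (fun x => ((b * (v x)⁻¹ : ℝ) : ℂ)) J :=
    Complex.continuous_ofReal.comp_continuousOn (h2.const_mul b)
  obtain ⟨W, hW0, hW⟩ := exists_hasDerivAt_parameter h.isOpen h.ordConnected h.zero_mem
    (F := fun x θ => stripF a b c v x (l * Circle.exp θ))
    (α := fun x => frameX (a * v x) (b * (v x)⁻¹) l)
    (A₁ := fun x => lowerCoeff (a * v x) (b * (v x)⁻¹) l)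
    (A₂ := fun x => upperCoeff (a * v x) (b * (v x)⁻¹) l) (G := fun x => (stripF a b c v x l)⁻¹)
    (c₁ := fun θ : ℝ => Complex.exp (-(θ * I)) - 1) (c₂ := fun θ : ℝ => Complex.exp (θ * I) - 1)
    (continuousOn_matrix_iff.2 fun i j => by
      fin_cases i <;> fin_cases j <;> simp only [lowerCoeff]
      exacts [continuousOn_const, h3.mul continuousOn_const, (h4.mul continuousOn_const).neg,
        continuousOn_const])
    (continuousOn_matrix_iff.2 fun i j => by
      fin_cases i <;> fin_cases j <;> simp only [upperCoeff]
      exacts [continuousOn_const, (h4.mul continuousOn_const).neg, h3.mul continuousOn_const,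
        continuousOn_const])
    hasDerivAt_exp_neg_sub_one hasDerivAt_exp_sub_one (by simp) (by simp)
    (h.continuousOn_stripF l) (fun θ => h.stripF_zero _)
    (fun x hx θ => (h.hasDerivAt_stripF hx _).congr_deriv (by rw [frameX_mul_exp]))
    (by simp only [h.stripF_zero, inv_one])
    (fun x hx => by rw [hl]; exact inv_mul_of_det_one (hd x hx))
    (fun x hx => by
      have := (h.hasDerivAt_stripF hx l).adjugate_of_right (by simp [frameX])
      rw [← inv_eq_adjugate (hd x hx)] at this
      exact this.congr_of_eventuallyEq (Filter.eventually_of_mem (h.isOpen.mem_nhds hx)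
        fun t ht => inv_eq_adjugate (hd t ht)))
  refine ⟨W, hW0, fun x hx => ?_⟩
  have := hW x hx
  rw [hl] at this
  exact ⟨this.1, this.2.congr_deriv (by rw [frameX'_eq])⟩

/-- Explicit Iwasawa splittings on a strip, with the gradients of the frame and of its parameter
derivative. -/
theorem exists_frame (h : ProfileSystem a b c J v r) : ∃ F : ℂ → MatLoop,
    (∀ z, z.re ∈ J → F z ∈ realLoops ∧ ∃ B ∈ plusLoops, dpwSolution a b c z = F z * B) ∧
    ∀ l, ∃ W : ℂ → Matrix (Fin 2) (Fin 2) ℂ, ∀ z, z.re ∈ J →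
      HasDerivAt (fun θ : ℝ => F z (l * Circle.exp θ)) (W z * F z l) 0 ∧
      HasGrad (fun z => F z l) (F z l * frameX (a * v z.re) (b * (v z.re)⁻¹) l)
        (F z l * (I • dpwA (a * v z.re) (b * (v z.re)⁻¹) (r z.re) l)) z ∧
      HasGrad W (F z l * frameX' (a * v z.re) (b * (v z.re)⁻¹) l * (F z l)⁻¹)
        (F z l * (I • dpwA' (a * v z.re) (b * (v z.re)⁻¹) l) * (F z l)⁻¹) z := by
  -- Since `φ(x + iy) = φ(iy) φ(x)` and `φ(iy)` is real, the splitting on the real axis extends to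
  -- the strip with the same positive factor.
  let E : ℂ → MatLoop := fun z => dpwSolution a b c (z.im * I)
  have hEr : ∀ z, E z ∈ realLoops := fun z => dpwSolution_mem_realLoops a b c z.im
  have hEd : ∀ z l, (E z l).det = 1 := fun z l => (hEr z).1.2.1 l
  refine ⟨fun z => E z * stripF a b c v z.re, fun z hz => ⟨mul_mem_realLoops (hEr z)
    (h.stripF_mem_realLoops hz), _, h.stripB_mem_plusLoops hz, ?_⟩, fun l => ?_⟩
  · rw [mul_assoc, ← h.stripF_splitting hz, ← dpwSolution_add, add_comm, Complex.re_add_im]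
  obtain ⟨V, -, hV⟩ := exists_hasDerivAt_dpwSolution a b c l
  obtain ⟨W, -, hW⟩ := h.exists_hasDerivAt_stripF l
  refine ⟨fun z => V z.im + E z l * W z.re * (E z l)⁻¹, fun z hz => ?_⟩
  have hFd : (stripF a b c v z.re l).det = 1 := (h.stripF_mem_twistedLoops hz).2.1 l
  have hl : l * Circle.exp 0 = l := by rw [Circle.exp_zero, mul_one]
  have hAF := h.dpwA_mul_stripF hz
  have gE : HasGrad (fun z => E z l) 0 (E z l * (I • dpwA a b c l)) z :=
    HasGrad.of_im (g := fun t => dpwSolution a b c (t * I) l) (hasDerivAt_dpwSolution a b c I l z.im)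
  have gF : HasGrad (fun z => stripF a b c v z.re l)
      (stripF a b c v z.re l * frameX (a * v z.re) (b * (v z.re)⁻¹) l) 0 z :=
    HasGrad.of_re (g := fun t => stripF a b c v t l) (h.hasDerivAt_stripF hz l)
  have gW : HasGrad (fun z : ℂ => W z.re) _ 0 z := HasGrad.of_re (hW z.re hz).2
  have gV : HasGrad (fun z : ℂ => V z.im) 0 _ z := HasGrad.of_im (hV z.im).2
  have gEi : HasGrad (fun z => (E z l)⁻¹) 0 (-((I • dpwA a b c l) * (E z l)⁻¹)) z := by
    have := HasGrad.matrix_inv (F := fun z => E z l) (X := 0) (Y := I • dpwA a b c l) (z := z)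
      (gE.congr_grad (by rw [mul_zero]) rfl) (Filter.Eventually.of_forall fun w => hEd w l)
      (by simp) (by simp [dpwA])
    simpa using this
  -- This is the derivative in `θ` of `A F = F L`. It expresses `Ad F` of the derivative of `L` by
  -- the derivative of `A` and a bracket with `W`, which is the `y`-derivative required below.
  have hθ : dpwA' a b l * stripF a b c v z.re l + dpwA a b c l * (W z.re * stripF a b c v z.re l) =
      W z.re * (dpwA a b c l * stripF a b c v z.re l) +
        stripF a b c v z.re l * dpwA' (a * v z.re) (b * (v z.re)⁻¹) l := by
    have h1 := (hasDerivAt_dpwA_mul_exp a b c l).mul (hW z.re hz).1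
    have h2 := (hW z.re hz).1.mul (hasDerivAt_dpwA_mul_exp (a * v z.re) (b * (v z.re)⁻¹) (r z.re) l)
    have h3 : (fun θ : ℝ => dpwA a b c (l * Circle.exp θ)) *
        (fun θ : ℝ => stripF a b c v z.re (l * Circle.exp θ)) =
        (fun θ : ℝ => stripF a b c v z.re (l * Circle.exp θ)) *
        fun θ : ℝ => dpwA (a * v z.re) (b * (v z.re)⁻¹) (r z.re) (l * Circle.exp θ) :=
      funext fun θ => hAF _
    rw [h3] at h1
    have h4 := h1.unique h2
    rw [hl] at h4
    rw [h4, mul_assoc, ← hAF]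
  refine ⟨?_, ?_, ?_⟩
  · refine ((hV z.im).1.mul (hW z.re hz).1).congr_deriv ?_
    rw [hl]
    simp only [Pi.mul_apply, add_mul]
    rw [mul_assoc (V z.im), mul_assoc (E z l * W z.re), ← mul_assoc (E z l)⁻¹,
      inv_mul_of_det_one (hEd z l), one_mul, mul_assoc (E z l)]
  · refine (gE.matrix_mul gF).congr_grad ?_ ?_
    · rw [zero_mul, zero_add, ← mul_assoc]; rfl
    · rw [mul_zero, add_zero, Matrix.mul_smul, Matrix.smul_mul, mul_assoc, hAF, Matrix.mul_smul,
        ← mul_assoc]; rfl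
  · have hFi : ∀ X : Matrix (Fin 2) (Fin 2) ℂ, (E z * stripF a b c v z.re) l * X *
        ((E z * stripF a b c v z.re) l)⁻¹ =
        E z l * (stripF a b c v z.re l * X * (stripF a b c v z.re l)⁻¹) * (E z l)⁻¹ := by
      intro X
      rw [Pi.mul_apply, Matrix.mul_inv_rev]
      simp only [mul_assoc]
    refine (gV.add ((gE.matrix_mul gW).matrix_mul gEi)).congr_grad ?_ ?_
    · rw [hFi]
      simp only [zero_mul, zero_add, mul_zero, add_zero]
    · rw [hFi]
      have h5 : stripF a b c v z.re l * (I • dpwA' (a * v z.re) (b * (v z.re)⁻¹) l) *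
          (stripF a b c v z.re l)⁻¹ = I • dpwA' a b l + (I • dpwA a b c l) * W z.re -
            W z.re * (I • dpwA a b c l) := by
        have h6 := eq_sub_of_add_eq' hθ.symm
        rw [Matrix.mul_smul, h6, Matrix.smul_mul, sub_mul, add_mul]
        simp only [mul_assoc]
        rw [mul_inv_of_det_one hFd]
        simp only [mul_one, Matrix.smul_mul, Matrix.mul_smul, smul_sub, smul_add]
      rw [h5]
      simp only [mul_zero, add_zero]
      show dpwSolution a b c (z.im * I) l * (I • dpwA' a b l) * (dpwSolution a b c (z.im * I) l)⁻¹ + _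
        = dpwSolution a b c (z.im * I) l * _ * (dpwSolution a b c (z.im * I) l)⁻¹
      noncomm_ring

end ProfileSystem

end StripFrame


/-! ## The surfaces of the potential -/

section Surfaces

open scoped Matrix.Norms.Operator
open Complex (I)
open scoped ComplexConjugate

theorem isSu11_of_hasDerivAt_mul {F : MatLoop} {W : Matrix (Fin 2) (Fin 2) ℂ} {l : Circle}
    (hF : F ∈ realLoops) (hW : HasDerivAt (fun θ : ℝ => F (l * Circle.exp θ)) (W * F l) 0) :
    IsSu11 W := by
  have := isSu11_of_hasDerivAt hF (hasDerivAt_matrix_iff.1 hW)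
  rwa [mul_assoc, mul_inv_of_det_one (hF.1.2.1 l), mul_one] at this

theorem isSymBobenko_iff_eq_symFormula {H : ℝ} {F F' B B' : MatLoop}
    {W : Matrix (Fin 2) (Fin 2) ℂ} {l : Circle} (hF : F ∈ realLoops) (hF' : F' ∈ realLoops)
    (hB : B ∈ plusLoops) (hB' : B' ∈ plusLoops) (h : F * B = F' * B')
    (hW : HasDerivAt (fun θ : ℝ => F' (l * Circle.exp θ)) (W * F' l) 0) (p : R21) :
    IsSymBobenko H l F p ↔ p = symFormula H (F' l) W := by
  rw [isSymBobenko_iff_of_splittings hF hF' hB hB' h (hasDerivAt_matrix_iff.1 hW), mul_assoc,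
    mul_inv_of_det_one (hF'.1.2.1 l), mul_one]

theorem adAct_ofSu11 {G X : Matrix (Fin 2) (Fin 2) ℂ} (hX : IsSu11 X) :
    adAct G (ofSu11 X) = ofSu11 (G * X * G⁻¹) := by
  rw [adAct_apply, hX.toSu11_ofSu11]

theorem adAct_mul {G F : Matrix (Fin 2) (Fin 2) ℂ} (hF : IsSU11 F) (p : R21) :
    adAct (G * F) p = adAct G (adAct F p) := by
  rw [adAct_apply G, hF.toSu11_adAct, adAct_apply, Matrix.mul_inv_rev]
  simp only [mul_assoc]

/-- Left multiplication of a frame by a real loop moves the surface by an isometry: `Ad G` is its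
linear part, and the logarithmic derivative `V` of `G` in `θ` gives the translation. -/
theorem symFormula_mul (H : ℝ) {G F W V : Matrix (Fin 2) (Fin 2) ℂ} (hF : IsSU11 F)
    (hW : IsSu11 W) : symFormula H (G * F) (V + G * W * G⁻¹) =
      adAct G (symFormula H F W) + (-(1 / (2 * H)) * 2) • ofSu11 V := by
  rw [symFormula_eq, symFormula_eq, adAct_mul hF, mul_smul]
  simp only [map_smul, map_add, adAct_ofSu11 hW, smul_add]
  abel

theorem hasDerivAt_mul_loop {G F : MatLoop} {V W : Matrix (Fin 2) (Fin 2) ℂ} {l : Circle}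
    (hG : (G l).det = 1) (hV : HasDerivAt (fun θ : ℝ => G (l * Circle.exp θ)) (V * G l) 0)
    (hW : HasDerivAt (fun θ : ℝ => F (l * Circle.exp θ)) (W * F l) 0) :
    HasDerivAt (fun θ : ℝ => (G * F) (l * Circle.exp θ))
      ((V + G l * W * (G l)⁻¹) * (G * F) l) 0 := by
  refine (hV.mul hW).congr_deriv ?_
  rw [Circle.exp_zero, mul_one, Pi.mul_apply, add_mul, mul_assoc V, mul_assoc (G l * W),
    ← mul_assoc (G l)⁻¹, inv_mul_of_det_one hG, one_mul, mul_assoc (G l)]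

theorem hasDerivAt_of_splitting {a b c : ℝ} {z : ℂ} {F B : MatLoop} (hF : F ∈ realLoops)
    (hB : B ∈ plusLoops) (hφ : dpwSolution a b c z = F * B) (l : Circle) :
    ∃ W, HasDerivAt (fun θ : ℝ => F (l * Circle.exp θ)) (W * F l) 0 := by
  refine ⟨Matrix.of (fun i j => deriv (fun θ : ℝ => F (l * Circle.exp θ) i j) 0) * (F l)⁻¹, hasDerivAt_matrix_iff.2 fun i j => ?_⟩
  rw [mul_assoc, inv_mul_of_det_one (hF.1.2.1 l), mul_one]
  exact (differentiableAt_of_splitting hF hB hφ l i j).hasDerivAt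

/-- Picard-Lindelöf near `(1, c)`, on an interval short enough for `v` to stay positive. A local
profile is enough, because every point of the domain is moved to `0`. -/
theorem exists_profileSystem (a b c : ℝ) : ∃ J v r, ProfileSystem a b c J v r := by
  let G : ℝ × ℝ → ℝ × ℝ := fun p => (2 * p.1 * p.2, 2 * a ^ 2 * p.1 ^ 2 - 2 * b ^ 2 * p.1⁻¹ ^ 2)
  have hG : ContDiffAt ℝ 1 G (1, c) := by
    have h1 : ContDiffAt ℝ 1 (fun p : ℝ × ℝ => p.1⁻¹) (1, c) :=
      contDiffAt_fst.inv one_ne_zero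
    have h2 : ContDiffAt ℝ 1 (fun p : ℝ × ℝ => p.1) (1, c) := contDiffAt_fst
    have h3 : ContDiffAt ℝ 1 (fun p : ℝ × ℝ => p.2) (1, c) := contDiffAt_snd
    exact ((contDiffAt_const.mul h2).mul h3).prodMk
      ((contDiffAt_const.mul (h2.pow 2)).sub (contDiffAt_const.mul (h1.pow 2)))
  obtain ⟨α, hα0, ε, hε, hα⟩ := hG.exists_forall_mem_closedBall_exists_eq_forall_mem_Ioo_hasDerivAt₀ 0
  have hα0' : HasDerivAt α (G (α 0)) 0 := hα 0 ⟨by linarith, by linarith⟩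
  have hpos : ∀ᶠ x in nhds 0, 0 < (α x).1 :=
    (continuous_fst.continuousAt.comp hα0'.continuousAt).eventually
      (lt_mem_nhds (by simp [hα0]))
  obtain ⟨δ, hδ, hδ'⟩ := Metric.eventually_nhds_iff_ball.1 hpos
  have hmem : ∀ x ∈ Set.Ioo (-min δ ε) (min δ ε), 0 < (α x).1 ∧ HasDerivAt α (G (α x)) x := by
    intro x hx
    have h1 := min_le_left δ ε
    have h2 := min_le_right δ ε
    refine ⟨hδ' x ?_, hα x ⟨by linarith [hx.1], by linarith [hx.2]⟩⟩
    rw [Metric.mem_ball, Real.dist_eq, sub_zero, abs_lt]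
    exact ⟨by linarith [hx.1], by linarith [hx.2]⟩
  exact ⟨Set.Ioo (-min δ ε) (min δ ε), fun x => (α x).1, fun x => (α x).2,
    { isOpen := isOpen_Ioo
      ordConnected := Set.ordConnected_Ioo
      zero_mem := ⟨by simp [hδ, hε], by simp [hδ, hε]⟩
      pos := fun x hx => (hmem x hx).1
      hasDerivAt_v := fun x hx => (hmem x hx).2.fst
      hasDerivAt_r := fun x hx => (hmem x hx).2.snd
      v_zero := by simp [hα0]
      r_zero := by simp [hα0] }⟩

theorem FrameSystem.congr_profile {a b H p q : ℝ} {U : Set ℂ} {v r v' r' : ℂ → ℝ}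
    {e₁ e₂ e₃ f : ℂ → R21} (h : FrameSystem a b H p q U v r e₁ e₂ e₃ f) (hv : Set.EqOn v' v U)
    (hr : Set.EqOn r' r U) : FrameSystem a b H p q U v' r' e₁ e₂ e₃ f where
  isOpen := h.isOpen
  v_ne z hz := by rw [hv hz]; exact h.v_ne z hz
  grad_v z hz := by
    rw [hv hz, hr hz]
    exact (h.grad_v z hz).congr_of_eventuallyEq
      (Filter.eventually_of_mem (h.isOpen.mem_nhds hz) hv)
  grad_r z hz := by
    rw [hv hz]
    exact (h.grad_r z hz).congr_of_eventuallyEq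
      (Filter.eventually_of_mem (h.isOpen.mem_nhds hz) hr)
  grad_f z hz := by rw [hv hz]; exact h.grad_f z hz
  grad_e₁ z hz := by rw [hv hz, hr hz]; exact h.grad_e₁ z hz
  grad_e₂ z hz := by rw [hv hz, hr hz]; exact h.grad_e₂ z hz
  grad_e₃ z hz := by rw [hv hz]; exact h.grad_e₃ z hz
  norm_e₁ := h.norm_e₁
  norm_e₂ := h.norm_e₂
  norm_e₃ := h.norm_e₃
  orth₁₂ := h.orth₁₂
  orth₁₃ := h.orth₁₃
  orth₂₃ := h.orth₂₃
  cross := h.cross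

/-- The surface of a profile on its strip, with its structure equations. -/
theorem ProfileSystem.exists_surface {a b c : ℝ} {J : Set ℝ} {v r : ℝ → ℝ}
    (h : ProfileSystem a b c J v r) (H : ℝ) (l : Circle) :
    ∃ (F : ℂ → MatLoop) (W : ℂ → Matrix (Fin 2) (Fin 2) ℂ) (e₁ e₂ e₃ : ℂ → R21),
      (∀ z, z.re ∈ J → F z ∈ realLoops ∧ ∃ B ∈ plusLoops, dpwSolution a b c z = F z * B) ∧
      (∀ z, z.re ∈ J → HasDerivAt (fun θ : ℝ => F z (l * Circle.exp θ)) (W z * F z l) 0) ∧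
      FrameSystem a b H (((l : ℂ) ^ 2).re) (((l : ℂ) ^ 2).im) {z | z.re ∈ J} (fun z => v z.re)
        (fun z => r z.re) e₁ e₂ e₃ (fun z => symFormula H (F z l) (W z)) := by
  obtain ⟨F, hF, hW⟩ := h.exists_frame
  obtain ⟨W, hW⟩ := hW l
  exact ⟨F, W, _, _, _, hF, fun z hz => (hW z hz).1,
    frameSystem_symFormula l (h.isOpen.preimage Complex.continuous_re)
      (fun z hz => (h.pos _ hz).ne') (fun z hz => HasGrad.of_re (h.hasDerivAt_v _ hz))
      (fun z hz => HasGrad.of_re (h.hasDerivAt_r _ hz))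
      (fun z hz => isSU11_of_mem_realLoops (hF z hz).1 l) (fun z hz => (hW z hz).2.1)
      fun z hz => (hW z hz).2.2⟩

theorem IsConformalCMCImmersion.of_locally {U : Set ℂ} {f : ℂ → R21} {H : ℝ}
    (h : ∀ z ∈ U, ∃ V ⊆ U, z ∈ V ∧ IsConformalCMCImmersion V f H) :
    IsConformalCMCImmersion U f H where
  isOpen := isOpen_iff_mem_nhds.2 fun z hz => by
    obtain ⟨V, hVU, hzV, hV⟩ := h z hz
    exact Filter.mem_of_superset (hV.isOpen.mem_nhds hzV) hVU
  smooth z hz := by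
    obtain ⟨V, hVU, hzV, hV⟩ := h z hz
    exact (hV.smooth.contDiffAt (hV.isOpen.mem_nhds hzV)).contDiffWithinAt
  spacelike z hz := by
    obtain ⟨V, hVU, hzV, hV⟩ := h z hz
    exact hV.spacelike z hzV
  conformal z hz := by
    obtain ⟨V, hVU, hzV, hV⟩ := h z hz
    exact hV.conformal z hzV
  cmc z hz := by
    obtain ⟨V, hVU, hzV, hV⟩ := h z hz
    exact hV.cmc z hzV

theorem dpwSolution_conj {a b c a' b' c' : ℝ} {B : MatLoop} (hB : ∀ l, (B l).det = 1)
    (h : ∀ l, B l * dpwA a b c l = dpwA a' b' c' l * B l) (z : ℂ) :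
    B * dpwSolution a b c z = dpwSolution a' b' c' z * B := by
  funext l
  have hu : IsUnit (B l) := isUnit_of_mul_eq_one (mul_inv_of_det_one (hB l))
  have h1 : z • dpwA a' b' c' l = B l * (z • dpwA a b c l) * (B l)⁻¹ := by
    rw [Matrix.mul_smul, Matrix.smul_mul, h, mul_assoc, mul_inv_of_det_one (hB l), mul_one]
  simp only [Pi.mul_apply, dpwSolution]
  rw [h1, Matrix.exp_conj _ _ hu, mul_assoc, inv_mul_of_det_one (hB l), mul_one]

/-- At `z₀` with `φ(z₀) = F₀B₀`, the conjugation `B₀A = A'B₀` gives `φ(z₀ + w) = F₀ exp(wA') B₀`.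
Near `z₀` the surface is therefore an isometric image of the strip surface of `A'`; this also shows
that the domain is open. -/
theorem isConformalCMCImmersion_dpwDomain {a b c H : ℝ} (ha : a ≠ 0) (hH : H ≠ 0) {l : Circle}
    {F : ℂ → MatLoop} (hF : IsIwasawaFrame a b c F) {f : ℂ → R21}
    (hf : IsSymBobenkoSurface a b c H l F f) : IsConformalCMCImmersion (dpwDomain a b c) f H := by
  refine IsConformalCMCImmersion.of_locally fun z₀ hz₀ => ?_
  obtain ⟨F₀, hF₀, B₀, hB₀, β, r₀, hβ, hφ, hA⟩ := exists_normalized_splitting hz₀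
  obtain ⟨J, v, r, h⟩ := exists_profileSystem (a * β ^ 2) (b * (β ^ 2)⁻¹) r₀
  obtain ⟨G, W, e₁, e₂, e₃, hG, hW, hs⟩ := h.exists_surface H l
  obtain ⟨V, hV⟩ := hasDerivAt_of_splitting hF₀ hB₀ hφ l
  have hsplit : ∀ z : ℂ, (z - z₀).re ∈ J → ∃ B ∈ plusLoops,
      dpwSolution a b c z = (F₀ * G (z - z₀)) * B := by
    intro z hz
    obtain ⟨-, B, hB, hGB⟩ := hG _ hz
    refine ⟨B * B₀, mul_mem_plusLoops hB hB₀, ?_⟩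
    rw [show z = z₀ + (z - z₀) by ring, dpwSolution_add, hφ, mul_assoc,
      dpwSolution_conj hB₀.1.2.1 hA, hGB, add_sub_cancel_left]
    simp only [mul_assoc]
  have hmem : ∀ z : ℂ, (z - z₀).re ∈ J → z ∈ dpwDomain a b c := fun z hz => by
    obtain ⟨B, hB, hz'⟩ := hsplit z hz
    exact mem_dpwDomain_of_splitting (mul_mem_realLoops hF₀ (hG _ hz).1) hB hz'
  have hsu := isSU11_of_mem_realLoops hF₀ l
  refine ⟨{z | (z - z₀).re ∈ J}, hmem, by simpa using h.zero_mem, ?_⟩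
  have hsys := ((hs.comp_sub z₀).map (adAct (F₀ l)) ((-(1 / (2 * H)) * 2) • ofSu11 V)
    hsu.lorentz_adAct hsu.lorentzCross_adAct).congr (hs.comp_sub z₀).isOpen subset_rfl (f' := f) ?_
  · exact hsys.isConformalCMCImmersion (mul_ne_zero ha (by positivity)) hH
  · intro z hz
    obtain ⟨B, hB, hz'⟩ := hsplit z hz
    obtain ⟨hFz, B', hB', hz''⟩ := hF z (hmem z hz)
    have h1 := (isSymBobenko_iff_eq_symFormula hFz (mul_mem_realLoops hF₀ (hG _ hz).1) hB' hB
      (hz''.symm.trans hz') (hasDerivAt_mul_loop (hF₀.1.2.1 l) hV (hW _ hz)) (f z)).1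
      (hf z (hmem z hz))
    rw [h1, Pi.mul_apply, symFormula_mul H (isSU11_of_mem_realLoops (hG _ hz).1 l)
      (isSu11_of_hasDerivAt_mul (hG _ hz).1 (hW _ hz))]

theorem isEquivariantInY_dpwDomain {a b c H : ℝ} {l : Circle}
    {F : ℂ → MatLoop} (hF : IsIwasawaFrame a b c F) {f : ℂ → R21}
    (hf : IsSymBobenkoSurface a b c H l F f) : IsEquivariantInY (dpwDomain a b c) f := by
  obtain ⟨V, -, hV⟩ := exists_hasDerivAt_dpwSolution a b c l
  have hr : ∀ t : ℝ, dpwSolution a b c (t * I) ∈ realLoops := dpwSolution_mem_realLoops a b c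
  have hsu : ∀ t : ℝ, IsSU11 (dpwSolution a b c (t * I) l) := fun t =>
    isSU11_of_mem_realLoops (hr t) l
  have hVsu : ∀ t, IsSu11 (V t) := fun t => isSu11_of_hasDerivAt_mul (hr t) (hV t).1
  have hadd : ∀ s t : ℝ, dpwSolution a b c ((s + t : ℝ) * I) =
      dpwSolution a b c (s * I) * dpwSolution a b c (t * I) := fun s t => by
    rw [← dpwSolution_add]; congr 1; push_cast; ring
  -- The cocycle identity for the translation parts, from differentiating `φ((s+t)i) = φ(si) φ(ti)`
  -- in `θ`. It makes `R` a homomorphism.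
  have hVadd : ∀ s t : ℝ, V (s + t) = V s + dpwSolution a b c (s * I) l * V t *
      (dpwSolution a b c (s * I) l)⁻¹ := by
    intro s t
    have h1 := (hV (s + t)).1
    have h2 := hasDerivAt_mul_loop ((hr s).1.2.1 l) (hV s).1 (hV t).1
    rw [hadd] at h1
    have h3 := congrArg (fun M => M * (dpwSolution a b c ((s + t : ℝ) * I) l)⁻¹) (h1.unique h2)
    simp only [← hadd, mul_assoc _ (dpwSolution a b c ((s + t : ℝ) * I) l),
      mul_inv_of_det_one ((hr (s + t)).1.2.1 l), mul_one] at h3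
    exact h3
  have hex : ∀ t : ℝ, ∃ g : R21 ≃ᵃ[ℝ] R21, IsLorentzIsometry g ∧ ∀ p, g p =
      adAct (dpwSolution a b c (t * I) l) p + (-(1 / (2 * H)) * 2) • ofSu11 (V t) := fun t =>
    exists_affineEquiv_of_lorentz _ _ (hsu t).lorentz_adAct
  choose R hR hRp using hex
  refine ⟨R, hR, fun s t => ?_, fun p => ?_, fun z hz t => ?_⟩
  · ext1 p
    rw [AffineEquiv.coe_mul, Function.comp_apply]
    rw [hRp, hRp, hRp, hadd, Pi.mul_apply, adAct_mul (hsu t), map_add, map_smul,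
      adAct_ofSu11 (hVsu t), hVadd, map_add, smul_add]
    abel
  · simp only [hRp, adAct_apply]
    have h1 : Continuous fun t : ℝ => dpwSolution a b c (t * I) l := continuous_iff_continuousAt.2
      fun t => (hasDerivAt_dpwSolution a b c I l t).continuousAt
    have h2 : Continuous V := continuous_iff_continuousAt.2 fun t => (hV t).2.continuousAt
    have h3 : Continuous fun t : ℝ => (dpwSolution a b c (t * I) l)⁻¹ := by
      simp only [inv_eq_adjugate ((hr _).1.2.1 l)]
      exact adjugateCLM.continuous.comp h1
    have h4 : Continuous fun t => (-(1 / (2 * H)) * 2) • ofSu11 (V t) :=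
      (continuous_const_smul (-(1 / (2 * H)) * 2)).comp (ofSu11.continuous.comp h2)
    exact (ofSu11.continuous.comp ((h1.mul continuous_const).mul h3)).add h4
  · obtain ⟨hFz, B, hB, hφ⟩ := hF z hz
    have hsplit : dpwSolution a b c (z + t * I) = (dpwSolution a b c (t * I) * F z) * B := by
      rw [add_comm, dpwSolution_add, hφ, mul_assoc]
    have hMF := mul_mem_realLoops (hr t) hFz
    have hz' := mem_dpwDomain_of_splitting hMF hB hsplit
    refine ⟨hz', ?_⟩
    obtain ⟨W, hW⟩ := hasDerivAt_of_splitting hFz hB hφ l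
    obtain ⟨hFz', B', hB', hφ'⟩ := hF _ hz'
    have h1 := (isSymBobenko_iff_eq_symFormula hFz' hMF hB' hB (hφ'.symm.trans hsplit)
      (hasDerivAt_mul_loop ((hr t).1.2.1 l) (hV t).1 hW) _).1 (hf _ hz')
    have h2 := (isSymBobenko_iff_eq_symFormula hFz hFz hB hB rfl hW _).1 (hf z hz)
    rw [h1, h2, hRp, Pi.mul_apply, symFormula_mul H (isSU11_of_mem_realLoops hFz l)
      (isSu11_of_hasDerivAt_mul hFz hW)]

theorem exists_isSymBobenkoSurface {a b c H : ℝ} {l : Circle} {F : ℂ → MatLoop}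
    (hF : IsIwasawaFrame a b c F) : ∃ f, IsSymBobenkoSurface a b c H l F f := by
  have h : ∀ z, ∃ p, z ∈ dpwDomain a b c → IsSymBobenko H l (F z) p := fun z => by
    by_cases hz : z ∈ dpwDomain a b c
    · obtain ⟨hFz, B, hB, hφ⟩ := hF z hz
      obtain ⟨p, hp⟩ := exists_isSymBobenko_of_splitting (H := H) (l := l) hFz hB hφ
      exact ⟨p, fun _ => hp⟩
    · exact ⟨0, fun h => absurd h hz⟩
  choose f hf using h
  exact ⟨f, hf⟩

theorem Circle.exists_sq_eq {p q : ℝ} (h : p ^ 2 + q ^ 2 = 1) :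
    ∃ l : Circle, ((l : ℂ) ^ 2).re = p ∧ ((l : ℂ) ^ 2).im = q := by
  have hn : ‖(⟨p, q⟩ : ℂ)‖ = 1 := by
    rw [Complex.norm_def, Complex.normSq_mk, ← pow_two, ← pow_two, h, Real.sqrt_one]
  have hl : ((Circle.exp (Complex.arg ⟨p, q⟩ / 2) : Circle) : ℂ) ^ 2 = ⟨p, q⟩ := by
    have := Complex.norm_mul_exp_arg_mul_I ⟨p, q⟩
    rw [hn, Complex.ofReal_one, one_mul] at this
    rw [Circle.coe_exp, ← Complex.exp_nat_mul]
    refine Eq.trans ?_ this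
    congr 1
    push_cast
    ring
  exact ⟨_, by rw [hl], by rw [hl]⟩

/-- An equivariant surface with constant mean curvature is obtained from its profile. -/
theorem IsConformalCMCImmersion.exists_eq_symBobenko {H : ℝ} {U : Set ℂ} {f : ℂ → R21} (hH : H ≠ 0)
    (hU : IsConnected U) (hf : IsConformalCMCImmersion U f H) (he : IsEquivariantInY U f)
    (hn : ∃ z ∈ U, ¬ IsUmbilicAt f z) {z₀ : ℂ} (hz₀ : z₀ ∈ U) :
    ∃ (a b c : ℝ) (l₀ : Circle) (F : ℂ → MatLoop) (fhat : ℂ → R21) (g : R21 ≃ᵃ[ℝ] R21),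
      a ≠ 0 ∧ b ≠ 0 ∧ IsIwasawaFrame a b c F ∧ IsSymBobenkoSurface a b c H l₀ F fhat ∧
      IsLorentzIsometry g ∧
      ∀ z ∈ U, z - z₀ ∈ dpwDomain a b c ∧ f z = g (fhat (z - z₀)) := by
  obtain ⟨a, b, p, q, v, r, e₁, e₂, e₃, ha, hb, hpq, hv0, hv, hvt, hrt, hs⟩ :=
    hf.exists_frameSystem hH hU he hn hz₀
  obtain ⟨l₀, rfl, rfl⟩ := Circle.exists_sq_eq hpq
  have hinv : ∀ z ∈ U, ∀ t : ℝ, z + t * I ∈ U := fun z hz t => by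
    obtain ⟨R, -, -, -, hR⟩ := he
    exact (hR z hz t).1
  have heq : ∀ z : ℂ, z₀ + ((z - z₀).re : ℂ) = z + ((z₀ - z).im : ℝ) * I := fun z => by
    apply Complex.ext <;> simp
  have hmemU : ∀ z ∈ U, z₀ + ((z - z₀).re : ℂ) ∈ U := fun z hz => by
    rw [heq]; exact hinv z hz _
  have hpoint : ∀ x : ℝ, HasDerivAt (fun x : ℝ => z₀ + (x : ℂ)) 1 x := fun x =>
    (Complex.ofRealCLM.hasDerivAt (x := x)).const_add z₀
  have hline : ∀ {g : ℂ → ℝ} {X : ℝ} {x : ℝ}, HasGrad g X 0 (z₀ + x) →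
      HasDerivAt (fun x : ℝ => g (z₀ + x)) X x := fun {g X x} hg => by
    have := HasFDerivAt.comp_hasDerivAt (f := fun x : ℝ => z₀ + (x : ℂ)) x hg (hpoint x)
    refine this.congr_deriv ?_
    simp
  -- The profile is read off along the horizontal line through `z₀`, so `c` has to be `r z₀`.
  have hP : ProfileSystem a b (r z₀) {x : ℝ | z₀ + (x : ℂ) ∈ U} (fun x => v (z₀ + x))
      (fun x => r (z₀ + x)) :=
    { isOpen := hs.isOpen.preimage (by fun_prop)
      ordConnected := by
        -- As `U` is invariant in `y`, its intersection with the line is the projection of `U`,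
        -- hence connected, and it determines all of `U`.
        have h1 : {x : ℝ | z₀ + (x : ℂ) ∈ U} = (fun z : ℂ => (z - z₀).re) '' U := by
          ext x
          constructor
          · intro hx
            exact ⟨_, hx, by simp⟩
          · rintro ⟨z, hz, rfl⟩
            exact hmemU z hz
        rw [h1]
        exact (hU.isPreconnected.image _ (by fun_prop)).ordConnected
      zero_mem := by simpa using hz₀
      pos := fun x hx => hv _ hx
      hasDerivAt_v := fun x hx => hline (hs.grad_v _ hx)
      hasDerivAt_r := fun x hx => hline (hs.grad_r _ hx)
      v_zero := by simpa using hv0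
      r_zero := by simp }
  obtain ⟨G, W, e₁', e₂', e₃', hG, hW, hs'⟩ := hP.exists_surface H l₀
  obtain ⟨F, hF⟩ := exists_isIwasawaFrame a b (r z₀)
  obtain ⟨fhat, hfhat⟩ := exists_isSymBobenkoSurface (H := H) (l := l₀) hF
  have hdom : ∀ z ∈ U, z - z₀ ∈ dpwDomain a b (r z₀) := fun z hz => by
    obtain ⟨hGz, B, hB, hφ⟩ := hG (z - z₀) (hmemU z hz)
    exact mem_dpwDomain_of_splitting hGz hB hφ
  -- The constructed surface has the same constants and, by invariance in `y`, the same `v` and `r`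
  -- on `U` as the given one, which is what rigidity requires.
  have hs'' := ((hs'.comp_sub z₀).congr (f' := fun z => fhat (z - z₀)) hs.isOpen
    (fun z hz => hmemU z hz) (fun z hz => by
      obtain ⟨hGz, B, hB, hφ⟩ := hG (z - z₀) (hmemU z hz)
      obtain ⟨hFz, B', hB', hφ'⟩ := hF (z - z₀) (hdom z hz)
      exact (isSymBobenko_iff_eq_symFormula hFz hGz hB' hB (hφ'.symm.trans hφ)
        (hW (z - z₀) (hmemU z hz)) _).1 (hfhat _ (hdom z hz)))).congr_profile (v' := v) (r' := r)
    (fun z hz => by simp only [heq]; exact (hvt z hz _).symm)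
    (fun z hz => by simp only [heq]; exact (hrt z hz _).symm)
  obtain ⟨g, hg, hgf⟩ := hs.exists_isometry hs'' hU
  exact ⟨a, b, r z₀, l₀, F, fhat, g, ha, hb, hF, hfhat, hg, fun z hz => ⟨hdom z hz, hgf z hz⟩⟩

end Surfaces

theorem corollary5p5 :
    (∀ a b c H : ℝ, a ≠ 0 → b ≠ 0 → H ≠ 0 → ∀ l₀ : Circle,
      (0 : ℂ) ∈ dpwDomain a b c ∧
      (∃ F : ℂ → MatLoop, IsIwasawaFrame a b c F) ∧
      ∀ F : ℂ → MatLoop, IsIwasawaFrame a b c F →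
        (∃ f : ℂ → R21, IsSymBobenkoSurface a b c H l₀ F f) ∧
        ∀ f : ℂ → R21, IsSymBobenkoSurface a b c H l₀ F f →
          IsConformalCMCImmersion (dpwDomain a b c) f H ∧
          IsEquivariantInY (dpwDomain a b c) f) ∧
    (∀ (H : ℝ) (U : Set ℂ) (f : ℂ → R21), H ≠ 0 → IsConnected U →
      IsConformalCMCImmersion U f H → IsEquivariantInY U f →
      (∃ z ∈ U, ¬ IsUmbilicAt f z) →
      ∀ z₀ ∈ U, ∃ (a b c : ℝ) (l₀ : Circle) (F : ℂ → MatLoop) (fhat : ℂ → R21)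
          (g : R21 ≃ᵃ[ℝ] R21),
        a ≠ 0 ∧ b ≠ 0 ∧ IsIwasawaFrame a b c F ∧
        IsSymBobenkoSurface a b c H l₀ F fhat ∧ IsLorentzIsometry g ∧
        ∀ z ∈ U, z - z₀ ∈ dpwDomain a b c ∧ f z = g (fhat (z - z₀))) :=
  ⟨fun a b c _ ha _ hH _ => ⟨zero_mem_dpwDomain a b c, exists_isIwasawaFrame a b c,
    fun _ hF => ⟨exists_isSymBobenkoSurface hF, fun _ hf =>
      ⟨isConformalCMCImmersion_dpwDomain ha hH hF hf, isEquivariantInY_dpwDomain hF hf⟩⟩⟩,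
    fun _ _ _ hH hU hf he hn _ hz₀ => hf.exists_eq_symBobenko hH hU he hn hz₀⟩
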